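/- **Setting.** Let $n\ge 0$, let $\mathbb A_n=\{a_1,\dots,a_n,\overline{a_1},\dots,\overline{a_n}\}$ be an alphabet of $2n$ letters with the involution $x\mapsto\overline x$, and put $\overline{x_0x_1\cdots x_m}=\overline{x_m}\cdots\overline{x_1}\,\overline{x_0}$ for linear words. A linear word is *freely reduced* if no two consecutive letters have the form $x\overline x$. A *cyclic word* $\mathcal W=c(W)$ is a linear word $W$ up to rotation; the linear words $W$ with $\mathcal W=c(W)$ are its linear representatives. A cyclic word is *reduced* if it is non-empty and all its linear representatives are freely reduced; $l(\cdot)$ is the length. Fix a *surface symbol* $\mathcal O$: a cyclic word in which every letter of $\mathbb A_n$ appears exactly once. For a cyclic word $\mathcal W$ let $o(\mathcal W)=1$ if the letters of $\mathcal W$ are pairwise distinct and occur in $\mathcal O$ in the same cyclic order, $o(\mathcal W)=-1$ if they are pairwise distinct and occur in $\mathcal O$ in the opposite cyclic order, and $o(\mathcal W)=0$ otherwise (this is used for words of three or four letters only). **Linked pairs.** A pair $(P,Q)$ of freely reduced linear words of length at least $2$ is *linked* if one of the following holds. 1. $P=p_1p_2$, $Q=q_1q_2$ and $o(c(\overline{p_1}\,\overline{q_1}p_2q_2))\ne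 0$; then $\operatorname{sign}(P,Q)=o(c(\overline{p_1}\,\overline{q_1}p_2q_2))$. 2. $P=p_1Yp_2$, $Q=q_1Yq_2$, $p_1\neq q_1$, $p_2\neq q_2$, where $Y$ is a non-empty word with first letter $x_1$ and last letter $x_2$, and $o(c(\overline{p_1}\,\overline{q_1}x_1))=o(c(p_2q_2\overline{x_2}))$; then $\operatorname{sign}(P,Q)=o(c(\overline{p_1}\,\overline{q_1}x_1))$. 3. $P=p_1Yp_2$, $Q=q_1\overline Yq_2$, $p_1\neq\overline{q_2}$, $p_2\neq\overline{q_1}$, where $Y$ is a non-empty word with first letter $x_1$ and last letter $x_2$, and $o(c(q_2\overline{p_1}x_1))=o(c(\overline{q_1}p_2\overline{x_2}))$; then $\operatorname{sign}(P,Q)=o(c(q_2\overline{p_1}x_1))$. For a reduced cyclic word $\mathcal W$, let $\mathbb{LP}_1(\mathcal W)$ be the set of pairs of occurrences, in the cyclic word $\mathcal W$, of linear subwords $P$ and $Q$ of $\mathcal W$ (of length at most $l(\mathcal W)$) such that $(P,Q)$ is linked. For reduced cyclic words $\mathcal V,\mathcal W$, let $\mathbb{LP}_2(\mathcal V,\mathcal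 W)$ be the set of pairs of an occurrence of a subword $P$ of a power of $\mathcal V$ and an occurrence of a subword $Q$ of a power of $\mathcal W$ such that $(P,Q)$ is linked; an occurrence is determined by the length of the subword and by the position of its first letter, which counts modulo $l(\mathcal V)$, respectively $l(\mathcal W)$. **The operations.** Let $\Bbbk$ be a commutative ring (for example a field) and $\mathbb V$ the free $\Bbbk$-module on the reduced cyclic words in $\mathbb A_n$. For $(P,Q)\in\mathbb{LP}_1(\mathcal W)$ put $\delta_1(P,Q)=c(W_1)$ and $\delta_2(P,Q)=c(W_2)$. In types 1 and 2, $W_1$ and $W_2$ are the two linear words obtained by cutting $\mathcal W$ immediately before $p_2$ and immediately before $q_2$, with $W_1$ starting at $p_2$ and $W_2$ starting at $q_2$. In type 3, $W_1$ is the part of $\mathcal W$ from $p_2$ to $q_1$ and $W_2$ is the part from $q_2$ to $p_1$. Define $$\delta(\mathcal W)=\sum_{(P,Q)\in\mathbb{LP}_1(\mathcal W)}\operatorname{sign}(P,Q)\,\delta_1(P,Q)\otimes\delta_2(P,Q).$$ For $(P,Q)\in\mathbb{LP}_2(\mathcal V,\mathcal W)$ of type 1 or 2 put $\gamma(P,Q)=c(V_1W_1)$,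 where $V_1$ is the linear representative of $\mathcal V$ cut immediately before $p_2$ and $W_1$ is that of $\mathcal W$ cut immediately before $q_2$. For type 3, if $l(Y)\le l(\mathcal V)$ and $l(Y)\le l(\mathcal W)$, put $\gamma(P,Q)=c(V_1W_1)$, where $V_1$ (possibly empty) is the part of $\mathcal V$ that starts right after $Y$ and ends right before $Y$, and $W_1$ (possibly empty) is the part of $\mathcal W$ that starts right after $\overline Y$ and ends right before $\overline Y$. For type 3 in the remaining cases, $\gamma(P,Q)$ is the cyclic word obtained from $c(V'W')$ by free and cyclic reduction, where $V'$ is the linear representative of $\mathcal V$ cut right after the end of $Y$ and $W'$ is that of $\mathcal W$ cut right before the beginning of $\overline Y$. Define $$[\mathcal V,\mathcal W]=\sum_{(P,Q)\in\mathbb{LP}_2(\mathcal V,\mathcal W)}\operatorname{sign}(P,Q)\,\gamma(P,Q).$$ **Theorem.** For reduced cyclic words, the sets $\mathbb{LP}_1(\mathcal W)$ and $\mathbb{LP}_2(\mathcal V,\mathcal W)$ are finite and the cyclic words $\delta_1(P,Q)$, $\delta_2(P,Q)$, $\gamma(P,Q)$ are reduced, so that the formulas above define linear maps $\delta:\mathbb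 V\to\mathbb V\otimes\mathbb V$ and $[\;,\;]:\mathbb V\otimes\mathbb V\to\mathbb V$. The triple $(\mathbb V,[\;,\;],\delta)$ is an involutive Lie bialgebra. That is, with $s(x\otimes y)=y\otimes x$, $\varepsilon(x\otimes y\otimes z)=z\otimes x\otimes y$ and $x\cdot(y\otimes z)=[x,y]\otimes z+y\otimes[x,z]$: - $[\;,\;]\circ s=-[\;,\;]$ and $[\;,\;]\circ(\mathrm{id}\otimes[\;,\;])\circ(\mathrm{id}+\varepsilon+\varepsilon^2)=0$; - $s\circ\delta=-\delta$ and $(\mathrm{id}+\varepsilon+\varepsilon^2)\circ(\mathrm{id}\otimes\delta)\circ\delta=0$; - $\delta([x,y])=x\cdot\delta(y)-y\cdot\delta(x)$ for all $x,y\in\mathbb V$; - $[\;,\;]\circ\delta=0$. -/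

import Mathlib

open scoped TensorProduct

/-! ### Lie algebras, Lie coalgebras and Lie bialgebras over a commutative ring -/

namespace LieBialg

variable {𝕜 : Type*} [CommRing 𝕜] {A : Type*} [AddCommGroup A] [Module 𝕜 A]

/-- The flip `s (x ⊗ y) = y ⊗ x`. -/
noncomputable def s : A ⊗[𝕜] A →ₗ[𝕜] A ⊗[𝕜] A :=
  (TensorProduct.comm 𝕜 A A).toLinearMap

/-- The cyclic permutation `ε (x ⊗ y ⊗ z) = z ⊗ x ⊗ y`. -/
noncomputable def ε : A ⊗[𝕜] (A ⊗[𝕜] A) →ₗ[𝕜] A ⊗[𝕜] (A ⊗[𝕜] A) :=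
  (TensorProduct.comm 𝕜 (A ⊗[𝕜] A) A).toLinearMap ∘ₗ
    (TensorProduct.assoc 𝕜 A A A).symm.toLinearMap

/-- Skew symmetry and the Jacobi identity for `br : A ⊗ A → A`. -/
structure IsLieAlgebra (br : A ⊗[𝕜] A →ₗ[𝕜] A) : Prop where
  skew : br ∘ₗ s = -br
  jacobi : br ∘ₗ br.lTensor A ∘ₗ (LinearMap.id + ε + ε ∘ₗ ε) = 0

/-- Coskew symmetry and the co-Jacobi identity for `δ : A → A ⊗ A`. -/
structure IsLieCoalgebra (δ : A →ₗ[𝕜] A ⊗[𝕜] A) : Prop where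
  coskew : s ∘ₗ δ = -δ
  cojacobi : (LinearMap.id + ε + ε ∘ₗ ε) ∘ₗ δ.lTensor A ∘ₗ δ = 0

/-- The action `x · (y ⊗ z) = [x, y] ⊗ z + y ⊗ [x, z]`. -/
noncomputable def act (br : A ⊗[𝕜] A →ₗ[𝕜] A) (x : A) : A ⊗[𝕜] A →ₗ[𝕜] A ⊗[𝕜] A :=
  (br ∘ₗ TensorProduct.mk 𝕜 A A x).rTensor A + (br ∘ₗ TensorProduct.mk 𝕜 A A x).lTensor A

/-- Lie bialgebras: a Lie algebra and a Lie coalgebra with the compatibility condition. -/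
structure IsLieBialgebra (br : A ⊗[𝕜] A →ₗ[𝕜] A) (δ : A →ₗ[𝕜] A ⊗[𝕜] A) : Prop where
  lieAlgebra : IsLieAlgebra br
  lieCoalgebra : IsLieCoalgebra δ
  compat : ∀ x y : A, δ (br (x ⊗ₜ[𝕜] y)) = act br x (δ y) - act br y (δ x)

/-- Involutive Lie bialgebras: moreover `[ , ] ∘ δ = 0`. -/
structure IsInvolutiveLieBialgebra (br : A ⊗[𝕜] A →ₗ[𝕜] A) (δ : A →ₗ[𝕜] A ⊗[𝕜] A) : Prop where
  lieBialgebra : IsLieBialgebra br δ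
  involutive : br ∘ₗ δ = 0

end LieBialg

/-! ### Cyclic words -/

namespace CyclicWord

/-- The `2 n` letters `a₁, …, aₙ, a̅₁, …, a̅ₙ`; the Boolean tells a generator from its inverse. -/
abbrev Letter (n : ℕ) := Fin n × Bool

variable {n : ℕ}

/-- `x ↦ x̅` on letters. (On linear words, `FreeGroup.invRev` is the map `W ↦ W̅`.) -/
def bar (x : Letter n) : Letter n := (x.1, !x.2)

/-- A cyclic word is reduced if it is non-empty and all its linear representatives are freely
reduced. -/
def IsReduced (c : Cycle (Letter n)) : Prop :=
  c ≠ Cycle.nil ∧ ∀ w : List (Letter n), (w : Cycle (Letter n)) = c → FreeGroup.IsReduced w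

/-- A surface symbol: a cyclic word in which every letter appears exactly once. -/
def IsSurfaceSymbol (O : Cycle (Letter n)) : Prop :=
  O.Nodup ∧ ∀ x : Letter n, x ∈ O

/-- The letters of `c` occur, at distinct places of `O` and in this cyclic order, in `O`. -/
def EmbedsIn (c O : Cycle (Letter n)) : Prop :=
  ∃ w o : List (Letter n), (w : Cycle (Letter n)) = c ∧ (o : Cycle (Letter n)) = O ∧ w.Sublist o

open Classical in
/-- The orientation `o(c) ∈ {-1, 0, 1}` of a cyclic word with respect to `O`: it is `1` if the
letters of `c` are distinct letters of `O` in the cyclic order of `O`, it is `-1` if this holds for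
the opposite cyclic order, and `0` otherwise. -/
noncomputable def orient (O c : Cycle (Letter n)) : ℤ :=
  if EmbedsIn c O then 1 else if EmbedsIn c.reverse O then -1 else 0

/-! ### Linked pairs of linear words -/

/-- Condition (1): `P = p₁ p₂` and `Q = q₁ q₂` with `o(c(p̅₁ q̅₁ p₂ q₂)) ≠ 0`. -/
def Linked₁ (O : Cycle (Letter n)) (P Q : List (Letter n)) : Prop :=
  ∃ p₁ p₂ q₁ q₂ : Letter n, P = [p₁, p₂] ∧ Q = [q₁, q₂] ∧
    orient O ([bar p₁, bar q₁, p₂, q₂] : List (Letter n)) ≠ 0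

/-- Condition (2): `P = p₁ Y p₂` and `Q = q₁ Y q₂`, where `Y` is non-empty with first letter `x₁`
and last letter `x₂`. -/
def Linked₂ (O : Cycle (Letter n)) (P Q : List (Letter n)) : Prop :=
  ∃ (p₁ p₂ q₁ q₂ x₁ x₂ : Letter n) (Y : List (Letter n)),
    P = p₁ :: (Y ++ [p₂]) ∧ Q = q₁ :: (Y ++ [q₂]) ∧ p₁ ≠ q₁ ∧ p₂ ≠ q₂ ∧
    Y.head? = some x₁ ∧ Y.getLast? = some x₂ ∧
    orient O ([bar p₁, bar q₁, x₁] : List (Letter n)) =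
      orient O ([p₂, q₂, bar x₂] : List (Letter n))

/-- Condition (3): `P = p₁ Y p₂` and `Q = q₁ Y̅ q₂`, where `Y` is non-empty with first letter `x₁`
and last letter `x₂`. -/
def Linked₃ (O : Cycle (Letter n)) (P Q : List (Letter n)) : Prop :=
  ∃ (p₁ p₂ q₁ q₂ x₁ x₂ : Letter n) (Y : List (Letter n)),
    P = p₁ :: (Y ++ [p₂]) ∧ Q = q₁ :: (FreeGroup.invRev Y ++ [q₂]) ∧
    p₁ ≠ bar q₂ ∧ p₂ ≠ bar q₁ ∧
    Y.head? = some x₁ ∧ Y.getLast? = some x₂ ∧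
    orient O ([q₂, bar p₁, x₁] : List (Letter n)) =
      orient O ([bar q₁, p₂, bar x₂] : List (Letter n))

/-- `(P, Q)` is `O`-linked. -/
def Linked (O : Cycle (Letter n)) (P Q : List (Letter n)) : Prop :=
  FreeGroup.IsReduced P ∧ FreeGroup.IsReduced Q ∧ 2 ≤ P.length ∧ 2 ≤ Q.length ∧
    (Linked₁ O P Q ∨ Linked₂ O P Q ∨ Linked₃ O P Q)

open Classical in
/-- The sign of a linked pair: `o(c(p̅₁ q̅₁ p₂ q₂))`, `o(c(p̅₁ q̅₁ x₁))` and `o(c(q₂ p̅₁ x₁))` for the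
types (1), (2) and (3), where `p₁, x₁` are the first two letters of `P`, `q₁` is the first letter of
`Q` and `q₂` is its last one. (The value at a pair that is not linked is irrelevant.) -/
noncomputable def sign (O : Cycle (Letter n)) (P Q : List (Letter n)) : ℤ :=
  match P, Q with
  | [p₁, p₂], [q₁, q₂] => orient O ([bar p₁, bar q₁, p₂, q₂] : List (Letter n))
  | p₁ :: x₁ :: X, q₁ :: Z =>
      if Linked₃ O (p₁ :: x₁ :: X) (q₁ :: Z) then
        orient O ([Z.getLastD q₁, bar p₁, x₁] : List (Letter n))
      else orient O ([bar p₁, bar q₁, x₁] : List (Letter n))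
  | _, _ => 0

/-! ### Linked pairs of occurrences in cyclic words

An occurrence of a subword in a cyclic word `𝒲`, or in a power of it, is given by the linear
representative `w` of `𝒲` that is obtained by cutting `𝒲` immediately before the first letter of the
subword, and by the length `k` of the subword. The multiset `𝒲.lists` has one member for each of the
`l(𝒲)` places where `𝒲` can be cut (equal representatives from different cuts are counted
separately). If `w` is the representative for the cut before the first letter, then `w.rotate i` is
the one for the cut `i` letters further on. The two words of a linked pair have the same length. -/

/-- The first `k` letters of the power `w ^ k`, that is, of the periodic word `w w w ⋯`. -/
def powTake (w : List (Letter n)) (k : ℕ) : List (Letter n) :=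
  (List.replicate k w).flatten.take k

/-- Linked pairs in `LP₁(c(u))`: `P` consists of the first `k` letters of `u`, and `Q` consists of
the `k` letters that start `d` letters later. -/
def LP₁ (O : Cycle (Letter n)) (u : List (Letter n)) (d k : ℕ) : Prop :=
  d < u.length ∧ k ≤ u.length ∧ Linked O (u.take k) ((u.rotate d).take k)

open Classical in
/-- The cyclic word `δ₁(P, Q) = c(W₁)` of the linked pair `(u, d, k)`. For types (1) and (2), `W₁`
reaches from `p₂` to the place immediately before `q₂`; for type (3) it reaches from `p₂`
to `q₁`. -/
noncomputable def δ₁ (O : Cycle (Letter n)) (u : List (Letter n)) (d k : ℕ) : Cycle (Letter n) :=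
  if Linked₃ O (u.take k) ((u.rotate d).take k) then
    (((u.rotate (k - 1)).take (d + 2 - k) : List (Letter n)) : Cycle (Letter n))
  else (((u.rotate (k - 1)).take d : List (Letter n)) : Cycle (Letter n))

open Classical in
/-- The cyclic word `δ₂(P, Q) = c(W₂)` of the linked pair `(u, d, k)`. For types (1) and (2), `W₂`
reaches from `q₂` to the place immediately before `p₂`; for type (3) it reaches from `q₂`
to `p₁`. -/
noncomputable def δ₂ (O : Cycle (Letter n)) (u : List (Letter n)) (d k : ℕ) : Cycle (Letter n) :=
  if Linked₃ O (u.take k) ((u.rotate d).take k) then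
    (((u.rotate (d + k - 1)).take (u.length + 2 - (d + k)) : List (Letter n)) : Cycle (Letter n))
  else (((u.rotate (d + k - 1)).take (u.length - d) : List (Letter n)) : Cycle (Letter n))

/-- Linked pairs in `LP₂(c(v), c(w))`: `P` consists of the first `k` letters of a power of `v`, and
`Q` consists of the first `k` letters of a power of `w`. -/
def LP₂ (O : Cycle (Letter n)) (v w : List (Letter n)) (k : ℕ) : Prop :=
  Linked O (powTake v k) (powTake w k)

open Classical in
/-- The cyclic word `γ(P, Q)` of the linked pair `(v, w, k)`.

For types (1) and (2) it is `c(V₁ W₁)`, where the cuts are immediately before `p₂` and `q₂`.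

For type (3), `Y` and `Y̅` have `k - 2` letters. If they are not longer than `v` and `w`, then the
word is `c(V₁ W₁)`, where `V₁` is what remains of `c(v)` when `Y` is removed and starts after `Y`,
and `W₁` is what remains of `c(w)` when `Y̅` is removed and starts after `Y̅`. In general it is
the cyclic reduction of the product of the representative of `c(v)` cut right after `Y` and the
representative of `c(w)` cut right before `Y̅`. -/
noncomputable def γ (O : Cycle (Letter n)) (v w : List (Letter n)) (k : ℕ) : Cycle (Letter n) :=
  if Linked₃ O (powTake v k) (powTake w k) then
    if k - 2 ≤ v.length ∧ k - 2 ≤ w.length then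
      (((v.rotate (k - 1)).take (v.length - (k - 2)) ++
        (w.rotate (k - 1)).take (w.length - (k - 2)) : List (Letter n)) : Cycle (Letter n))
    else
      ((FreeGroup.reduceCyclically (FreeGroup.reduce (v.rotate (k - 1) ++ w.rotate 1)) :
        List (Letter n)) : Cycle (Letter n))
  else ((v.rotate (k - 1) ++ w.rotate (k - 1) : List (Letter n)) : Cycle (Letter n))

/-! ### The space `𝕍`, its bracket and its cobracket -/

variable (𝕜 : Type*) [CommRing 𝕜]

/-- The free module on the reduced cyclic words. -/
abbrev V (n : ℕ) := {c : Cycle (Letter n) // IsReduced c} →₀ 𝕜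

open Classical in
/-- The basis vector of a reduced cyclic word (and `0` for other cyclic words). -/
noncomputable def word (c : Cycle (Letter n)) : V 𝕜 n :=
  if h : IsReduced c then Finsupp.single ⟨c, h⟩ 1 else 0

open Classical in
/-- `δ(𝒲) = ∑ sign(P, Q) δ₁(P, Q) ⊗ δ₂(P, Q)` over the linked pairs `(P, Q)` of `𝒲`. -/
noncomputable def cobracketWord (O 𝒲 : Cycle (Letter n)) : V 𝕜 n ⊗[𝕜] V 𝕜 n :=
  (𝒲.lists.map fun u =>
    ∑ d ∈ Finset.range u.length, ∑ k ∈ Finset.range (u.length + 1),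
      if LP₁ O u d k then
        ((sign O (u.take k) ((u.rotate d).take k) : ℤ) : 𝕜) •
          (word 𝕜 (δ₁ O u d k) ⊗ₜ[𝕜] word 𝕜 (δ₂ O u d k))
      else 0).sum

/-- `[𝒱, 𝒲] = ∑ sign(P, Q) γ(P, Q)` over the linked pairs `(P, Q)` of `𝒱` and `𝒲`. -/
noncomputable def bracketWord (O 𝒱 𝒲 : Cycle (Letter n)) : V 𝕜 n :=
  (𝒱.lists.map fun v =>
    (𝒲.lists.map fun w =>
      ∑ᶠ k ∈ {k : ℕ | LP₂ O v w k},
        ((sign O (powTake v k) (powTake w k) : ℤ) : 𝕜) • word 𝕜 (γ O v w k)).sum).sum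

/-- The linear map `δ : 𝕍 → 𝕍 ⊗ 𝕍`. -/
noncomputable def cobracket (O : Cycle (Letter n)) : V 𝕜 n →ₗ[𝕜] V 𝕜 n ⊗[𝕜] V 𝕜 n :=
  Finsupp.linearCombination 𝕜 fun 𝒲 => cobracketWord 𝕜 O 𝒲.1

/-- The linear map `[ , ] : 𝕍 ⊗ 𝕍 → 𝕍`. -/
noncomputable def bracket (O : Cycle (Letter n)) : V 𝕜 n ⊗[𝕜] V 𝕜 n →ₗ[𝕜] V 𝕜 n :=
  TensorProduct.lift
    (Finsupp.linearCombination 𝕜 fun 𝒱 : {c : Cycle (Letter n) // IsReduced c} =>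
      Finsupp.linearCombination 𝕜 fun 𝒲 : {c : Cycle (Letter n) // IsReduced c} =>
        bracketWord 𝕜 O 𝒱.1 𝒲.1)

end CyclicWord

/-!
A reduced cyclic word is the same thing as a non-trivial conjugacy class of the free group on `n`
generators (`cycleOf`), that is, a free homotopy class of closed curves on a surface with boundary
which is glued from a disc along the surface symbol. The bracket and the cobracket are Goldman's
and Turaev's: they sum, with signs, over the crossings of curves, and smooth one crossing in each
term. The linked pairs of words are a way to count the crossings that cannot be avoided. The proof
makes this precise without any topology.

*Curves as permutations.* A family of closed curves is a permutation `σ` of a finite set of edges,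
together with a letter for each edge: a curve is a cycle of `σ`, and its class is the product of
the letters along it (`hol`). Between an edge `σ⁻¹ e` and the edge `e`, the curve passes through
the disc along a chord; the passages `e` and `f` have an integral crossing number `eps`. Smoothing
this crossing replaces `σ` by `swap e f * σ`, which joins two cycles or splits one. If bracket and
cobracket of all curves are given by sums over crossings (`Realizes`), then every identity of an
involutive Lie bialgebra is a statement about pairs of crossings: pairs without a common passage
can be smoothed in either order and cancel, pairs with a common passage cancel by the cyclic
relation `Generic.eps_cyclic` between three chords, a finite check on the signs of a linear order.
This gives `Realizes.skew`, `Realizes.jacobi`, `Realizes.coskew`, `Realizes.cojacobi`,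
`Realizes.compat` and `Realizes.involutive`.

*Independence of the representatives.* To have crossing numbers, the chords need distinct end
points, so edges with equal letters are separated by an arbitrary numbering (`inPoint`,
`outPoint`), in opposite order at the two sides of a generator. If instead equal ends are left
together and count as half a crossing (`halfCross`), then the sum over all passages of twice the
crossing number does not change, since the differences telescope along parallel and antiparallel
edges (`sum_eps_eq_sum_halfCross`). The sums over half crossings are visibly functions of the
conjugacy classes: inserting `x x̅` into a word adds terms that cancel. They are called
`formalBracket` and `formalCobracket`, and `two_smul_sum_eps_join` and `two_smul_sum_eps_cut`
identify them with the sums over crossings.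

*Linked pairs.* For reduced cyclic words, the half crossings that are not crossings in one point
sit at the two ends of the strips along which the curves run parallel or antiparallel, one at each
end. The two halves add up if the curves change sides along the strip, which is the definition of
a linked pair, and they cancel otherwise (`sum_start_add_sum_end`, `sum_halfCross_eq_sum_linked`).
By `γ_path` and `δ_path`, the words attached to a linked pair are the reduced cyclic words of the
smoothed curves. So the formal bracket and the formal cobracket are twice the sums over linked
pairs (`formalBracket_mk`, `formalCobracket_mk`); this is an identity between formal sums with
integral coefficients, where the factor two can be cancelled, and it is transported to the given
ring of coefficients afterwards. Hence bracket and cobracket are realized by crossings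
(`realizes`), and the identities hold.

Linked pairs are short because a strip that is as long as a common period of the two words would
have no end (`Strip.lt`); in a single cyclic word, a strip with its own translate has to leave out
at least two letters (`Strip.add_one_lt`), and a freely reduced word cannot overlap with its own
inverse (`le_of_linked₃`).
-/

namespace CyclicWord

/-! ### Signs and crossing numbers in a linear order -/

section Order
variable {α : Type*} [LinearOrder α]

/-- The sign of `b - a` in a linear order. -/
def sgn (a b : α) : ℤ := if a < b then 1 else if b < a then -1 else 0

/-- The indicator of `a < b`. -/
def ltInd (a b : α) : ℤ := if a < b then 1 else 0

/-- Twice the crossing number of the chords `x → x'` and `y → y'` of a circle that is cut open to a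
linear order; a common end point of the two chords counts as one half of a crossing. -/
def twiceCross (x x' y y' : α) : ℤ := sgn x y + sgn y x' + sgn x' y' + sgn y' x

/-- The crossing number of the chords `x → x'` and `y → y'` of a circle that is cut open to a linear
order, for chords without common end points. -/
def cross (x x' y y' : α) : ℤ := ltInd x' y' - ltInd x' y - ltInd x y' + ltInd x y

@[simp] theorem sgn_self (a : α) : sgn a a = 0 := by simp [sgn]

theorem sgn_swap (a b : α) : sgn a b = -sgn b a := by
  rcases lt_trichotomy a b with h | h | h
  · simp [sgn, h, h.not_gt]
  · simp [sgn, h]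
  · simp [sgn, h, h.not_gt]

theorem sgn_eq_ltInd {a b : α} (h : a ≠ b) : sgn a b = 2 * ltInd a b - 1 := by
  rcases lt_or_gt_of_ne h with h | h <;> simp [sgn, ltInd, h, h.not_gt]

theorem sgn_eq_or {a b : α} (h : a ≠ b) : sgn a b = 1 ∨ sgn a b = -1 := by
  rcases lt_or_gt_of_ne h with h | h <;> simp [sgn, h, h.not_gt]

theorem two_mul_cross {x x' y y' : α} (h₁ : x ≠ y) (h₂ : x ≠ y') (h₃ : x' ≠ y) (h₄ : x' ≠ y') :
    2 * cross x x' y y' = twiceCross x x' y y' := by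
  unfold cross twiceCross
  rw [sgn_swap y x', sgn_swap y' x, sgn_eq_ltInd h₁, sgn_eq_ltInd h₂, sgn_eq_ltInd h₃,
    sgn_eq_ltInd h₄]
  ring

theorem twiceCross_swap (x x' y y' : α) : twiceCross x x' y y' = -twiceCross y y' x x' := by
  unfold twiceCross
  rw [sgn_swap x y, sgn_swap y x', sgn_swap x' y', sgn_swap y' x]
  ring

/-- Three distinct points are either in increasing or in decreasing cyclic order. -/
theorem sgn_triple {p q r : α} (h₁ : p ≠ q) (h₂ : q ≠ r) (h₃ : p ≠ r) :
    sgn p q * sgn q r - sgn q r * sgn p r - sgn p r * sgn p q = -1 := by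
  rcases lt_or_gt_of_ne h₁ with h₁ | h₁ <;> rcases lt_or_gt_of_ne h₂ with h₂ | h₂ <;>
    rcases lt_or_gt_of_ne h₃ with h₃ | h₃ <;>
    first
    | exact absurd (h₁.trans h₂) h₃.not_gt
    | exact absurd (h₂.trans h₁) h₃.not_gt
    | simp [sgn, h₁, h₂, h₃, h₁.not_gt, h₂.not_gt, h₃.not_gt]

/-- Smoothing a crossing of two chords separates them. -/
theorem cross_mul_cross_smoothing {x x' y y' : α} (h₀ : x ≠ x') (h₀' : y ≠ y') (h₁ : x ≠ y)
    (h₂ : x ≠ y') (h₃ : x' ≠ y) (h₄ : x' ≠ y') : cross x x' y y' * cross y x' x y' = 0 := by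
  have e₁ := two_mul_cross h₁ h₂ h₃ h₄
  have e₂ := two_mul_cross h₁.symm h₀' h₀.symm h₄
  have : (2 * cross x x' y y') * (2 * cross y x' x y') = 0 := by
    rw [e₁, e₂]
    unfold twiceCross
    rw [sgn_swap y x, sgn_swap y' x, sgn_swap y x', sgn_swap y' y]
    have t₁ := sgn_triple h₁ h₃.symm h₀
    have t₂ := sgn_triple h₁ h₀' h₂
    have t₃ := sgn_triple h₀ h₄ h₂
    have t₄ := sgn_triple h₃ h₀' h₄
    have q (a b : α) (h : a ≠ b) : sgn a b * sgn a b = 1 := by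
      rcases sgn_eq_or h with h | h <;> simp [h]
    rw [sgn_swap y x'] at t₁
    linear_combination -t₁ - t₂ + t₃ + t₄ - q _ _ h₁ + q _ _ h₄
  have h : 4 * (cross x x' y y' * cross y x' x y') = 0 := by rw [← this]; ring
  omega

/-- The three ways to compose two of the three smoothings of three pairwise distinct chords
`x → x'`, `y → y'`, `z → z'` cancel: this is the local form of the Jacobi identity. -/
theorem cross_mul_cross_cyclic {x x' y y' z z' : α} (hxy : x ≠ y) (hxy' : x ≠ y') (hx'y : x' ≠ y)
    (hx'y' : x' ≠ y') (hxz : x ≠ z) (hxz' : x ≠ z') (hx'z : x' ≠ z) (hx'z' : x' ≠ z') (hyz : y ≠ z)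
    (hyz' : y ≠ z') (hy'z : y' ≠ z) (hy'z' : y' ≠ z') :
    cross y y' z z' * cross x x' z y' + cross z z' x x' * cross y y' x z' +
      cross x x' y y' * cross z z' y x' = 0 := by
  have : (2 * cross y y' z z') * (2 * cross x x' z y') +
      (2 * cross z z' x x') * (2 * cross y y' x z') +
      (2 * cross x x' y y') * (2 * cross z z' y x') = 0 := by
    rw [two_mul_cross hyz hyz' hy'z hy'z', two_mul_cross hxz hxy' hx'z hx'y',
      two_mul_cross hxz.symm hx'z.symm hxz'.symm hx'z'.symm,
      two_mul_cross hxy.symm hyz' hxy'.symm hy'z', two_mul_cross hxy hxy' hx'y hx'y',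
      two_mul_cross hyz.symm hx'z.symm hyz'.symm hx'z'.symm]
    unfold twiceCross
    simp only [sgn_swap y x, sgn_swap z y, sgn_swap z x, sgn_swap y' x,
      sgn_swap z' y, sgn_swap y x', sgn_swap z x', sgn_swap z y',
      sgn_swap z' x']
    linear_combination -sgn_triple hxy hyz hxz + sgn_triple hxy hyz' hxz' +
      sgn_triple hxy' hy'z hxz - sgn_triple hxy' hy'z' hxz' + sgn_triple hx'y hyz hx'z -
      sgn_triple hx'y hyz' hx'z' - sgn_triple hx'y' hy'z hx'z + sgn_triple hx'y' hy'z' hx'z'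
  linarith

end Order

/-! ### Orientations of words of three and four letters -/

section Orient
variable {n : ℕ}

/-- The place of a letter in a list. -/
def place (o : List (Letter n)) (x : Letter n) : ℕ := o.idxOf x

theorem place_injective {o : List (Letter n)} (hm : ∀ x, x ∈ o) : Function.Injective (place o) :=
  fun x _ h => (List.idxOf_inj (hm x)).1 h

theorem place_pairwise_of_sublist {w o : List (Letter n)} (ho : o.Nodup) (h : w.Sublist o) :
    w.Pairwise fun a b => place o a < place o b := by
  refine List.Pairwise.sublist h ?_
  rw [List.pairwise_iff_getElem]
  intro i j hi hj hij
  rwa [place, place, ho.idxOf_getElem, ho.idxOf_getElem]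

theorem sublist_of_place_pairwise {w o : List (Letter n)} (ho : o.Nodup) (hw : ∀ x ∈ w, x ∈ o)
    (h : w.Pairwise fun a b => place o a < place o b) : w.Sublist o := by
  have hnd : w.Nodup := h.imp fun hab => by rintro rfl; exact lt_irrefl _ hab
  obtain ⟨l, hl, hlo⟩ := List.subperm_of_subset hnd hw
  have ho' := place_pairwise_of_sublist ho (List.Sublist.refl o)
  have : l = w := hl.eq_of_pairwise (fun a b _ _ h1 h2 => absurd h1 h2.not_gt) (ho'.sublist hlo) h
  exact this ▸ hlo

theorem place_rotate {o : List (Letter n)} (ho : o.Nodup) (m : ℕ) {x : Letter n} (hx : x ∈ o) :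
    place o x = (place (o.rotate m) x + m) % o.length := by
  have hx' : x ∈ o.rotate m := List.mem_rotate.2 hx
  have h := List.getElem_idxOf (List.idxOf_lt_length_iff.2 hx')
  rw [List.getElem_rotate] at h
  conv_lhs => rw [← h]
  exact ho.idxOf_getElem _ _

/-- An embedded cyclic word has a rotation whose letters occur in increasing order once the places
are shifted cyclically. -/
theorem EmbedsIn.exists_pairwise {w o : List (Letter n)} (ho : o.Nodup) (hm : ∀ x, x ∈ o)
    (h : EmbedsIn (w : Cycle (Letter n)) o) :
    ∃ (k m N : ℕ) (f : Letter n → ℕ), k ≤ w.length ∧ m ≤ N ∧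
      (∀ x, f x < N ∧ place o x < N ∧ (place o x = f x + m ∨ place o x + N = f x + m)) ∧
      (w.rotate k).Pairwise fun a b => f a < f b := by
  obtain ⟨w, o', hw, ho', hs⟩ := h
  obtain ⟨k, hk, rfl⟩ := List.isRotated_iff_mod.1 (Cycle.coe_eq_coe.1 hw).symm
  obtain ⟨m, hm', rfl⟩ := List.isRotated_iff_mod.1 (Cycle.coe_eq_coe.1 ho').symm
  refine ⟨k, m, o.length, place (o.rotate m), hk, hm', fun x => ?_,
    place_pairwise_of_sublist (List.nodup_rotate.2 ho) hs⟩
  have lt : place (o.rotate m) x < o.length := by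
    rw [← List.length_rotate (l := o) (n := m)]
    exact List.idxOf_lt_length_iff.2 (List.mem_rotate.2 (hm x) : x ∈ o.rotate m)
  refine ⟨lt, List.idxOf_lt_length_iff.2 (hm x), ?_⟩
  rw [place_rotate ho m (hm x)]
  rcases lt_or_ge (place (o.rotate m) x + m) o.length with h | h
  · exact Or.inl (Nat.mod_eq_of_lt h)
  · rw [Nat.mod_eq_sub_mod h, Nat.mod_eq_of_lt (by omega)]
    omega

theorem embedsIn_triple_iff {o : List (Letter n)} (ho : o.Nodup) (hm : ∀ x, x ∈ o)
    (a b c : Letter n) : EmbedsIn (([a, b, c] : List (Letter n)) : Cycle (Letter n)) o ↔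
      (place o a < place o b ∧ place o b < place o c) ∨
      (place o b < place o c ∧ place o c < place o a) ∨
      (place o c < place o a ∧ place o a < place o b) := by
  constructor
  · intro h
    obtain ⟨k, m, N, f, hk, hmN, hf, hp⟩ := h.exists_pairwise ho hm
    have ha := hf a; have hb := hf b; have hc := hf c
    generalize place o a = a', place o b = b', place o c = c' at *
    simp only [List.length_cons, List.length_nil] at hk
    interval_cases k <;> simp [List.rotate] at hp <;> omega
  · have sub {p q r : Letter n} (h₁ : place o p < place o q) (h₂ : place o q < place o r) :
        [p, q, r].Sublist o :=
      sublist_of_place_pairwise ho (fun x _ => hm x) (by simp [h₁, h₂, h₁.trans h₂])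
    rintro (⟨h₁, h₂⟩ | ⟨h₁, h₂⟩ | ⟨h₁, h₂⟩)
    · exact ⟨_, o, rfl, rfl, sub h₁ h₂⟩
    · exact ⟨_, o, Cycle.coe_eq_coe.2 ⟨2, rfl⟩, rfl, sub h₁ h₂⟩
    · exact ⟨_, o, Cycle.coe_eq_coe.2 ⟨1, rfl⟩, rfl, sub h₁ h₂⟩

theorem embedsIn_quadruple_iff {o : List (Letter n)} (ho : o.Nodup) (hm : ∀ x, x ∈ o)
    (a b c d : Letter n) : EmbedsIn (([a, b, c, d] : List (Letter n)) : Cycle (Letter n)) o ↔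
      (place o a < place o b ∧ place o b < place o c ∧ place o c < place o d) ∨
      (place o b < place o c ∧ place o c < place o d ∧ place o d < place o a) ∨
      (place o c < place o d ∧ place o d < place o a ∧ place o a < place o b) ∨
      (place o d < place o a ∧ place o a < place o b ∧ place o b < place o c) := by
  constructor
  · intro h
    obtain ⟨k, m, N, f, hk, hmN, hf, hp⟩ := h.exists_pairwise ho hm
    have ha := hf a; have hb := hf b; have hc := hf c; have hd := hf d
    generalize place o a = a', place o b = b', place o c = c', place o d = d' at *
    simp only [List.length_cons, List.length_nil] at hk
    interval_cases k <;> simp [List.rotate] at hp <;> omega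
  · have sub {p q r s : Letter n} (h₁ : place o p < place o q) (h₂ : place o q < place o r)
        (h₃ : place o r < place o s) : [p, q, r, s].Sublist o :=
      sublist_of_place_pairwise ho (fun x _ => hm x)
        (by simp [h₁, h₂, h₃, h₁.trans h₂, h₂.trans h₃, (h₁.trans h₂).trans h₃])
    rintro (⟨h₁, h₂, h₃⟩ | ⟨h₁, h₂, h₃⟩ | ⟨h₁, h₂, h₃⟩ | ⟨h₁, h₂, h₃⟩)
    · exact ⟨_, o, rfl, rfl, sub h₁ h₂ h₃⟩
    · exact ⟨_, o, Cycle.coe_eq_coe.2 ⟨3, rfl⟩, rfl, sub h₁ h₂ h₃⟩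
    · exact ⟨_, o, Cycle.coe_eq_coe.2 ⟨2, rfl⟩, rfl, sub h₁ h₂ h₃⟩
    · exact ⟨_, o, Cycle.coe_eq_coe.2 ⟨1, rfl⟩, rfl, sub h₁ h₂ h₃⟩

/-- The orientation of three letters, in terms of the linear order of their places: three signs of a
triple of distinct places add up to `1` or `-1`, and they cancel if two places agree. -/
theorem orient_triple {o : List (Letter n)} (ho : o.Nodup) (hm : ∀ x, x ∈ o) (a b c : Letter n) :
    orient o (([a, b, c] : List (Letter n)) : Cycle (Letter n)) =
      sgn (place o a) (place o b) + sgn (place o b) (place o c) + sgn (place o c) (place o a) := by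
  have hr : (([a, b, c] : List (Letter n)) : Cycle (Letter n)).reverse =
      (([c, b, a] : List (Letter n)) : Cycle (Letter n)) := rfl
  simp only [orient, hr, embedsIn_triple_iff ho hm, sgn]
  generalize place o a = a', place o b = b', place o c = c'
  split_ifs <;> omega

/-- The orientation of four letters is the crossing number of the two chords between opposite
ones. -/
theorem orient_quadruple {o : List (Letter n)} (ho : o.Nodup) (hm : ∀ x, x ∈ o) {a b c d : Letter n}
    (hab : a ≠ b) (hbc : b ≠ c) (hcd : c ≠ d) (hda : d ≠ a) :
    2 * orient o (([a, b, c, d] : List (Letter n)) : Cycle (Letter n)) =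
      twiceCross (place o a) (place o c) (place o b) (place o d) := by
  have hr : (([a, b, c, d] : List (Letter n)) : Cycle (Letter n)).reverse =
      (([d, c, b, a] : List (Letter n)) : Cycle (Letter n)) := rfl
  have inj := place_injective hm
  have h₁ := inj.ne hab; have h₂ := inj.ne hbc; have h₃ := inj.ne hcd; have h₄ := inj.ne hda
  simp only [orient, hr, embedsIn_quadruple_iff ho hm, twiceCross, sgn]
  generalize place o a = a', place o b = b', place o c = c', place o d = d' at *
  rcases lt_or_gt_of_ne h₁ with h₁ | h₁ <;> rcases lt_or_gt_of_ne h₂ with h₂ | h₂ <;>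
    rcases lt_or_gt_of_ne h₃ with h₃ | h₃ <;> rcases lt_or_gt_of_ne h₄ with h₄ | h₄ <;>
    first | (exfalso; omega) | simp [h₁, h₂, h₃, h₄, h₁.not_gt, h₂.not_gt, h₃.not_gt, h₄.not_gt]

/-- A non-zero orientation of a word of four letters forces the letters to be distinct. -/
theorem ne_of_orient_quadruple_ne_zero {o : List (Letter n)} (ho : o.Nodup) (hm : ∀ x, x ∈ o)
    {a b c d : Letter n} (h : orient o (([a, b, c, d] : List (Letter n)) : Cycle (Letter n)) ≠ 0) :
    a ≠ b ∧ b ≠ c ∧ c ≠ d ∧ d ≠ a ∧ a ≠ c ∧ b ≠ d := by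
  have hr : (([a, b, c, d] : List (Letter n)) : Cycle (Letter n)).reverse =
      (([d, c, b, a] : List (Letter n)) : Cycle (Letter n)) := rfl
  simp only [orient, hr, embedsIn_quadruple_iff ho hm] at h
  refine ⟨?_, ?_, ?_, ?_, ?_, ?_⟩ <;> rintro rfl <;> apply h <;>
    rw [if_neg (by omega), if_neg (by omega)]

end Orient

/-! ### Cycles of permutations and their surgery by transpositions -/

section Perm
open Equiv Equiv.Perm
variable {E : Type*}

/-- The cycle of `σ` through `e`, as a list that starts at `e`. -/
noncomputable def cycleList (σ : Perm E) (e : E) : List E :=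
  List.iterate σ e (Function.minimalPeriod σ e)

/-- The cycle of `σ` through `e`, as a set. -/
noncomputable def cyc [Fintype E] (σ : Perm E) (e : E) : Finset E :=
  open Classical in Finset.univ.filter (σ.SameCycle e)

@[simp] theorem mem_cyc [Fintype E] {σ : Perm E} {e f : E} : f ∈ cyc σ e ↔ σ.SameCycle e f := by
  simp [cyc]

theorem isPeriodicPt_of_chain {σ : Perm E} {e : E} {A : List E}
    (hc : List.IsChain (fun a b => σ a = b) (e :: A ++ [e])) (i : ℕ)
    (hi : i < (e :: A ++ [e]).length) :
    (e :: A ++ [e])[i] = σ^[i] e := by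
  induction i with
  | zero => rfl
  | succ i ih =>
    rw [Function.iterate_succ_apply', ← ih (by omega)]
    exact (List.isChain_iff_getElem.1 hc i hi).symm

/-- A list without repetitions that is closed under `σ`, in cyclic order, is the list of a cycle. -/
theorem cycleList_eq {σ : Perm E} {e : E} {A : List E} (hn : (e :: A).Nodup)
    (hc : List.IsChain (fun a b => σ a = b) (e :: A ++ [e])) : cycleList σ e = e :: A := by
  have key := isPeriodicPt_of_chain hc
  have hper : Function.IsPeriodicPt σ (A.length + 1) e := by
    have := key (A.length + 1) (by simp)
    simpa [Function.IsPeriodicPt, Function.IsFixedPt] using this.symm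
  have hmin : Function.minimalPeriod σ e = A.length + 1 := by
    refine le_antisymm (hper.minimalPeriod_le (by omega)) ?_
    by_contra! hlt
    set m := Function.minimalPeriod σ e with hm
    have hpos : 0 < m := hper.minimalPeriod_pos (by omega)
    have h0 : (e :: A ++ [e])[m]'(by simp; omega) = e := by
      rw [key]; exact Function.isPeriodicPt_minimalPeriod σ e
    rw [List.getElem_append_left (by simpa using hlt)] at h0
    have := (hn.getElem_inj_iff (i := m) (j := 0) (hi := by simpa using hlt) (hj := by simp)).1
      (by simpa using h0)
    omega
  rw [cycleList, hmin]
  refine List.ext_getElem (by simp) fun i h1 h2 => ?_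
  rw [List.getElem_iterate, ← key i (by simp at h2 ⊢; omega), List.getElem_append_left h2]

theorem minimalPeriod_pos [Fintype E] (σ : Perm E) (e : E) : 0 < Function.minimalPeriod σ e :=
  Function.minimalPeriod_pos_of_mem_periodicPts (σ.injective.mem_periodicPts e)

theorem mem_cycleList [Fintype E] {σ : Perm E} {e f : E} : f ∈ cycleList σ e ↔ σ.SameCycle e f := by
  rw [cycleList, List.mem_iterate]
  constructor
  · rintro ⟨m, -, h⟩
    exact ⟨m, by rw [zpow_natCast, ← Equiv.Perm.iterate_eq_pow]; exact h.symm⟩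
  · intro h
    obtain ⟨i, -, hi⟩ := h.exists_pow_eq'
    refine ⟨i % Function.minimalPeriod σ e, Nat.mod_lt _ (minimalPeriod_pos σ e), ?_⟩
    rw [Function.iterate_mod_minimalPeriod_eq, ← hi, Equiv.Perm.iterate_eq_pow]

theorem nodup_cycleList (σ : Perm E) (e : E) : (cycleList σ e).Nodup := by
  rw [List.nodup_iff_injective_getElem]
  intro i j h
  have hi := i.2; have hj := j.2
  simp only [cycleList, List.length_iterate] at hi hj
  simp only [cycleList, List.getElem_iterate] at h
  have := (Function.iterate_eq_iterate_iff_of_lt_minimalPeriod hi hj).1 h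
  exact Fin.ext this

theorem exists_cycleList_eq_cons [Fintype E] (σ : Perm E) (e : E) :
    ∃ A, cycleList σ e = e :: A := by
  obtain ⟨m, hm⟩ := Nat.exists_eq_add_of_lt (minimalPeriod_pos σ e)
  exact ⟨List.iterate σ (σ e) m, by rw [cycleList, hm]; simp [List.iterate]⟩

theorem cycleList_chain {σ : Perm E} {e : E} :
    List.IsChain (fun a b => σ a = b) (cycleList σ e ++ [e]) := by
  have h : cycleList σ e ++ [e] = List.iterate σ e (Function.minimalPeriod σ e + 1) := by
    rw [List.iterate_add, cycleList]
    congr 1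
    simp [List.iterate, Function.iterate_minimalPeriod]
  rw [h, List.isChain_iff_getElem]
  intro i hi
  simp only [List.getElem_iterate, Function.iterate_succ_apply']

theorem toFinset_cycleList [Fintype E] [DecidableEq E] (σ : Perm E) (e : E) :
    (cycleList σ e).toFinset = cyc σ e := by
  ext f; simp [mem_cycleList]

theorem sum_cyc [Fintype E] {M : Type*} [AddCommMonoid M] (σ : Perm E) (e : E) (F : E → M) :
    ∑ f ∈ cyc σ e, F f = ((cycleList σ e).map F).sum := by
  classical
  rw [← toFinset_cycleList, List.sum_toFinset F (nodup_cycleList σ e)]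

theorem sum_cyc_apply [Fintype E] {M : Type*} [AddCommMonoid M] (σ : Perm E) (e : E) (F : E → M) :
    ∑ f ∈ cyc σ e, F (σ f) = ∑ f ∈ cyc σ e, F f := by
  refine Finset.sum_bij' (fun f _ => σ f) (fun f _ => σ⁻¹ f) ?_ ?_ ?_ ?_ ?_ <;> simp

theorem cyc_eq_of_mem [Fintype E] {σ : Perm E} {e f : E} (h : σ.SameCycle e f) :
    cyc σ e = cyc σ f := by
  ext g; simp only [mem_cyc]; exact ⟨h.symm.trans, h.trans⟩

theorem cycleList_apply [Fintype E] (σ : Perm E) (e : E) :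
    cycleList σ (σ e) = (cycleList σ e).rotate 1 := by
  have hc := cycleList_chain (σ := σ) (e := e)
  have hn := nodup_cycleList σ e
  obtain ⟨A, hA⟩ := exists_cycleList_eq_cons σ e
  rw [hA] at hc hn ⊢
  cases A with
  | nil =>
    have : σ e = e := by simpa using hc
    rw [this, hA, List.rotate_singleton]
  | cons b B =>
    have hb : σ e = b := by
      simp only [List.cons_append, List.isChain_cons_cons] at hc; exact hc.1
    subst hb
    simp only [List.rotate_cons_succ, List.rotate_zero, List.cons_append]
    refine cycleList_eq (A := B ++ [e]) ?_ ?_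
    · simpa using (List.nodup_rotate (n := 1)).2 hn
    · simp only [List.cons_append, List.isChain_cons_cons] at hc
      rw [List.isChain_append]
      exact ⟨hc.2, by simp, by simp [List.getLast?_cons]⟩

/-- Under `swap e f * σ`, a path of `σ` that arrives at `f` for the first time is redirected
to `e`. -/
theorem chain_swap [DecidableEq E] {σ : Perm E} {e f c : E} {A : List E} (he : e ∉ A) (hf : f ∉ A)
    (h : List.IsChain (fun a b => σ a = b) (c :: A ++ [f])) :
    List.IsChain (fun a b => (swap e f * σ) a = b) (c :: A ++ [e]) := by
  induction A generalizing c with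
  | nil =>
    simp only [List.cons_append, List.nil_append, List.isChain_cons_cons,
      List.isChain_singleton, and_true] at h ⊢
    simp [h]
  | cons b A ih =>
    simp only [List.cons_append, List.isChain_cons_cons, List.mem_cons, not_or] at h he hf ⊢
    refine ⟨?_, ih he.2 hf.2 h.2⟩
    rw [Perm.mul_apply, h.1, swap_apply_of_ne_of_ne (Ne.symm he.1) (Ne.symm hf.1)]

theorem chain_swap' [DecidableEq E] {σ : Perm E} {e f c : E} {A : List E} (he : e ∉ A) (hf : f ∉ A)
    (h : List.IsChain (fun a b => σ a = b) (c :: A ++ [e])) :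
    List.IsChain (fun a b => (swap e f * σ) a = b) (c :: A ++ [f]) := by
  rw [swap_comm]; exact chain_swap hf he h

/-- Composing with a transposition of two elements of a cycle cuts the cycle in front of them. -/
theorem cycleList_swap_of_split [DecidableEq E] {σ : Perm E} {e f : E} {A B : List E}
    (h : cycleList σ e = e :: A ++ f :: B) :
    cycleList (swap e f * σ) e = e :: A ∧ cycleList (swap e f * σ) f = f :: B := by
  have hc := cycleList_chain (σ := σ) (e := e)
  have hn := nodup_cycleList σ e
  rw [h] at hc hn
  have hn' := hn
  simp only [List.cons_append, List.nodup_cons, List.nodup_append, List.mem_append,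
    List.mem_cons, not_or] at hn
  obtain ⟨⟨h1, h2, h3⟩, h4, ⟨h5, h6⟩, h7⟩ := hn
  have hfA : f ∉ A := fun hf => h7 f hf f (Or.inl rfl) rfl
  have e1 : e :: A ++ f :: B ++ [e] = (e :: A ++ [f]) ++ (B ++ [e]) := by simp
  have e2 : e :: A ++ f :: B ++ [e] = (e :: A) ++ (f :: B ++ [e]) := by simp
  constructor
  · refine cycleList_eq (by simp [h1, h4]) (chain_swap h1 hfA ?_)
    rw [e1] at hc
    exact hc.left_of_append
  · refine cycleList_eq (by simp [h5, h6]) (chain_swap' h3 h5 ?_)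
    rw [e2] at hc
    exact hc.right_of_append

/-- Composing with a transposition of elements of two cycles joins the cycles. -/
theorem cycleList_swap_of_not_sameCycle [Fintype E] [DecidableEq E] {σ : Perm E} {e f : E}
    (h : ¬σ.SameCycle e f) :
    cycleList (swap e f * σ) e = cycleList σ e ++ cycleList σ f := by
  have hc := cycleList_chain (σ := σ) (e := e)
  have hn := nodup_cycleList σ e
  have hc' := cycleList_chain (σ := σ) (e := f)
  have hn' := nodup_cycleList σ f
  have hfe : f ∉ cycleList σ e := fun hf => h (mem_cycleList.1 hf)
  have hef : e ∉ cycleList σ f := fun hf => h (mem_cycleList.1 hf).symm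
  have hdisj : List.Disjoint (cycleList σ e) (cycleList σ f) := fun x h1 h2 =>
    h ((mem_cycleList.1 h1).trans (mem_cycleList.1 h2).symm)
  obtain ⟨A, hA⟩ := exists_cycleList_eq_cons σ e
  obtain ⟨B, hB⟩ := exists_cycleList_eq_cons σ f
  rw [hA] at hc hn hfe hdisj ⊢
  rw [hB] at hc' hn' hef hdisj ⊢
  rw [List.cons_append]
  refine cycleList_eq ?_ ?_
  · rw [← List.cons_append]; exact hn.append hn' hdisj
  · have c1 := chain_swap' (f := f) (List.nodup_cons.1 hn).1
        (fun h => hfe (List.mem_cons_of_mem _ h)) hc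
    have c2 := chain_swap (e := e) (fun h => hef (List.mem_cons_of_mem _ h))
        (List.nodup_cons.1 hn').1 hc'
    have : e :: (A ++ f :: B) ++ [e] = (e :: A) ++ [f] ++ (B ++ [e]) := by simp
    rw [this]
    exact c1.append_overlap (by simpa using c2) (by simp)

/-- Cycles that contain none of the two transposed elements are not affected. -/
theorem cycleList_swap_of_disjoint [Fintype E] [DecidableEq E] {σ : Perm E} {a e f : E}
    (he : ¬σ.SameCycle a e) (hf : ¬σ.SameCycle a f) :
    cycleList (swap e f * σ) a = cycleList σ a := by
  have hc := cycleList_chain (σ := σ) (e := a)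
  have hn := nodup_cycleList σ a
  have hmem : ∀ x ∈ cycleList σ a ++ [a], x ≠ e ∧ x ≠ f := by
    intro x hx
    have hx : σ.SameCycle a x := by
      rcases List.mem_append.1 hx with hx | hx
      · exact mem_cycleList.1 hx
      · rw [List.mem_singleton.1 hx]
    exact ⟨fun h => he (h ▸ hx), fun h => hf (h ▸ hx)⟩
  obtain ⟨A, hA⟩ := exists_cycleList_eq_cons σ a
  rw [hA] at hc hn hmem ⊢
  refine cycleList_eq hn ?_
  rw [List.isChain_iff_getElem] at hc ⊢
  intro i hi
  have h1 := hc i hi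
  have h2 := hmem _ (List.getElem_mem hi)
  rw [Perm.mul_apply, h1, swap_apply_of_ne_of_ne h2.1 h2.2]

theorem sameCycle_iff_of_cycleList [Fintype E] {σ τ : Perm E} {a : E}
    (h : cycleList σ a = cycleList τ a) (x : E) : σ.SameCycle a x ↔ τ.SameCycle a x := by
  rw [← mem_cycleList, h, mem_cycleList]

theorem exists_cycleList_split [Fintype E] {σ : Perm E} {e f : E} (h : σ.SameCycle e f)
    (hef : e ≠ f) :
    ∃ A B, cycleList σ e = e :: A ++ f :: B := by
  obtain ⟨A, hA⟩ := exists_cycleList_eq_cons σ e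
  have hf : f ∈ cycleList σ e := mem_cycleList.2 h
  rw [hA, List.mem_cons] at hf
  obtain ⟨A₁, B, rfl⟩ := List.append_of_mem (hf.resolve_left hef.symm)
  exact ⟨A₁, B, by rw [hA]; rfl⟩

/-- Composing with a transposition splits a cycle that contains both points. -/
theorem not_sameCycle_swap [Fintype E] [DecidableEq E] {σ : Perm E} {e f : E} (h : σ.SameCycle e f)
    (hef : e ≠ f) :
    ¬(swap e f * σ).SameCycle e f := by
  obtain ⟨A, B, hAB⟩ := exists_cycleList_split h hef
  obtain ⟨h1, h2⟩ := cycleList_swap_of_split hAB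
  have hn := nodup_cycleList σ e
  rw [hAB] at hn
  rw [← mem_cycleList, h1]
  intro hf
  exact (List.disjoint_of_nodup_append hn) hf (List.mem_cons_self)

/-- Composing with a transposition joins two cycles. -/
theorem sameCycle_swap_iff [Fintype E] [DecidableEq E] {σ : Perm E} {e f : E} (h : ¬σ.SameCycle e f)
    (x y : E) :
    (swap e f * σ).SameCycle x y ↔ σ.SameCycle x y ∨ (σ.SameCycle e x ∧ σ.SameCycle f y) ∨
      (σ.SameCycle f x ∧ σ.SameCycle e y) := by
  have main (y : E) : (swap e f * σ).SameCycle e y ↔ σ.SameCycle e y ∨ σ.SameCycle f y := by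
    rw [← mem_cycleList, cycleList_swap_of_not_sameCycle h, List.mem_append, mem_cycleList,
      mem_cycleList]
  by_cases hx : σ.SameCycle e x ∨ σ.SameCycle f x
  · have h1 := (main x).2 hx
    have : (swap e f * σ).SameCycle x y ↔ (swap e f * σ).SameCycle e y :=
      ⟨h1.trans, h1.symm.trans⟩
    rw [this, main]
    rcases hx with hx | hx
    · have h2 : ¬σ.SameCycle f x := fun h3 => h (hx.trans h3.symm)
      have : σ.SameCycle x y ↔ σ.SameCycle e y := ⟨hx.trans, hx.symm.trans⟩
      tauto
    · have h2 : ¬σ.SameCycle e x := fun h3 => h (h3.trans hx.symm)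
      have : σ.SameCycle x y ↔ σ.SameCycle f y := ⟨hx.trans, hx.symm.trans⟩
      tauto
  · push Not at hx
    rw [sameCycle_iff_of_cycleList (cycleList_swap_of_disjoint (fun h => hx.1 h.symm)
      (fun h => hx.2 h.symm))]
    tauto

theorem sameCycle_swap_self [Fintype E] [DecidableEq E] {σ : Perm E} {e f : E}
    (h : ¬σ.SameCycle e f) :
    (swap e f * σ).SameCycle e f :=
  (sameCycle_swap_iff h e f).2 (Or.inr (Or.inl ⟨SameCycle.refl _ _, SameCycle.refl _ _⟩))

/-- The description of the cycles of `σ` by those of `swap e f * σ`, if the transposition cuts a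
cycle. -/
theorem sameCycle_iff_swap [Fintype E] [DecidableEq E] {σ : Perm E} {e f : E} (h : σ.SameCycle e f)
    (hef : e ≠ f) (x y : E) :
    σ.SameCycle x y ↔ (swap e f * σ).SameCycle x y ∨
      ((swap e f * σ).SameCycle e x ∧ (swap e f * σ).SameCycle f y) ∨
      ((swap e f * σ).SameCycle f x ∧ (swap e f * σ).SameCycle e y) := by
  have := sameCycle_swap_iff (not_sameCycle_swap h hef) x y
  rwa [← mul_assoc, swap_mul_self, one_mul] at this

end Perm

/-! ### Crossing numbers under surgery -/

section Eps
open Equiv Equiv.Perm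
variable {E : Type*} {α : Type*} [LinearOrder α]

/-- The crossing number of the passages in front of `e` and in front of `f`. The passage in front of
`e` enters at the end point `inn (σ⁻¹ e)` of the predecessor of `e` and leaves at `out e`. -/
def eps (inn out : E → α) (σ : Perm E) (e f : E) : ℤ :=
  cross (inn (σ⁻¹ e)) (out e) (inn (σ⁻¹ f)) (out f)

/-- The end points `inn e` and `out e` are pairwise distinct. -/
structure Generic (inn out : E → α) : Prop where
  inn_injective : Function.Injective inn
  out_injective : Function.Injective out
  inn_ne_out : ∀ e f, inn e ≠ out f

variable {inn out : E → α}

theorem Generic.two_mul_eps (hg : Generic inn out) (σ : Perm E) {e f : E} (h : e ≠ f) :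
    2 * eps inn out σ e f =
      twiceCross (inn (σ⁻¹ e)) (out e) (inn (σ⁻¹ f)) (out f) :=
  two_mul_cross (hg.inn_injective.ne (σ⁻¹.injective.ne h)) (hg.inn_ne_out _ _)
    (hg.inn_ne_out _ _).symm (hg.out_injective.ne h)

theorem Generic.eps_swap (hg : Generic inn out) (σ : Perm E) {e f : E} (h : e ≠ f) :
    eps inn out σ e f = -eps inn out σ f e := by
  have h1 := hg.two_mul_eps σ h
  have h2 := hg.two_mul_eps σ h.symm
  rw [twiceCross_swap] at h1
  omega

/-- Smoothing a crossing does not affect the crossings of the other passages. -/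
theorem eps_of_ne [DecidableEq E] (σ : Perm E) {e f g h : E} (h₁ : g ≠ e) (h₂ : g ≠ f) (h₃ : h ≠ e)
    (h₄ : h ≠ f) :
    eps inn out (swap e f * σ) g h = eps inn out σ g h := by
  simp [eps, mul_inv_rev, Perm.mul_apply, swap_apply_of_ne_of_ne, *]

/-- A smoothed crossing is no longer a crossing. -/
theorem Generic.eps_mul_self [DecidableEq E] (hg : Generic inn out) (σ : Perm E) {e f : E}
    (h : e ≠ f) :
    eps inn out σ e f * eps inn out (swap e f * σ) e f = 0 := by
  simp only [eps, mul_inv_rev, swap_inv, Perm.mul_apply, swap_apply_left, swap_apply_right]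
  exact cross_mul_cross_smoothing (hg.inn_ne_out _ _) (hg.inn_ne_out _ _)
    (hg.inn_injective.ne (σ⁻¹.injective.ne h)) (hg.inn_ne_out _ _)
    (hg.inn_ne_out _ _).symm (hg.out_injective.ne h)

/-- For three passages, the three ways of smoothing two of the crossings among them one after the
other cancel. All identities below rest on this and on the antisymmetry of `eps`. -/
theorem Generic.eps_cyclic [DecidableEq E] (hg : Generic inn out) (σ : Perm E) {e f g : E}
    (h₁ : e ≠ f) (h₂ : f ≠ g) (h₃ : e ≠ g) :
    eps inn out σ f g * eps inn out (swap f g * σ) e f +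
      eps inn out σ g e * eps inn out (swap g e * σ) f g +
      eps inn out σ e f * eps inn out (swap e f * σ) g e = 0 := by
  simp only [eps, mul_inv_rev, swap_inv, Perm.mul_apply, swap_apply_left,
    swap_apply_of_ne_of_ne h₁ h₃, swap_apply_of_ne_of_ne h₂ h₁.symm,
    swap_apply_of_ne_of_ne h₃.symm h₂.symm]
  have hi {a b : E} (h : a ≠ b) : inn (σ⁻¹ a) ≠ inn (σ⁻¹ b) :=
    hg.inn_injective.ne (σ⁻¹.injective.ne h)
  have ho {a b : E} (h : a ≠ b) : out a ≠ out b := hg.out_injective.ne h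
  have hio (a b : E) : inn a ≠ out b := hg.inn_ne_out a b
  exact cross_mul_cross_cyclic (hi h₁) (hio _ _) (hio _ _).symm (ho h₁) (hi h₃) (hio _ _)
    (hio _ _).symm (ho h₃) (hi h₂) (hio _ _) (hio _ _).symm (ho h₂)

theorem swap_mul_swap_comm [DecidableEq E] (σ : Perm E) {e f g h : E} (h₁ : g ≠ e) (h₂ : g ≠ f)
    (h₃ : h ≠ e) (h₄ : h ≠ f) : swap g h * (swap e f * σ) = swap e f * (swap g h * σ) := by
  rw [← mul_assoc, ← mul_assoc, mul_swap_eq_swap_mul, swap_apply_of_ne_of_ne h₁.symm h₃.symm,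
    swap_apply_of_ne_of_ne h₂.symm h₄.symm]

/-- The ways to write a cyclic permutation of `e`, `f`, `g` as a product of two transpositions. -/
theorem swap_mul_swap_rotate [DecidableEq E] (σ : Perm E) {e f g : E} (h₁ : e ≠ f) (h₃ : e ≠ g) :
    swap e f * (swap f g * σ) = swap f g * (swap g e * σ) := by
  rw [← mul_assoc, ← mul_assoc, mul_swap_eq_swap_mul (swap f g), swap_apply_right,
    swap_apply_of_ne_of_ne h₁ h₃, swap_comm f e]

end Eps

/-! ### Skew symmetry and the Jacobi identity for cycles of permutations -/

section Identities
open Equiv Equiv.Perm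
variable {E : Type*} {α : Type*} [LinearOrder α]
variable {𝕜 : Type*} [CommRing 𝕜] {A : Type*} [AddCommGroup A] [Module 𝕜 A]

/-- A bracket and a cobracket that are given, on the elements `cl σ e` attached to the cycles of
permutations `σ`, by smoothing the crossings of the passages: two cycles are joined, respectively
one cycle is cut, by composing `σ` with a transposition. -/
structure Realizes [Fintype E] [DecidableEq E] (br : A ⊗[𝕜] A →ₗ[𝕜] A) (dl : A →ₗ[𝕜] A ⊗[𝕜] A)
    (inn out : E → α) (cl : Perm E → E → A) : Prop where
  cl_eq : ∀ {σ : Perm E} {a b : E}, σ.SameCycle a b → cl σ a = cl σ b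
  cl_swap : ∀ {σ : Perm E} {a e f : E}, ¬σ.SameCycle a e → ¬σ.SameCycle a f →
    cl (swap e f * σ) a = cl σ a
  br_cl : ∀ {σ : Perm E} {a b : E}, ¬σ.SameCycle a b → br (cl σ a ⊗ₜ cl σ b) =
    ∑ e, ∑ f, if σ.SameCycle a e ∧ σ.SameCycle b f then
      eps inn out σ e f • cl (swap e f * σ) e else 0
  dl_cl : ∀ (σ : Perm E) (a : E), dl (cl σ a) =
    ∑ e, ∑ f, if σ.SameCycle a e ∧ σ.SameCycle a f ∧ e ≠ f then
      eps inn out σ e f • (cl (swap e f * σ) e ⊗ₜ[𝕜] cl (swap e f * σ) f) else 0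

theorem map_sum_ite [Fintype E] {M N : Type*} [AddCommGroup M] [AddCommGroup N] {F : Type*}
    [FunLike F M N] [AddMonoidHomClass F M N] (φ : F) (p : E → E → Prop) [∀ e f, Decidable (p e f)]
    (k : E → E → ℤ) (v : E → E → M) :
    φ (∑ e, ∑ f, if p e f then k e f • v e f else 0) =
      ∑ e, ∑ f, if p e f then k e f • φ (v e f) else 0 := by
  simp only [map_sum]
  refine Finset.sum_congr rfl fun e _ => Finset.sum_congr rfl fun f _ => ?_
  split_ifs <;> simp [map_zsmul]

section Sums
variable {M : Type*} [AddCommGroup M]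

theorem sum_rotate₃ [Fintype E] (F : E → E → E → M) :
    ∑ e, ∑ f, ∑ g, F e f g = ∑ e, ∑ f, ∑ g, F f g e := by
  symm
  rw [Finset.sum_comm]
  exact Finset.sum_congr rfl fun f _ => Finset.sum_comm

/-- Renaming of the summation indices that exchanges the inner ends of two crossings `(e, f)`, `(g,
h)`. -/
theorem sum_twist₄ [Fintype E] (F : E → E → E → E → M) :
    ∑ e, ∑ f, ∑ g, ∑ h, F e f g h = ∑ e, ∑ f, ∑ g, ∑ h, F g h f e := by
  have h1 : ∑ e, ∑ f, ∑ g, ∑ h, F g h f e = ∑ f, ∑ e, ∑ g, ∑ h, F g h f e := Finset.sum_comm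
  rw [h1]
  have h2 : ∑ e, ∑ f, ∑ g, ∑ h, F e f g h = ∑ p : E × E, ∑ q : E × E, F p.1 p.2 q.1 q.2 := by
    simp only [Fintype.sum_prod_type]
  have h3 : ∑ f, ∑ e, ∑ g, ∑ h, F g h f e = ∑ q : E × E, ∑ p : E × E, F p.1 p.2 q.1 q.2 := by
    simp only [Fintype.sum_prod_type]
  rw [h2, h3, Finset.sum_comm]

/-- A function on triples whose sums over cyclic rotations vanish has total sum zero: there is
exactly one rotation of a triple of distinct elements that starts with the smallest one. -/
theorem sum_eq_zero_of_rotate [Fintype E] {out : E → α} (ho : Function.Injective out)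
    (F : E → E → E → M) (h₀ : ∀ e f g, F e f g + F f g e + F g e f = 0)
    (h₁ : ∀ e f g, ¬(e ≠ f ∧ f ≠ g ∧ e ≠ g) → F e f g = 0) : ∑ e, ∑ f, ∑ g, F e f g = 0 := by
  set G : E → E → E → M := fun e f g => if out e < out f ∧ out e < out g then F e f g else 0
    with hG
  have key (e f g : E) : F e f g = G e f g +
      (if out f < out g ∧ out f < out e then F e f g else 0) +
      (if out g < out e ∧ out g < out f then F e f g else 0) := by
    by_cases hd : e ≠ f ∧ f ≠ g ∧ e ≠ g
    · obtain ⟨a1, a2, a3⟩ := hd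
      have a1 := ho.ne a1; have a2 := ho.ne a2; have a3 := ho.ne a3
      simp only [hG]
      rcases lt_or_gt_of_ne a1 with a1 | a1 <;> rcases lt_or_gt_of_ne a2 with a2 | a2 <;>
        rcases lt_or_gt_of_ne a3 with a3 | a3 <;>
        simp [a1, a2, a3, a1.not_gt, a2.not_gt, a3.not_gt]
      · exact absurd (a1.trans a2) a3.not_gt
      · exact absurd (a2.trans a1) a3.not_gt
    · simp [hG, h₁ e f g hd]
  have e1 : ∑ e, ∑ f, ∑ g, F e f g = ∑ e, ∑ f, ∑ g, G e f g +
      ∑ e, ∑ f, ∑ g, (if out f < out g ∧ out f < out e then F e f g else 0) +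
      ∑ e, ∑ f, ∑ g, (if out g < out e ∧ out g < out f then F e f g else 0) := by
    simp only [← Finset.sum_add_distrib, ← key]
  rw [e1, sum_rotate₃ (fun e f g => if out g < out e ∧ out g < out f then F e f g else 0),
    ← sum_rotate₃ (fun f g e => if out f < out g ∧ out f < out e then F e f g else 0)]
  simp only [← Finset.sum_add_distrib, hG]
  refine Finset.sum_eq_zero fun e _ => Finset.sum_eq_zero fun f _ => Finset.sum_eq_zero fun g _ =>
      ?_
  split_ifs
  · rw [← h₀ e f g]; abel
  · simp

end Sums

variable {br : A ⊗[𝕜] A →ₗ[𝕜] A} {dl : A →ₗ[𝕜] A ⊗[𝕜] A} {inn out : E → α}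
  {cl : Perm E → E → A}

/-- Skew symmetry: the two orders of the curves see the same crossings with opposite signs. -/
theorem Realizes.skew [Fintype E] [DecidableEq E] (hr : Realizes br dl inn out cl)
    (hg : Generic inn out) {σ : Perm E} {a b : E} (hab : ¬σ.SameCycle a b) :
    br (cl σ b ⊗ₜ cl σ a) = -br (cl σ a ⊗ₜ cl σ b) := by
  rw [hr.br_cl hab, hr.br_cl (fun h => hab h.symm), Finset.sum_comm, ← Finset.sum_neg_distrib]
  refine Finset.sum_congr rfl fun e _ => ?_
  rw [← Finset.sum_neg_distrib]
  refine Finset.sum_congr rfl fun f _ => ?_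
  by_cases h : σ.SameCycle a e ∧ σ.SameCycle b f
  · have hef : ¬σ.SameCycle e f := fun h' => hab (h.1.trans (h'.trans h.2.symm))
    have hne : e ≠ f := fun h' => hef (h' ▸ SameCycle.refl _ _)
    rw [if_pos h, if_pos h.symm, hg.eps_swap σ hne.symm, swap_comm f e,
      ← hr.cl_eq (sameCycle_swap_self hef), neg_smul]
  · rw [if_neg h, if_neg (fun h' => h h'.symm), neg_zero]

/-- Coskew symmetry: a crossing of `e` and `f` is also a crossing of `f` and `e`, with the opposite
sign. -/
theorem Realizes.coskew [Fintype E] [DecidableEq E] (hr : Realizes br dl inn out cl)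
    (hg : Generic inn out) (σ : Perm E) (a : E) : LieBialg.s (dl (cl σ a)) = -dl (cl σ a) := by
  rw [hr.dl_cl, map_sum_ite, Finset.sum_comm, ← Finset.sum_neg_distrib]
  refine Finset.sum_congr rfl fun e _ => ?_
  rw [← Finset.sum_neg_distrib]
  refine Finset.sum_congr rfl fun f _ => ?_
  by_cases h : σ.SameCycle a e ∧ σ.SameCycle a f ∧ e ≠ f
  · rw [if_pos h, if_pos ⟨h.2.1, h.1, h.2.2.symm⟩, hg.eps_swap σ h.2.2.symm, swap_comm f e,
      neg_smul]
    simp [LieBialg.s]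
  · rw [if_neg h, if_neg (fun h' => h ⟨h'.2.1, h'.1, h'.2.2.symm⟩), neg_zero]

/-- An iterated bracket as a sum over pairs of crossings, the second one on the smoothed curve. -/
theorem Realizes.br_br [Fintype E] [DecidableEq E] (hr : Realizes br dl inn out cl) {σ : Perm E}
    {a b c : E} (hab : ¬σ.SameCycle a b) (hbc : ¬σ.SameCycle b c) (hac : ¬σ.SameCycle a c) :
    br (cl σ a ⊗ₜ br (cl σ b ⊗ₜ cl σ c)) = ∑ f, ∑ g, ∑ e, ∑ h,
      if (σ.SameCycle b f ∧ σ.SameCycle c g ∧ σ.SameCycle a e) ∧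
        (σ.SameCycle b h ∨ σ.SameCycle c h) then
        (eps inn out σ f g * eps inn out (swap f g * σ) e h) •
          cl (swap e h * (swap f g * σ)) e else 0 := by
  rw [hr.br_cl hbc]
  have := map_sum_ite (br ∘ₗ TensorProduct.mk 𝕜 A A (cl σ a))
    (fun f g => σ.SameCycle b f ∧ σ.SameCycle c g) (fun f g => eps inn out σ f g)
    (fun f g => cl (swap f g * σ) f)
  simp only [LinearMap.comp_apply, TensorProduct.mk_apply] at this
  rw [this]
  refine Finset.sum_congr rfl fun f _ => Finset.sum_congr rfl fun g _ => ?_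
  by_cases hfg : σ.SameCycle b f ∧ σ.SameCycle c g
  · obtain ⟨hf, hg⟩ := hfg
    have haf : ¬σ.SameCycle a f := fun h => hab (h.trans hf.symm)
    have hag : ¬σ.SameCycle a g := fun h => hac (h.trans hg.symm)
    have hfg : ¬σ.SameCycle f g := fun h => hbc (hf.trans (h.trans hg.symm))
    have hiff (x y : E) := sameCycle_swap_iff hfg x y
    have haf' : ¬(swap f g * σ).SameCycle a f := by
      rw [hiff]
      rintro (h | h | h)
      · exact haf h
      · exact haf h.1.symm
      · exact hag h.1.symm
    rw [if_pos ⟨hf, hg⟩, ← hr.cl_swap haf hag, hr.br_cl haf', Finset.smul_sum]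
    refine Finset.sum_congr rfl fun e _ => ?_
    rw [Finset.smul_sum]
    refine Finset.sum_congr rfl fun h _ => ?_
    have c1 : (swap f g * σ).SameCycle a e ↔ σ.SameCycle a e := by
      rw [hiff]
      exact ⟨fun h => h.resolve_right (by rintro (h | h); exacts [haf h.1.symm, hag h.1.symm]),
        Or.inl⟩
    have c2 : (swap f g * σ).SameCycle f h ↔ (σ.SameCycle b h ∨ σ.SameCycle c h) := by
      rw [hiff]
      have e1 : σ.SameCycle f h ↔ σ.SameCycle b h := ⟨hf.trans, hf.symm.trans⟩
      have e2 : σ.SameCycle g h ↔ σ.SameCycle c h := ⟨hg.trans, hg.symm.trans⟩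
      have e3 : ¬ σ.SameCycle g f := fun h => hfg h.symm
      have e4 := SameCycle.refl σ f
      tauto
    simp only [c1, c2]
    by_cases hcond : σ.SameCycle a e ∧ (σ.SameCycle b h ∨ σ.SameCycle c h)
    · rw [if_pos hcond, if_pos ⟨⟨hf, hg, hcond.1⟩, hcond.2⟩, smul_smul]
    · rw [if_neg hcond, if_neg (by tauto), smul_zero]
  · rw [if_neg hfg]
    symm
    refine Finset.sum_eq_zero fun e _ => Finset.sum_eq_zero fun h _ => if_neg (by tauto)

/-- The Jacobi identity. Of the pairs of crossings in an iterated bracket, those without a common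
passage occur twice with opposite signs, in either order of smoothing, and those with a common
passage cancel in threes by `Generic.eps_cyclic`. -/
theorem Realizes.jacobi [Fintype E] [DecidableEq E] (hr : Realizes br dl inn out cl)
    (hg : Generic inn out) {σ : Perm E} {a b c : E} (hab : ¬σ.SameCycle a b)
    (hbc : ¬σ.SameCycle b c) (hac : ¬σ.SameCycle a c) :
    br (cl σ a ⊗ₜ br (cl σ b ⊗ₜ cl σ c)) + br (cl σ c ⊗ₜ br (cl σ a ⊗ₜ cl σ b)) +
      br (cl σ b ⊗ₜ br (cl σ c ⊗ₜ cl σ a)) = 0 := by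
  obtain ⟨T, hT⟩ : ∃ T : E → E → E → E → A, ∀ e h f g, T e h f g =
      (eps inn out σ f g * eps inn out (swap f g * σ) e h) •
        cl (swap e h * (swap f g * σ)) e := ⟨_, fun _ _ _ _ => rfl⟩
  -- The second crossing is away from the first one, on the first or on the second of the two
  -- curves that have been joined, or it is on one of the two passages of the first crossing.
  have split (a b c : E) (hab : ¬σ.SameCycle a b) (hbc : ¬σ.SameCycle b c)
      (hac : ¬σ.SameCycle a c) : br (cl σ a ⊗ₜ br (cl σ b ⊗ₜ cl σ c)) =
      (∑ f, ∑ g, ∑ e, ∑ h, if σ.SameCycle b f ∧ σ.SameCycle c g ∧ σ.SameCycle a e ∧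
        σ.SameCycle b h ∧ h ≠ f then T e h f g else 0) +
      (∑ f, ∑ g, ∑ e, ∑ h, if σ.SameCycle b f ∧ σ.SameCycle c g ∧ σ.SameCycle a e ∧
        σ.SameCycle c h ∧ h ≠ g then T e h f g else 0) +
      ∑ f, ∑ g, ∑ e, if σ.SameCycle b f ∧ σ.SameCycle c g ∧ σ.SameCycle a e then
        T e f f g + T e g f g else 0 := by
    rw [hr.br_br hab hbc hac]
    simp only [← hT, ← Finset.sum_add_distrib]
    refine Finset.sum_congr rfl fun f _ => Finset.sum_congr rfl fun g _ =>
      Finset.sum_congr rfl fun e _ => ?_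
    by_cases hB : σ.SameCycle b f ∧ σ.SameCycle c g ∧ σ.SameCycle a e
    · obtain ⟨hf, hg', he⟩ := hB
      have e1 : T e f f g + T e g f g =
          ∑ h, ((if h = f then T e f f g else 0) + (if h = g then T e g f g else 0)) := by
        simp [Finset.sum_add_distrib]
      rw [if_pos ⟨hf, hg', he⟩, e1, ← Finset.sum_add_distrib]
      refine Finset.sum_congr rfl fun h _ => ?_
      have hfg : f ≠ g := fun h => hbc (hf.trans (h ▸ hg'.symm))
      have hx : ¬(σ.SameCycle b h ∧ σ.SameCycle c h) := fun h => hbc (h.1.trans h.2.symm)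
      by_cases h1 : h = f
      · subst h1
        have : ¬σ.SameCycle c h := fun h' => hx ⟨hf, h'⟩
        simp [hf, hg', he, this, hfg]
      · by_cases h2 : h = g
        · subst h2
          have : ¬σ.SameCycle b h := fun h' => hx ⟨h', hg'⟩
          simp [hf, hg', he, this, h1]
        · by_cases hbh : σ.SameCycle b h
          · have : ¬σ.SameCycle c h := fun h' => hx ⟨hbh, h'⟩
            simp [hf, hg', he, hbh, this, h1, h2]
          · simp [hf, hg', he, hbh, h1, h2]
    · rw [if_neg hB, add_zero]
      refine Finset.sum_congr rfl fun h _ => ?_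
      rw [if_neg (by tauto), if_neg (by tauto), if_neg (by tauto), add_zero]
  -- Crossings in disjoint pairs of passages can be smoothed in either order.
  have cancel (a b c : E) (hab : ¬σ.SameCycle a b) (hbc : ¬σ.SameCycle b c)
      (hac : ¬σ.SameCycle a c) :
      (∑ f, ∑ g, ∑ e, ∑ h, if σ.SameCycle a f ∧ σ.SameCycle b g ∧ σ.SameCycle c e ∧
        σ.SameCycle b h ∧ h ≠ g then T e h f g else 0) =
      -(∑ f, ∑ g, ∑ e, ∑ h, if σ.SameCycle b f ∧ σ.SameCycle c g ∧ σ.SameCycle a e ∧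
        σ.SameCycle b h ∧ h ≠ f then T e h f g else 0) := by
    rw [sum_twist₄]
    simp only [← Finset.sum_neg_distrib]
    refine Finset.sum_congr rfl fun f _ => Finset.sum_congr rfl fun g _ =>
      Finset.sum_congr rfl fun e _ => Finset.sum_congr rfl fun h _ => ?_
    by_cases hB : σ.SameCycle b f ∧ σ.SameCycle c g ∧ σ.SameCycle a e ∧ σ.SameCycle b h ∧ h ≠ f
    · obtain ⟨hf, hg', he, hh, hne⟩ := hB
      rw [if_pos ⟨he, hh, hg', hf, hne.symm⟩, if_pos ⟨hf, hg', he, hh, hne⟩, hT, hT]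
      have n1 : e ≠ f := fun h => hab (he.trans (h ▸ hf.symm))
      have n2 : e ≠ g := fun h => hac (he.trans (h ▸ hg'.symm))
      have n3 : h ≠ g := fun h => hbc (hh.trans (h ▸ hg'.symm))
      have n4 : f ≠ g := fun h => hbc (hf.trans (h ▸ hg'.symm))
      have hfg : ¬σ.SameCycle f g := fun h => hbc (hf.trans (h.trans hg'.symm))
      have heh : ¬(swap f g * σ).SameCycle e h := by
        rw [sameCycle_swap_iff hfg]
        rintro (h' | h' | h')
        · exact hab (he.trans (h'.trans hh.symm))
        · exact hab (he.trans (h'.1.symm.trans hf.symm))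
        · exact hac (he.trans (h'.1.symm.trans hg'.symm))
      have hhg : (swap f g * σ).SameCycle h g := by
        rw [sameCycle_swap_iff hfg]
        exact Or.inr (Or.inl ⟨hf.symm.trans hh, SameCycle.refl _ _⟩)
      have heg : (swap e h * (swap f g * σ)).SameCycle e g := by
        rw [sameCycle_swap_iff heh]
        exact Or.inr (Or.inl ⟨SameCycle.refl _ _, hhg⟩)
      rw [eps_of_ne σ n2.symm n3.symm n1.symm hne.symm, eps_of_ne σ n1 n2 hne n3,
        hg.eps_swap σ n4.symm, swap_comm g f, swap_mul_swap_comm σ n1.symm hne.symm n2.symm n3.symm,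
        hr.cl_eq heg, ← neg_smul]
      congr 1; ring
    · rw [if_neg hB, if_neg (by tauto), neg_zero]
  -- For three passages, the local identity applies.
  have loc : (∑ f, ∑ g, ∑ e, if σ.SameCycle b f ∧ σ.SameCycle c g ∧ σ.SameCycle a e then
        T e f f g + T e g f g else 0) +
      (∑ f, ∑ g, ∑ e, if σ.SameCycle a f ∧ σ.SameCycle b g ∧ σ.SameCycle c e then
        T e f f g + T e g f g else 0) +
      (∑ f, ∑ g, ∑ e, if σ.SameCycle c f ∧ σ.SameCycle a g ∧ σ.SameCycle b e then
        T e f f g + T e g f g else 0) = 0 := by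
    rw [sum_rotate₃ (fun f g e => if σ.SameCycle c f ∧ σ.SameCycle a g ∧ σ.SameCycle b e then
        T e f f g + T e g f g else 0),
      ← sum_rotate₃ (fun g e f => if σ.SameCycle a f ∧ σ.SameCycle b g ∧ σ.SameCycle c e then
        T e f f g + T e g f g else 0)]
    simp only [← Finset.sum_add_distrib]
    refine Finset.sum_eq_zero fun f _ => Finset.sum_eq_zero fun g _ =>
      Finset.sum_eq_zero fun e _ => ?_
    by_cases hB : σ.SameCycle b f ∧ σ.SameCycle c g ∧ σ.SameCycle a e
    · obtain ⟨hf, hg', he⟩ := hB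
      rw [if_pos ⟨hf, hg', he⟩, if_pos ⟨he, hf, hg'⟩, if_pos ⟨hg', he, hf⟩]
      have n1 : e ≠ f := fun h => hab (he.trans (h ▸ hf.symm))
      have n2 : e ≠ g := fun h => hac (he.trans (h ▸ hg'.symm))
      have n3 : f ≠ g := fun h => hbc (hf.trans (h ▸ hg'.symm))
      have hef : ¬σ.SameCycle e f := fun h => hab (he.trans (h.trans hf.symm))
      have heg : ¬σ.SameCycle e g := fun h => hac (he.trans (h.trans hg'.symm))
      have hfg : ¬σ.SameCycle f g := fun h => hbc (hf.trans (h.trans hg'.symm))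
      have cyclic {e f g : E} (hef : ¬σ.SameCycle e f) (heg : ¬σ.SameCycle e g)
          (hfg : ¬σ.SameCycle f g) : T e f f g + T f g g e + T g e e f = 0 := by
        have ne {x y : E} (h : ¬σ.SameCycle x y) : x ≠ y := fun h' => h (h' ▸ SameCycle.refl _ _)
        have merged {e f g : E} (hef : ¬σ.SameCycle e f) (heg : ¬σ.SameCycle e g)
            (hfg : ¬σ.SameCycle f g) : (swap e f * (swap f g * σ)).SameCycle e f := by
          refine sameCycle_swap_self ?_
          rw [sameCycle_swap_iff hfg]
          rintro (h | h | h)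
          · exact hef h
          · exact hef h.1.symm
          · exact heg h.1.symm
        have r1 := swap_mul_swap_rotate σ (ne hef) (ne heg)
        have r2 := swap_mul_swap_rotate σ (ne hfg) (ne hef).symm
        have m1 := hr.cl_eq (merged hef heg hfg)
        have m2 := hr.cl_eq (merged hfg (fun h => hef h.symm) (fun h => heg h.symm))
        rw [r1, m2] at m1
        rw [hT, hT, hT, ← r2, r1, m1, m2, ← add_smul, ← add_smul, hg.eps_cyclic σ (ne hef) (ne hfg)
            (ne heg), zero_smul]
      have flip {e f g : E} (hne : f ≠ g) : T e g f g = -T e g g f := by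
        rw [hT, hT, hg.eps_swap σ hne, swap_comm f g, neg_mul, neg_smul]
      have i1 := cyclic hef heg hfg
      have i2 := cyclic heg hef (fun h => hfg h.symm)
      rw [flip n3, flip n1, flip n2.symm]
      have : T e f f g + -T e g g f + (T g e e f + -T g f f e) + (T f g g e + -T f e e g) =
        (T e f f g + T f g g e + T g e e f) - (T e g g f + T g f f e + T f e e g) := by abel
      rw [this, i1, i2, sub_zero]
    · rw [if_neg hB, if_neg (by tauto), if_neg (by tauto)]; simp
  rw [split a b c hab hbc hac, split c a b (fun h => hac h.symm) hab (fun h => hbc h.symm),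
    split b c a hbc (fun h => hac h.symm) (fun h => hab h.symm), cancel a b c hab hbc hac,
    cancel b c a hbc (fun h => hac h.symm) (fun h => hab h.symm),
    cancel c a b (fun h => hac h.symm) hab (fun h => hbc h.symm)]
  refine Eq.trans ?_ loc
  abel

end Identities

/-! ### The co-Jacobi identity -/

section Identities
open Equiv Equiv.Perm
variable {E : Type*} {α : Type*} [LinearOrder α]
variable {𝕜 : Type*} [CommRing 𝕜] {A : Type*} [AddCommGroup A] [Module 𝕜 A]
variable {br : A ⊗[𝕜] A →ₗ[𝕜] A} {dl : A →ₗ[𝕜] A ⊗[𝕜] A} {inn out : E → α}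
  {cl : Perm E → E → A}

/-- Two elements that are in different cycles after composition with their transposition were in
the same cycle before. -/
theorem sameCycle_of_not_sameCycle_swap [Fintype E] [DecidableEq E] {σ : Perm E} {e f : E}
    (h : ¬(swap e f * σ).SameCycle e f) : σ.SameCycle e f := by
  by_contra h'
  exact h (sameCycle_swap_self h')

theorem sameCycle_of_swap [Fintype E] [DecidableEq E] {σ : Perm E} {e f x y : E}
    (h : σ.SameCycle e f) (hef : e ≠ f) (hxy : (swap e f * σ).SameCycle x y) : σ.SameCycle x y :=
  (sameCycle_iff_swap h hef x y).2 (Or.inl hxy)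

/-- Two disjoint crossings that cut one cycle into three, described symmetrically. -/
theorem cut_cut_iff [Fintype E] [DecidableEq E] {σ : Perm E} (hσ : ∀ x y, σ.SameCycle x y)
    (e f g h : E) :
    (e ≠ f ∧ (swap e f * σ).SameCycle f g ∧ (swap e f * σ).SameCycle f h ∧ g ≠ h ∧ g ≠ f ∧ h ≠ f ∧
      (swap g h * (swap e f * σ)).SameCycle f h) ↔
    (e ≠ f ∧ g ≠ h ∧ g ≠ f ∧ h ≠ f ∧ g ≠ e ∧ h ≠ e) ∧
      ¬(swap g h * (swap e f * σ)).SameCycle e g ∧ ¬(swap g h * (swap e f * σ)).SameCycle g h ∧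
      ¬(swap g h * (swap e f * σ)).SameCycle e h ∧ (swap g h * (swap e f * σ)).SameCycle f h := by
  constructor
  · rintro ⟨hef, hfg, hfh, hgh, hgf, hhf, hτ⟩
    have h1 : (swap e f * σ).SameCycle g h := hfg.symm.trans hfh
    have h2 := not_sameCycle_swap (hσ e f) hef
    have h3 {x y : E} (h : (swap g h * (swap e f * σ)).SameCycle x y) := sameCycle_of_swap h1 hgh h
    exact ⟨⟨hef, hgh, hgf, hhf, fun h => h2 (h ▸ hfg.symm), fun h => h2 (h ▸ hfh.symm)⟩,
      fun h => h2 ((h3 h).trans hfg.symm), not_sameCycle_swap h1 hgh,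
      fun h => h2 ((h3 h).trans hfh.symm), hτ⟩
  · rintro ⟨⟨hef, hgh, hgf, hhf, hge, hhe⟩, h1, h2, h3, h4⟩
    have h5 := sameCycle_of_not_sameCycle_swap h2
    have h6 := sameCycle_of_swap h5 hgh h4
    exact ⟨hef, h6.trans h5.symm, h6, hgh, hgf, hhf, h4⟩

theorem cut_cut_swap_iff [Fintype E] [DecidableEq E] {σ : Perm E} (hσ : ∀ x y, σ.SameCycle x y)
    (e f g h : E) :
    (g ≠ h ∧ (swap g h * σ).SameCycle h f ∧ (swap g h * σ).SameCycle h e ∧ f ≠ e ∧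
        f ≠ h ∧ e ≠ h ∧ (swap f e * (swap g h * σ)).SameCycle h f) ↔
      (e ≠ f ∧ (swap e f * σ).SameCycle f g ∧ (swap e f * σ).SameCycle f h ∧ g ≠ h ∧ g ≠ f ∧
          h ≠ f ∧ (swap g h * (swap e f * σ)).SameCycle f h) := by
  have c2 := cut_cut_iff hσ g h e f
  rw [swap_comm f e]
  rw [cut_cut_iff hσ]
  have sy (π : Perm E) (x y : E) : π.SameCycle x y ↔ π.SameCycle y x := sameCycle_comm
  have c3 (hd : g ≠ e ∧ g ≠ f ∧ h ≠ e ∧ h ≠ f) :=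
      swap_mul_swap_comm σ hd.1 hd.2.1 hd.2.2.1 hd.2.2.2
  constructor
  · rintro ⟨b1, b2, b3, b4, b5, b6, b7⟩
    obtain ⟨⟨a1, a2, a3, a4, a5, a6⟩, b1, b2, b3, b4⟩ := c2.1 ⟨b1, b3, b2, b4.symm, b6, b5, b7⟩
    rw [c3 ⟨a5.symm, a6.symm, a3.symm, a4.symm⟩]
    exact ⟨⟨a2, a1, a6.symm, a4.symm, a5.symm, a3.symm⟩, fun h => b1 h.symm,
      fun h => b3 (h.trans b4), fun h => b2 (h.trans b4), b4.symm⟩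
  · rintro ⟨⟨a1, a2, a3, a4, a5, a6⟩, b1, b2, b3, b4⟩
    rw [c3 ⟨a5, a3, a6, a4⟩] at b1 b2 b3 b4
    obtain ⟨b1, b3, b2, b4, b5, b6, b7⟩ := c2.2 ⟨⟨a2, a1, a6.symm, a4.symm, a5.symm, a3.symm⟩,
      fun h => b1 h.symm, fun h => b3 (h.trans b4), fun h => b2 (h.trans b4), b4.symm⟩
    exact ⟨b1, b2, b3, b4.symm, b6, b5, b7⟩

/-- Three passages in the cyclic order `e`, `f`, `h` on one cycle, described symmetrically. -/
theorem cyclic_order_iff [Fintype E] [DecidableEq E] {σ : Perm E} (hσ : ∀ x y, σ.SameCycle x y)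
    (e f h : E) :
    (e ≠ f ∧ f ≠ h ∧ (swap e f * σ).SameCycle f h) ↔
    (e ≠ f ∧ f ≠ h ∧ e ≠ h) ∧ ¬(swap f h * (swap e f * σ)).SameCycle e f ∧
      ¬(swap f h * (swap e f * σ)).SameCycle f h ∧
      ¬(swap f h * (swap e f * σ)).SameCycle e h := by
  constructor
  · rintro ⟨hef, hfh, h1⟩
    have h2 := not_sameCycle_swap (hσ e f) hef
    have h3 {x y : E} (h : (swap f h * (swap e f * σ)).SameCycle x y) := sameCycle_of_swap h1 hfh h
    exact ⟨⟨hef, hfh, fun h => h2 (h ▸ h1.symm)⟩, fun h => h2 (h3 h), not_sameCycle_swap h1 hfh,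
      fun h => h2 ((h3 h).trans h1.symm)⟩
  · rintro ⟨⟨hef, hfh, -⟩, h1, h2, h3⟩
    exact ⟨hef, hfh, sameCycle_of_not_sameCycle_swap h2⟩

/-- The relation of `cyclic_order_iff` is invariant under rotation. -/
theorem cyclic_order_rotate [Fintype E] [DecidableEq E] {σ : Perm E} (hσ : ∀ x y, σ.SameCycle x y)
    (e f h : E) :
    (e ≠ f ∧ f ≠ h ∧ (swap e f * σ).SameCycle f h) ↔
      (f ≠ h ∧ h ≠ e ∧ (swap f h * σ).SameCycle h e) := by
  rw [cyclic_order_iff hσ, cyclic_order_iff hσ]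
  by_cases hd : e ≠ f ∧ f ≠ h ∧ e ≠ h
  · have hr : swap h e * (swap f h * σ) = swap f h * (swap e f * σ) := by
      rw [swap_comm h e, swap_comm f h, swap_comm e f]
      exact swap_mul_swap_rotate σ hd.2.2 hd.1
    have c (x y : E) : (swap f h * (swap e f * σ)).SameCycle x y ↔
        (swap f h * (swap e f * σ)).SameCycle y x := sameCycle_comm
    rw [hr, c h e, c f e]
    tauto
  · constructor <;> intro h' <;> exact absurd h'.1 (by tauto)

/-- An iterated cobracket as a sum over pairs of crossings, the second one on one of the two
parts. -/
theorem Realizes.dl_dl [Fintype E] [DecidableEq E] (hr : Realizes br dl inn out cl) {σ : Perm E}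
    (hσ : ∀ x y, σ.SameCycle x y) (a : E) :
    dl.lTensor A (dl (cl σ a)) = ∑ e, ∑ f, ∑ g, ∑ h,
      if e ≠ f ∧ (swap e f * σ).SameCycle f g ∧ (swap e f * σ).SameCycle f h ∧ g ≠ h then
        (eps inn out σ e f * eps inn out (swap e f * σ) g h) •
          (cl (swap g h * (swap e f * σ)) e ⊗ₜ[𝕜] (cl (swap g h * (swap e f * σ)) g ⊗ₜ[𝕜]
            cl (swap g h * (swap e f * σ)) h)) else 0 := by
  rw [hr.dl_cl, map_sum_ite]
  refine Finset.sum_congr rfl fun e _ => Finset.sum_congr rfl fun f _ => ?_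
  by_cases hef : e ≠ f
  · rw [if_pos ⟨hσ _ _, hσ _ _, hef⟩, LinearMap.lTensor_tmul, hr.dl_cl]
    have := map_sum_ite (TensorProduct.mk 𝕜 A (A ⊗[𝕜] A) (cl (swap e f * σ) e))
      (fun g h => (swap e f * σ).SameCycle f g ∧ (swap e f * σ).SameCycle f h ∧ g ≠ h)
      (fun g h => eps inn out (swap e f * σ) g h)
      (fun g h => cl (swap g h * (swap e f * σ)) g ⊗ₜ[𝕜] cl (swap g h * (swap e f * σ)) h)
    simp only [TensorProduct.mk_apply] at this
    rw [this, Finset.smul_sum]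
    refine Finset.sum_congr rfl fun g _ => ?_
    rw [Finset.smul_sum]
    refine Finset.sum_congr rfl fun h _ => ?_
    by_cases hc : (swap e f * σ).SameCycle f g ∧ (swap e f * σ).SameCycle f h ∧ g ≠ h
    · have h2 := not_sameCycle_swap (hσ e f) hef
      rw [if_pos hc, if_pos ⟨hef, hc⟩, smul_smul, hr.cl_swap (σ := swap e f * σ) (a := e)
        (fun h => h2 (h.trans hc.1.symm)) (fun h => h2 (h.trans hc.2.1.symm))]
    · rw [if_neg hc, if_neg (fun h => hc h.2), smul_zero]
  · rw [if_neg (by tauto)]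
    symm
    exact Finset.sum_eq_zero fun g _ => Finset.sum_eq_zero fun h _ => if_neg (by tauto)

theorem ε_tmul (x y z : A) : LieBialg.ε (x ⊗ₜ[𝕜] (y ⊗ₜ[𝕜] z)) = z ⊗ₜ[𝕜] (x ⊗ₜ[𝕜] y) := by
  simp [LieBialg.ε]

theorem ε_ε_ε (x : A ⊗[𝕜] (A ⊗[𝕜] A)) : LieBialg.ε (LieBialg.ε (LieBialg.ε x)) = x := by
  have : (LieBialg.ε ∘ₗ LieBialg.ε ∘ₗ LieBialg.ε :
      A ⊗[𝕜] (A ⊗[𝕜] A) →ₗ[𝕜] A ⊗[𝕜] (A ⊗[𝕜] A)) = LinearMap.id := by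
    refine TensorProduct.ext' fun x y => ?_
    induction y using TensorProduct.induction_on with
    | zero => simp
    | tmul y z => simp [ε_tmul]
    | add y z hy hz => rw [TensorProduct.tmul_add, map_add, map_add, hy, hz]
  exact LinearMap.congr_fun this x

/-- The co-Jacobi identity. Pairs of crossings without a common passage cut off two arcs from a
middle one and can be smoothed in either order; pairs with a common passage cancel in threes by
`Generic.eps_cyclic`. -/
theorem Realizes.cojacobi [Fintype E] [DecidableEq E] (hr : Realizes br dl inn out cl)
    (hg : Generic inn out) {σ : Perm E} (hσ : ∀ x y, σ.SameCycle x y) (a : E) :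
    (LinearMap.id + LieBialg.ε + LieBialg.ε ∘ₗ LieBialg.ε :
      A ⊗[𝕜] (A ⊗[𝕜] A) →ₗ[𝕜] A ⊗[𝕜] (A ⊗[𝕜] A)) (dl.lTensor A (dl (cl σ a))) = 0 := by
  set R : A ⊗[𝕜] (A ⊗[𝕜] A) →ₗ[𝕜] A ⊗[𝕜] (A ⊗[𝕜] A) :=
    LinearMap.id + LieBialg.ε + LieBialg.ε ∘ₗ LieBialg.ε with hR
  have hRε (x) : R (LieBialg.ε x) = R x := by
    simp only [hR, LinearMap.add_apply, LinearMap.id_apply, LinearMap.comp_apply, ε_ε_ε]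
    abel
  obtain ⟨t, ht⟩ : ∃ t : E → E → E → E → A ⊗[𝕜] (A ⊗[𝕜] A), ∀ e f g h, t e f g h =
      (eps inn out σ e f * eps inn out (swap e f * σ) g h) •
          (cl (swap g h * (swap e f * σ)) e ⊗ₜ[𝕜] (cl (swap g h * (swap e f * σ)) g ⊗ₜ[𝕜]
            cl (swap g h * (swap e f * σ)) h)) := ⟨_, fun _ _ _ _ => rfl⟩
  -- Two disjoint crossings cut off two arcs from a middle arc that contains `f`; the first sum
  -- collects the pairs with `f` and `h` in the same arc, the second one those with `f` and `g`.
  have split : dl.lTensor A (dl (cl σ a)) =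
      (∑ e, ∑ f, ∑ g, ∑ h, if e ≠ f ∧ (swap e f * σ).SameCycle f g ∧ (swap e f * σ).SameCycle f h ∧
        g ≠ h ∧ g ≠ f ∧ h ≠ f ∧ (swap g h * (swap e f * σ)).SameCycle f h then
          t e f g h else 0) +
      (∑ e, ∑ f, ∑ g, ∑ h, if e ≠ f ∧ (swap e f * σ).SameCycle f g ∧ (swap e f * σ).SameCycle f h ∧
        g ≠ h ∧ g ≠ f ∧ h ≠ f ∧ (swap g h * (swap e f * σ)).SameCycle f g then
          t e f g h else 0) +
      ∑ e, ∑ f, ∑ h, if e ≠ f ∧ f ≠ h ∧ (swap e f * σ).SameCycle f h then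
        t e f f h + t e f h f else 0 := by
    rw [hr.dl_dl hσ]
    simp only [← ht, ← Finset.sum_add_distrib]
    refine Finset.sum_congr rfl fun e _ => Finset.sum_congr rfl fun f _ => ?_
    have e2 : (∑ x, if e ≠ f ∧ f ≠ x ∧ (swap e f * σ).SameCycle f x then
        t e f f x + t e f x f else 0) =
        ∑ g, ∑ h, ((if g = f then (if e ≠ f ∧ f ≠ h ∧ (swap e f * σ).SameCycle f h then
          t e f f h else 0) else 0) + (if h = f then (if e ≠ f ∧ f ≠ g ∧
            (swap e f * σ).SameCycle f g then t e f g f else 0) else 0)) := by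
      simp only [Finset.sum_add_distrib, Finset.sum_ite_eq', Finset.mem_univ, if_true]
      rw [Finset.sum_comm]
      simp only [Finset.sum_ite_eq', Finset.mem_univ, if_true, ← Finset.sum_add_distrib]
      refine Finset.sum_congr rfl fun x _ => ?_
      split_ifs <;> simp
    rw [Finset.sum_add_distrib (g := fun x => if e ≠ f ∧ f ≠ x ∧ (swap e f * σ).SameCycle f x then
        t e f f x + t e f x f else 0), e2, ← Finset.sum_add_distrib]
    refine Finset.sum_congr rfl fun g _ => ?_
    rw [← Finset.sum_add_distrib]
    refine Finset.sum_congr rfl fun h _ => ?_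
    by_cases hB : e ≠ f ∧ (swap e f * σ).SameCycle f g ∧ (swap e f * σ).SameCycle f h ∧ g ≠ h
    · obtain ⟨hef, hfg, hfh, hgh⟩ := hB
      by_cases h1 : g = f
      · subst h1
        have := SameCycle.refl (swap e g * σ) g
        simp [hef, hfh, hgh, hgh.symm, this]
      · by_cases h2 : h = f
        · subst h2
          have := SameCycle.refl (swap e h * σ) h
          simp [hef, hfg, hgh, hgh.symm, this]
        · have h3 := hfg.symm.trans hfh
          have h4 := not_sameCycle_swap h3 hgh
          have h5 := (sameCycle_iff_swap h3 hgh f g).1 hfg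
          by_cases h6 : (swap g h * (swap e f * σ)).SameCycle f h
          · have h7 : ¬(swap g h * (swap e f * σ)).SameCycle f g := fun h => h4 (h.symm.trans h6)
            simp [hef, hfg, hfh, hgh, h1, h2, h6, h7]
          · have h7 : (swap g h * (swap e f * σ)).SameCycle f g := by
              rcases h5 with h5 | h5 | h5
              · exact h5
              · exact h5.1.symm
              · exact absurd h5.1.symm h6
            simp [hef, hfg, hfh, hgh, h1, h2, h6, h7]
    · rw [if_neg hB, if_neg (by tauto), if_neg (by tauto)]
      by_cases h1 : g = f
      · subst h1
        have : SameCycle (swap e g * σ) g g := SameCycle.refl _ _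
        by_cases h2 : h = g
        · subst h2; simp
        · rw [if_pos rfl, if_neg h2, if_neg (fun h' => hB ⟨h'.1, this, h'.2.2, h'.2.1⟩)]; simp
      · by_cases h2 : h = f
        · subst h2
          have : SameCycle (swap e h * σ) h h := SameCycle.refl _ _
          rw [if_pos rfl, if_neg h1, if_neg (fun h' => hB ⟨h'.1, h'.2.2, this, h'.2.1.symm⟩)]; simp
        · simp [h1, h2]
  have disj : (∑ e, ∑ f, ∑ g, ∑ h, if e ≠ f ∧ (swap e f * σ).SameCycle f g ∧
        (swap e f * σ).SameCycle f h ∧ g ≠ h ∧ g ≠ f ∧ h ≠ f ∧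
        (swap g h * (swap e f * σ)).SameCycle f g then t e f g h else 0) =
      -LieBialg.ε (LieBialg.ε (∑ e, ∑ f, ∑ g, ∑ h, if e ≠ f ∧ (swap e f * σ).SameCycle f g ∧
        (swap e f * σ).SameCycle f h ∧ g ≠ h ∧ g ≠ f ∧ h ≠ f ∧
        (swap g h * (swap e f * σ)).SameCycle f h then t e f g h else 0)) := by
    rw [sum_twist₄]
    simp only [map_sum, ← Finset.sum_neg_distrib]
    refine Finset.sum_congr rfl fun e _ => Finset.sum_congr rfl fun f _ =>
      Finset.sum_congr rfl fun g _ => Finset.sum_congr rfl fun h _ => ?_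
    have c1 := cut_cut_iff hσ e f g h
    have c3 (hd : g ≠ e ∧ g ≠ f ∧ h ≠ e ∧ h ≠ f) :=
      swap_mul_swap_comm σ hd.1 hd.2.1 hd.2.2.1 hd.2.2.2
    have c4 := cut_cut_swap_iff hσ e f g h
    by_cases hB : e ≠ f ∧ (swap e f * σ).SameCycle f g ∧
        (swap e f * σ).SameCycle f h ∧ g ≠ h ∧ g ≠ f ∧ h ≠ f ∧
        (swap g h * (swap e f * σ)).SameCycle f h
    · rw [if_pos (c4.2 hB), if_pos hB]
      obtain ⟨⟨hef, hgh, hgf, hhf, hge, hhe⟩, h1, h2, h3, h4⟩ := c1.1 hB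
      have hcl := hr.cl_eq h4
      rw [c3 ⟨hge, hgf, hhe, hhf⟩] at hcl
      rw [ht, ht, c3 ⟨hge, hgf, hhe, hhf⟩, map_zsmul, map_zsmul, ε_tmul, ε_tmul,
        swap_comm f e, hcl, eps_of_ne σ hge hgf hhe hhf, eps_of_ne σ hgf.symm hhf.symm hge.symm
            hhe.symm,
        hg.eps_swap σ hef, ← neg_smul]
      congr 1
      ring
    · rw [if_neg (fun h => hB (c4.1 h)), if_neg hB]
      simp
  have loc : R (∑ e, ∑ f, ∑ h, if e ≠ f ∧ f ≠ h ∧ (swap e f * σ).SameCycle f h then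
        t e f f h + t e f h f else 0) = 0 := by
    simp only [map_sum]
    refine sum_eq_zero_of_rotate hg.out_injective _ (fun e f h => ?_) (fun e f h hd => ?_)
    · have r1 := cyclic_order_rotate hσ e f h
      have r2 := cyclic_order_rotate hσ f h e
      by_cases hB : e ≠ f ∧ f ≠ h ∧ (swap e f * σ).SameCycle f h
      · rw [if_pos hB, if_pos (r1.1 hB), if_pos (r2.1 (r1.1 hB))]
        obtain ⟨⟨hef, hfh, heh⟩, -⟩ := (cyclic_order_iff hσ e f h).1 hB
        have p1 : swap h e * (swap f h * σ) = swap f h * (swap e f * σ) := by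
          rw [swap_comm h e, swap_comm f h, swap_comm e f]
          exact swap_mul_swap_rotate σ heh hef
        have p2 : swap e f * (swap h e * σ) = swap f h * (swap e f * σ) := by
          rw [← p1, swap_comm e f, swap_comm h e, swap_comm f h]
          exact swap_mul_swap_rotate σ hef.symm hfh
        have flip (x y z : E) (hyz : y ≠ z) : t x y z y =
            -((eps inn out σ x y * eps inn out (swap x y * σ) y z) •
              (cl (swap y z * (swap x y * σ)) x ⊗ₜ[𝕜] (cl (swap y z * (swap x y * σ)) z ⊗ₜ[𝕜]
                cl (swap y z * (swap x y * σ)) y))) := by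
          rw [ht, hg.eps_swap _ hyz.symm, swap_comm z y, mul_neg, neg_smul]
        have rot (x y z : A) : R (x ⊗ₜ (y ⊗ₜ z)) = R (z ⊗ₜ (x ⊗ₜ y)) := by
          exact (hRε _).symm.trans (by rw [ε_tmul])
        rw [flip e f h hfh, flip f h e heh.symm, flip h e f hef, ht, ht, ht, p1, p2]
        set τ := swap f h * (swap e f * σ)
        have hk := hg.eps_cyclic σ hfh.symm hef.symm heh.symm
        simp only [map_add, map_neg, map_zsmul]
        rw [rot (cl τ f) (cl τ h), rot (cl τ h) (cl τ e) (cl τ f), rot (cl τ f) (cl τ e),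
          rot (cl τ h) (cl τ f) (cl τ e), rot (cl τ f) (cl τ h) (cl τ e)]
        have hk' : eps inn out σ e f * eps inn out (swap e f * σ) f h +
            eps inn out σ f h * eps inn out (swap f h * σ) h e +
            eps inn out σ h e * eps inn out (swap h e * σ) e f = 0 := by
          rw [swap_comm e f, swap_comm h e, swap_comm f h, hg.eps_swap σ hef, hg.eps_swap σ hfh,
            hg.eps_swap σ heh.symm, hg.eps_swap _ hef, hg.eps_swap _ hfh,
            hg.eps_swap _ heh.symm]
          linarith
        generalize R (cl τ e ⊗ₜ[𝕜] (cl τ f ⊗ₜ[𝕜] cl τ h)) = X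
        generalize R (cl τ e ⊗ₜ[𝕜] (cl τ h ⊗ₜ[𝕜] cl τ f)) = Y
        refine Eq.trans ?_ ((congrArg (· • (X - Y)) hk').trans (zero_smul ℤ _))
        module
      · rw [if_neg hB, if_neg (fun h => hB (r1.2 h)), if_neg (fun h => hB (r1.2 (r2.2 h)))]
        simp
    · rw [if_neg, map_zero]
      intro h'
      exact hd ((cyclic_order_iff hσ e f h).1 h').1
  rw [split, map_add, map_add, disj, map_neg, hRε, hRε, loc]
  abel

end Identities

/-! ### Involutivity -/

section Identities
open Equiv Equiv.Perm
variable {E : Type*} {α : Type*} [LinearOrder α]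
variable {𝕜 : Type*} [CommRing 𝕜] {A : Type*} [AddCommGroup A] [Module 𝕜 A]
variable {br : A ⊗[𝕜] A →ₗ[𝕜] A} {dl : A →ₗ[𝕜] A ⊗[𝕜] A} {inn out : E → α}
  {cl : Perm E → E → A}

/-- If `e`, `g`, `f`, `h` lie on a cycle in this cyclic order, then cutting it in front of `g` and
`h` separates `g` and `f` from `h` and `e`. -/
theorem sameCycle_swap_of_cyclic_order [Fintype E] [DecidableEq E] {σ : Perm E} {e f g h : E}
    (hef : e ≠ f) (hσ : σ.SameCycle e f) (hg : (swap e f * σ).SameCycle e g) (hge : g ≠ e)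
    (hh : (swap e f * σ).SameCycle f h) (hhf : h ≠ f) :
    (swap g h * σ).SameCycle g f ∧ (swap g h * σ).SameCycle h e := by
  obtain ⟨A, B, hAB⟩ := exists_cycleList_split hσ hef
  obtain ⟨h1, h2⟩ := cycleList_swap_of_split hAB
  rw [← mem_cycleList, h1, List.mem_cons] at hg
  rw [← mem_cycleList, h2, List.mem_cons] at hh
  obtain ⟨A₁, A₂, rfl⟩ := List.append_of_mem (hg.resolve_left hge)
  obtain ⟨B₁, B₂, rfl⟩ := List.append_of_mem (hh.resolve_left hhf)
  have hc := cycleList_chain (σ := σ) (e := e)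
  have hn := nodup_cycleList σ e
  rw [hAB] at hc hn
  have hrot : cycleList σ g = g :: (A₂ ++ f :: B₁) ++ h :: (B₂ ++ e :: A₁) := by
    have e1 : g :: (A₂ ++ f :: B₁) ++ h :: (B₂ ++ e :: A₁) =
        g :: ((A₂ ++ f :: B₁) ++ h :: (B₂ ++ e :: A₁)) := by simp
    rw [e1]
    refine cycleList_eq ?_ ?_
    · refine (List.Perm.nodup_iff ?_).1 hn
      have : e :: (A₁ ++ g :: A₂) ++ f :: (B₁ ++ h :: B₂) =
        (e :: A₁) ++ (g :: A₂ ++ f :: B₁ ++ h :: B₂) := by simp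
      rw [this]
      refine List.perm_append_comm.trans ?_
      simp
    · have i1 : e :: (A₁ ++ g :: A₂) ++ f :: (B₁ ++ h :: B₂) ++ [e] =
          (e :: A₁) ++ g :: (A₂ ++ f :: (B₁ ++ h :: B₂) ++ [e]) := by simp
      have i2 : g :: (A₂ ++ f :: B₁ ++ h :: (B₂ ++ e :: A₁)) ++ [g] =
          (g :: (A₂ ++ f :: (B₁ ++ h :: B₂))) ++ e :: (A₁ ++ [g]) := by simp
      rw [i1, List.isChain_split] at hc
      rw [i2, List.isChain_split]
      exact ⟨by simpa using hc.2, by simpa using hc.1⟩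
  obtain ⟨h3, h4⟩ := cycleList_swap_of_split hrot
  rw [← mem_cycleList, ← mem_cycleList, h3, h4]
  simp

/-- Bracket after cobracket as a sum over pairs of crossings, the second one between the two
parts. -/
theorem Realizes.br_dl [Fintype E] [DecidableEq E] (hr : Realizes br dl inn out cl) {σ : Perm E}
    (hσ : ∀ x y, σ.SameCycle x y) (a : E) :
    br (dl (cl σ a)) = ∑ e, ∑ f, ∑ g, ∑ h,
      if e ≠ f ∧ (swap e f * σ).SameCycle e g ∧ (swap e f * σ).SameCycle f h then
        (eps inn out σ e f * eps inn out (swap e f * σ) g h) •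
          cl (swap g h * (swap e f * σ)) g else 0 := by
  rw [hr.dl_cl, map_sum_ite]
  refine Finset.sum_congr rfl fun e _ => Finset.sum_congr rfl fun f _ => ?_
  by_cases hef : e ≠ f
  · rw [if_pos ⟨hσ _ _, hσ _ _, hef⟩, hr.br_cl (not_sameCycle_swap (hσ e f) hef), Finset.smul_sum]
    refine Finset.sum_congr rfl fun g _ => ?_
    rw [Finset.smul_sum]
    refine Finset.sum_congr rfl fun h _ => ?_
    simp only [hef, ne_eq, not_false_eq_true, true_and, smul_ite, smul_zero, smul_smul]
  · rw [if_neg (by tauto)]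
    symm
    exact Finset.sum_eq_zero fun g _ => Finset.sum_eq_zero fun h _ => if_neg (by tauto)

/-- A sum over pairs, split according to whether the entries are equal to `a` and `b`. -/
theorem sum_sum_split [Fintype E] [DecidableEq E] {M : Type*} [AddCommGroup M] (P : E → E → M)
    (a b : E) :
    ∑ g, ∑ h, P g h = (∑ g, ∑ h, if g ≠ a ∧ h ≠ b then P g h else 0) +
      (∑ h, if h ≠ b then P a h else 0) + (∑ g, if g ≠ a then P g b else 0) + P a b := by
  have e1 (g h : E) : P g h = (if g ≠ a ∧ h ≠ b then P g h else 0) +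
      (if g = a then if h ≠ b then P a h else 0 else 0) +
      (if h = b then if g ≠ a then P g b else 0 else 0) +
      (if g = a then if h = b then P a b else 0 else 0) := by
    by_cases h1 : g = a <;> by_cases h2 : h = b <;> simp [h1, h2]
  rw [Finset.sum_congr rfl fun g _ => Finset.sum_congr rfl fun h _ => e1 g h]
  simp only [Finset.sum_add_distrib, Finset.sum_ite_eq', Finset.mem_univ, if_true]
  congr 2
  · congr 1
    rw [Finset.sum_comm]
    simp
  · rw [Finset.sum_comm]
    simp

/-- A function on quadruples that changes its sign under the exchange of the two pairs has total
sum zero. -/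
theorem sum_eq_zero_of_twist [Fintype E] {M : Type*} [AddCommGroup M] (ho : Function.Injective out)
    (F : E → E → E → E → M) (h₀ : ∀ e f g h, F g h f e = -F e f g h)
    (h₁ : ∀ e f g h, ¬(g ≠ e ∧ g ≠ f ∧ h ≠ e ∧ h ≠ f) → F e f g h = 0) :
    ∑ e, ∑ f, ∑ g, ∑ h, F e f g h = 0 := by
  have key (e f g h : E) : F e f g h =
      (if min (out e) (out f) < min (out g) (out h) then F e f g h else 0) +
      (if min (out g) (out h) < min (out e) (out f) then F e f g h else 0) := by
    by_cases hd : g ≠ e ∧ g ≠ f ∧ h ≠ e ∧ h ≠ f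
    · have : min (out e) (out f) ≠ min (out g) (out h) := by
        obtain ⟨a1, a2, a3, a4⟩ := hd
        have := ho.ne a1; have := ho.ne a2; have := ho.ne a3; have := ho.ne a4
        rcases min_choice (out e) (out f) with h1 | h1 <;>
          rcases min_choice (out g) (out h) with h2 | h2 <;> rw [h1, h2] <;> exact Ne.symm ‹_›
      rcases this.lt_or_gt with h1 | h1 <;> simp [h1, h1.not_gt]
    · simp [h₁ e f g h hd]
  have e1 : ∑ e, ∑ f, ∑ g, ∑ h, F e f g h =
      (∑ e, ∑ f, ∑ g, ∑ h, if min (out e) (out f) < min (out g) (out h) then F e f g h else 0) +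
      ∑ e, ∑ f, ∑ g, ∑ h,
        (if min (out g) (out h) < min (out e) (out f) then F e f g h else 0) := by
    simp only [← Finset.sum_add_distrib, ← key]
  rw [e1, sum_twist₄ (fun e f g h => if min (out g) (out h) < min (out e) (out f) then
    F e f g h else 0)]
  simp only [← Finset.sum_add_distrib]
  refine Finset.sum_eq_zero fun e _ => Finset.sum_eq_zero fun f _ => Finset.sum_eq_zero fun g _ =>
    Finset.sum_eq_zero fun h _ => ?_
  rw [min_comm (out f), h₀ e f g h]
  split_ifs <;> simp

/-- Involutivity. Two crossings that are linked along the curve can be smoothed in either order,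
with opposite signs; if they have one passage in common, they cancel in threes by
`Generic.eps_cyclic`, and a smoothed crossing does not count again. -/
theorem Realizes.involutive [Fintype E] [DecidableEq E] (hr : Realizes br dl inn out cl)
    (hg : Generic inn out) {σ : Perm E} (hσ : ∀ x y, σ.SameCycle x y) (a : E) :
    br (dl (cl σ a)) = 0 := by
  rw [hr.br_dl hσ]
  obtain ⟨T, hT⟩ : ∃ T : E → E → E → E → A, ∀ e f g h, T e f g h =
      (eps inn out σ e f * eps inn out (swap e f * σ) g h) •
        cl (swap g h * (swap e f * σ)) g := ⟨_, fun _ _ _ _ => rfl⟩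
  simp only [← hT]
  -- Disjoint pairs of passages: the two crossings are linked along the curve, and both orders of
  -- smoothing occur.
  have disj : ∑ e, ∑ f, ∑ g, ∑ h, (if g ≠ e ∧ h ≠ f then if e ≠ f ∧
      (swap e f * σ).SameCycle e g ∧ (swap e f * σ).SameCycle f h then T e f g h else 0 else 0) =
      0 := by
    have dist {e f g h : E} (hd : g ≠ e ∧ h ≠ f)
        (hc : e ≠ f ∧ (swap e f * σ).SameCycle e g ∧ (swap e f * σ).SameCycle f h) :
        g ≠ e ∧ g ≠ f ∧ h ≠ e ∧ h ≠ f := by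
      have := not_sameCycle_swap (hσ e f) hc.1
      exact ⟨hd.1, fun h' => this (h' ▸ hc.2.1), fun h' => this (h' ▸ hc.2.2).symm, hd.2⟩
    have step {e f g h : E} (hd : g ≠ e ∧ h ≠ f)
        (hc : e ≠ f ∧ (swap e f * σ).SameCycle e g ∧ (swap e f * σ).SameCycle f h) :
        (f ≠ g ∧ e ≠ h) ∧ g ≠ h ∧ (swap g h * σ).SameCycle g f ∧
          (swap g h * σ).SameCycle h e := by
      obtain ⟨d1, d2, d3, d4⟩ := dist hd hc
      have hgh : g ≠ h := by
        rintro rfl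
        exact not_sameCycle_swap (hσ e f) hc.1 (hc.2.1.trans hc.2.2.symm)
      exact ⟨⟨d2.symm, d3.symm⟩, hgh,
        sameCycle_swap_of_cyclic_order hc.1 (hσ e f) hc.2.1 hd.1 hc.2.2 hd.2⟩
    refine sum_eq_zero_of_twist hg.out_injective _ (fun e f g h => ?_) (fun e f g h hd => ?_)
    · by_cases hB : (g ≠ e ∧ h ≠ f) ∧ e ≠ f ∧ (swap e f * σ).SameCycle e g ∧
        (swap e f * σ).SameCycle f h
      · obtain ⟨d1, d2, d3, d4⟩ := dist hB.1 hB.2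
        have hs := step hB.1 hB.2
        have hcomm := swap_mul_swap_comm σ d1 d2 d3 d4
        have hcl : (swap g h * (swap e f * σ)).SameCycle f g := by
          rw [hcomm, swap_comm e f]
          refine (sameCycle_swap_iff ?_ _ _).2 (Or.inl hs.2.2.1.symm)
          intro h'
          exact not_sameCycle_swap (hσ g h) hs.2.1
            (hs.2.2.1.trans (h'.trans hs.2.2.2.symm))
        rw [if_pos hB.1, if_pos hB.2, if_pos hs.1, if_pos hs.2, hT, hT, ← hr.cl_eq hcl, hcomm,
          swap_comm f e, eps_of_ne σ d1 d2 d3 d4, eps_of_ne σ d2.symm d4.symm d1.symm d3.symm,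
          hg.eps_swap σ hB.2.1, ← neg_smul]
        congr 1
        ring
      · have : ¬((f ≠ g ∧ e ≠ h) ∧ g ≠ h ∧ (swap g h * σ).SameCycle g f ∧
            (swap g h * σ).SameCycle h e) := by
          intro h'
          obtain ⟨a1, a2⟩ := step h'.1 h'.2
          obtain ⟨b1, b2⟩ := step a1 a2
          exact hB (step b1 b2)
        rw [← ite_and, ← ite_and, if_neg hB, if_neg this, neg_zero]
    · rw [← ite_and, if_neg]
      exact fun h' => hd (dist h'.1 h'.2)
  -- The second crossing uses the passage `e` of the first one again.
  have loc : ∑ e, ∑ f, ∑ h, (if h ≠ f then if e ≠ f ∧ (swap e f * σ).SameCycle e e ∧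
      (swap e f * σ).SameCycle f h then T e f e h else 0 else 0) = 0 := by
    have c0 (e f h : E) : (h ≠ f ∧ e ≠ f ∧ (swap e f * σ).SameCycle e e ∧
        (swap e f * σ).SameCycle f h) ↔ (e ≠ f ∧ f ≠ h ∧ (swap e f * σ).SameCycle f h) := by
      have := SameCycle.refl (swap e f * σ) e
      tauto
    simp only [← ite_and, c0]
    refine sum_eq_zero_of_rotate hg.out_injective _ (fun e f h => ?_) (fun e f h hd => ?_)
    · have r1 := cyclic_order_rotate hσ e f h
      have r2 := cyclic_order_rotate hσ f h e
      by_cases hB : e ≠ f ∧ f ≠ h ∧ (swap e f * σ).SameCycle f h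
      · rw [if_pos hB, if_pos (r1.1 hB), if_pos (r2.1 (r1.1 hB))]
        obtain ⟨⟨hef, hfh, heh⟩, -⟩ := (cyclic_order_iff hσ e f h).1 hB
        have p1 : swap e f * (swap f h * σ) = swap e h * (swap e f * σ) := by
          rw [swap_comm e h]
          exact (swap_mul_swap_rotate σ heh.symm hfh.symm).symm
        have p2 : swap f h * (swap h e * σ) = swap e h * (swap e f * σ) := by
          rw [← p1]
          exact (swap_mul_swap_rotate σ hef heh).symm
        have joined {x y z : E} (hc : x ≠ y ∧ y ≠ z ∧ (swap x y * σ).SameCycle y z) :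
            (swap x z * (swap x y * σ)).SameCycle x z :=
          sameCycle_swap_self fun h => not_sameCycle_swap (hσ x y) hc.1 (h.trans hc.2.2.symm)
        have j1 := hr.cl_eq (joined hB)
        have j2 := hr.cl_eq (joined (r1.1 hB))
        rw [swap_comm f e, p1] at j2
        rw [hT, hT, hT, swap_comm f e, p1, swap_comm h f, p2, j2, ← j1, ← add_smul, ← add_smul]
        have hk := hg.eps_cyclic σ hef hfh heh
        have : eps inn out σ e f * eps inn out (swap e f * σ) e h +
            eps inn out σ f h * eps inn out (swap f h * σ) f e +
            eps inn out σ h e * eps inn out (swap h e * σ) h f = 0 := by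
          rw [hg.eps_swap (swap e f * σ) heh, hg.eps_swap (swap f h * σ) hef.symm,
            hg.eps_swap (swap h e * σ) hfh.symm]
          linarith
        rw [this, zero_smul]
      · rw [if_neg hB, if_neg (fun h => hB (r1.2 h)), if_neg (fun h => hB (r1.2 (r2.2 h)))]
        simp
    · rw [if_neg]
      intro h'
      exact hd ((cyclic_order_iff hσ e f h).1 h').1
  -- The second crossing uses the passage `f` again: this is the same up to renaming.
  have loc' : ∑ e, ∑ f, ∑ g, (if g ≠ e then if e ≠ f ∧ (swap e f * σ).SameCycle e g ∧
      (swap e f * σ).SameCycle f f then T e f g f else 0 else 0) = 0 := by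
    refine Eq.trans ?_ loc
    rw [Finset.sum_comm]
    refine Finset.sum_congr rfl fun e _ => Finset.sum_congr rfl fun f _ =>
      Finset.sum_congr rfl fun h _ => ?_
    have c0 : (h ≠ f ∧ f ≠ e ∧ (swap f e * σ).SameCycle f h ∧
        (swap f e * σ).SameCycle e e) ↔ (h ≠ f ∧ e ≠ f ∧ (swap e f * σ).SameCycle e e ∧
        (swap e f * σ).SameCycle f h) := by
      rw [swap_comm f e]
      have := SameCycle.refl (swap e f * σ) e
      tauto
    simp only [← ite_and, c0]
    split_ifs with hB
    · have hne : e ≠ h := fun h' => not_sameCycle_swap (hσ e f) hB.2.1 (h' ▸ hB.2.2.2.symm)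
      have hj : (swap e h * (swap e f * σ)).SameCycle e h :=
        sameCycle_swap_self fun h => not_sameCycle_swap (hσ e f) hB.2.1 (h.trans hB.2.2.2.symm)
      rw [hT, hT, hr.cl_eq hj, swap_comm f e, swap_comm h e, hg.eps_swap σ hB.2.1.symm,
        hg.eps_swap _ hne.symm, neg_mul_neg]
    · rfl
  -- The second crossing is the first one again.
  have zero : ∑ e, ∑ f, (if e ≠ f ∧ (swap e f * σ).SameCycle e e ∧
      (swap e f * σ).SameCycle f f then T e f e f else 0) = 0 := by
    refine Finset.sum_eq_zero fun e _ => Finset.sum_eq_zero fun f _ => ?_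
    split_ifs with hB
    · rw [hT, hg.eps_mul_self σ hB.1, zero_smul]
    · rfl
  rw [Finset.sum_congr rfl fun e _ => Finset.sum_congr rfl fun f _ => sum_sum_split _ e f]
  simp only [Finset.sum_add_distrib]
  rw [disj, loc, loc', zero]
  simp

end Identities

/-! ### Compatibility of bracket and cobracket -/

section Identities
open Equiv Equiv.Perm
variable {E : Type*} {α : Type*} [LinearOrder α]
variable {𝕜 : Type*} [CommRing 𝕜] {A : Type*} [AddCommGroup A] [Module 𝕜 A]
variable {br : A ⊗[𝕜] A →ₗ[𝕜] A} {dl : A →ₗ[𝕜] A ⊗[𝕜] A} {inn out : E → α}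
  {cl : Perm E → E → A}

/-- A sum over ordered pairs of distinct elements, split according to whether the pair meets
`{e, f}`. -/
theorem sum_pair_split [Fintype E] [DecidableEq E] {M : Type*} [AddCommGroup M] (P : E → E → M)
    {e f : E} (hef : e ≠ f) :
    (∑ g, ∑ h, if g ≠ h then P g h else 0) =
      (∑ g, ∑ h, if g ≠ h ∧ g ≠ e ∧ g ≠ f ∧ h ≠ e ∧ h ≠ f then P g h else 0) +
      (∑ y, if y ≠ e ∧ y ≠ f then P e y + P y e + P f y + P y f else 0) + (P e f + P f e) := by
  have e1 (g h : E) : (if g ≠ h then P g h else 0) =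
      (if g ≠ h ∧ g ≠ e ∧ g ≠ f ∧ h ≠ e ∧ h ≠ f then P g h else 0) +
      ((if g = e then if h ≠ e ∧ h ≠ f then P e h else 0 else 0) +
       (if h = e then if g ≠ e ∧ g ≠ f then P g e else 0 else 0) +
       (if g = f then if h ≠ e ∧ h ≠ f then P f h else 0 else 0) +
       (if h = f then if g ≠ e ∧ g ≠ f then P g f else 0 else 0)) +
      ((if g = e then if h = f then P e f else 0 else 0) +
        (if g = f then if h = e then P f e else 0 else 0)) := by
    by_cases h1 : g = e
    · subst h1
      by_cases h2 : h = g
      · subst h2; simp [hef]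
      · by_cases h3 : h = f
        · subst h3; simp [hef]
        · simp [hef, h2, h3, Ne.symm h2]
    · by_cases h2 : g = f
      · subst h2
        by_cases h3 : h = g
        · subst h3; simp [h1]
        · by_cases h4 : h = e
          · subst h4; simp [hef, Ne.symm h3]
          · simp [h1, h3, h4, Ne.symm h3]
      · by_cases h3 : h = e
        · subst h3; simp [h1, h2, hef]
        · by_cases h4 : h = f
          · subst h4; simp [h1, h2, hef.symm]
          · simp [h1, h2, h3, h4]
  have e2 : (∑ y, if y ≠ e ∧ y ≠ f then P e y + P y e + P f y + P y f else 0) =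
      (∑ y, if y ≠ e ∧ y ≠ f then P e y else 0) + (∑ y, if y ≠ e ∧ y ≠ f then P y e else 0) +
      (∑ y, if y ≠ e ∧ y ≠ f then P f y else 0) + ∑ y, if y ≠ e ∧ y ≠ f then P y f else 0 := by
    simp only [← Finset.sum_add_distrib]
    refine Finset.sum_congr rfl fun y _ => ?_
    split_ifs <;> simp
  have c1 (F : E → M) (x : E) : (∑ g, ∑ h, if g = x then F h else 0) = ∑ h, F h := by
    rw [Finset.sum_comm]; simp
  have c2 (F : E → M) (x : E) : (∑ g, ∑ h, if h = x then F g else 0) = ∑ h, F h := by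
    simp
  rw [Finset.sum_congr rfl fun g _ => Finset.sum_congr rfl fun h _ => e1 g h, e2]
  simp only [Finset.sum_add_distrib]
  rw [c1 (fun h => if h ≠ e ∧ h ≠ f then P e h else 0),
    c1 (fun h => if h ≠ e ∧ h ≠ f then P f h else 0),
    c2 (fun h => if h ≠ e ∧ h ≠ f then P h e else 0),
    c2 (fun h => if h ≠ e ∧ h ≠ f then P h f else 0),
    c1 (fun h => if h = f then P e f else 0), c1 (fun h => if h = e then P f e else 0)]
  simp

/-- The action of one curve on the cobracket of another one, as a sum over pairs of crossings: first
a self-crossing of the second curve is smoothed, then a crossing with the first curve. -/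
theorem Realizes.act_dl [Fintype E] [DecidableEq E] (hr : Realizes br dl inn out cl) {σ : Perm E}
    {a b : E} (hab : ¬σ.SameCycle a b) :
    LieBialg.act br (cl σ a) (dl (cl σ b)) = ∑ g, ∑ h, ∑ e, ∑ f,
      if (σ.SameCycle b g ∧ σ.SameCycle b h ∧ g ≠ h) ∧ σ.SameCycle a e ∧ σ.SameCycle b f then
        (eps inn out σ g h * eps inn out (swap g h * σ) e f) •
          (cl (swap e f * (swap g h * σ)) g ⊗ₜ[𝕜] cl (swap e f * (swap g h * σ)) h) else 0 := by
  rw [hr.dl_cl, map_sum_ite]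
  refine Finset.sum_congr rfl fun g _ => Finset.sum_congr rfl fun h _ => ?_
  by_cases hB : σ.SameCycle b g ∧ σ.SameCycle b h ∧ g ≠ h
  · obtain ⟨hbg, hbh, hgh⟩ := hB
    have hag : ¬σ.SameCycle a g := fun h => hab (h.trans hbg.symm)
    have hah : ¬σ.SameCycle a h := fun h => hab (h.trans hbh.symm)
    have hσ := hbg.symm.trans hbh
    have h1 := not_sameCycle_swap hσ hgh
    have iff1 := sameCycle_iff_of_cycleList (cycleList_swap_of_disjoint hag hah)
    have h2 : ¬(swap g h * σ).SameCycle a g := fun h => hag ((iff1 g).1 h)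
    have h3 : ¬(swap g h * σ).SameCycle a h := fun h => hah ((iff1 _).1 h)
    have iff2 (f : E) : σ.SameCycle b f ↔
        (swap g h * σ).SameCycle g f ∨ (swap g h * σ).SameCycle h f := by
      have hb : σ.SameCycle b f ↔ σ.SameCycle g f := ⟨hbg.symm.trans, hbg.trans⟩
      rw [hb, sameCycle_iff_swap hσ hgh]
      have := SameCycle.refl (swap g h * σ) g
      have h1' : ¬(swap g h * σ).SameCycle h g := fun h => h1 h.symm
      tauto
    rw [if_pos ⟨hbg, hbh, hgh⟩]
    simp only [LieBialg.act, LinearMap.add_apply, LinearMap.rTensor_tmul, LinearMap.lTensor_tmul,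
      LinearMap.comp_apply, TensorProduct.mk_apply]
    rw [← hr.cl_swap hag hah, hr.br_cl h2, hr.br_cl h3]
    have m1 := map_sum_ite ((TensorProduct.mk 𝕜 A A).flip (cl (swap g h * σ) h))
      (fun e f => (swap g h * σ).SameCycle a e ∧ (swap g h * σ).SameCycle g f)
      (fun e f => eps inn out (swap g h * σ) e f) (fun e f => cl (swap e f * (swap g h * σ)) e)
    have m2 := map_sum_ite (TensorProduct.mk 𝕜 A A (cl (swap g h * σ) g))
      (fun e f => (swap g h * σ).SameCycle a e ∧ (swap g h * σ).SameCycle h f)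
      (fun e f => eps inn out (swap g h * σ) e f) (fun e f => cl (swap e f * (swap g h * σ)) e)
    simp only [TensorProduct.mk_apply, LinearMap.flip_apply] at m1 m2
    rw [m1, m2, ← Finset.sum_add_distrib, Finset.smul_sum]
    refine Finset.sum_congr rfl fun e _ => ?_
    rw [← Finset.sum_add_distrib, Finset.smul_sum]
    refine Finset.sum_congr rfl fun f _ => ?_
    by_cases hae : σ.SameCycle a e
    · have hae' := (iff1 e).2 hae
      by_cases hf1 : (swap g h * σ).SameCycle g f
      · have hf2 : ¬(swap g h * σ).SameCycle h f := fun h => h1 (hf1.trans h.symm)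
        have hj : ¬(swap g h * σ).SameCycle e f := fun h' =>
          h2 (hae'.trans (h'.trans hf1.symm))
        have k1 : (swap e f * (swap g h * σ)).SameCycle e g :=
          (sameCycle_swap_iff hj _ _).2 (Or.inr (Or.inl ⟨SameCycle.refl _ _, hf1.symm⟩))
        rw [if_pos ⟨hae', hf1⟩, if_neg (fun h => hf2 h.2),
          if_pos ⟨⟨hbg, hbh, hgh⟩, hae, (iff2 f).2 (Or.inl hf1)⟩, add_zero, smul_smul,
          hr.cl_eq k1, hr.cl_swap (σ := swap g h * σ) (a := h)
          (fun h' => h3 (hae'.trans h'.symm)) hf2]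
      · by_cases hf2 : (swap g h * σ).SameCycle h f
        · have hj : ¬(swap g h * σ).SameCycle e f := fun h' =>
            h3 (hae'.trans (h'.trans hf2.symm))
          have k1 : (swap e f * (swap g h * σ)).SameCycle e h :=
            (sameCycle_swap_iff hj _ _).2 (Or.inr (Or.inl ⟨SameCycle.refl _ _, hf2.symm⟩))
          rw [if_neg (fun h => hf1 h.2), if_pos ⟨hae', hf2⟩,
            if_pos ⟨⟨hbg, hbh, hgh⟩, hae, (iff2 f).2 (Or.inr hf2)⟩, zero_add, smul_smul,
            hr.cl_eq k1, hr.cl_swap (σ := swap g h * σ) (a := g)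
            (fun h' => h2 (hae'.trans h'.symm)) hf1]
        · rw [if_neg (fun h => hf1 h.2), if_neg (fun h => hf2 h.2),
            if_neg (fun h => ((iff2 f).1 h.2.2).elim hf1 hf2)]
          simp
    · have hae' : ¬(swap g h * σ).SameCycle a e := fun h => hae ((iff1 e).1 h)
      rw [if_neg (fun h => hae' h.1), if_neg (fun h => hae' h.1), if_neg (fun h => hae h.2.1)]
      simp
  · rw [if_neg hB]
    symm
    exact Finset.sum_eq_zero fun e _ => Finset.sum_eq_zero fun f _ => if_neg (by tauto)

/-- Cobracket after bracket as a sum over pairs of crossings: first a crossing of the two curves is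
smoothed, then a self-crossing of the result. -/
theorem Realizes.dl_br [Fintype E] [DecidableEq E] (hr : Realizes br dl inn out cl) {σ : Perm E}
    {a b : E} (hab : ¬σ.SameCycle a b) (hσ : ∀ x, σ.SameCycle a x ∨ σ.SameCycle b x) :
    dl (br (cl σ a ⊗ₜ cl σ b)) = ∑ e, ∑ f, if σ.SameCycle a e ∧ σ.SameCycle b f then
      ∑ g, ∑ h, if g ≠ h then (eps inn out σ e f * eps inn out (swap e f * σ) g h) •
        (cl (swap g h * (swap e f * σ)) g ⊗ₜ[𝕜] cl (swap g h * (swap e f * σ)) h) else 0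
      else 0 := by
  rw [hr.br_cl hab, map_sum_ite]
  refine Finset.sum_congr rfl fun e _ => Finset.sum_congr rfl fun f _ => ?_
  split_ifs with hB
  · have hef : ¬σ.SameCycle e f := fun h => hab (hB.1.trans (h.trans hB.2.symm))
    have hall (x : E) : (swap e f * σ).SameCycle e x := by
      rw [sameCycle_swap_iff hef]
      rcases hσ x with h | h
      · exact Or.inl (hB.1.symm.trans h)
      · exact Or.inr (Or.inl ⟨SameCycle.refl _ _, hB.2.symm.trans h⟩)
    rw [hr.dl_cl, Finset.smul_sum]
    refine Finset.sum_congr rfl fun g _ => ?_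
    rw [Finset.smul_sum]
    refine Finset.sum_congr rfl fun h _ => ?_
    simp only [hall, true_and, smul_ite, smul_zero, smul_smul]
  · rfl

theorem sum_exchange₄ [Fintype E] {M : Type*} [AddCommGroup M] (F : E → E → E → E → M) :
    ∑ g, ∑ h, ∑ e, ∑ f, F e f g h = ∑ e, ∑ f, ∑ g, ∑ h, F e f g h := by
  have h2 : ∑ g, ∑ h, ∑ e, ∑ f, F e f g h = ∑ q : E × E, ∑ p : E × E, F p.1 p.2 q.1 q.2 := by
    simp only [Fintype.sum_prod_type]
  have h3 : ∑ e, ∑ f, ∑ g, ∑ h, F e f g h = ∑ p : E × E, ∑ q : E × E, F p.1 p.2 q.1 q.2 := by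
    simp only [Fintype.sum_prod_type]
  rw [h2, h3, Finset.sum_comm]

/-- Compatibility. In `dl (br (cl σ a ⊗ₜ cl σ b))`, the second crossing is a self-crossing of one of
the two curves, which gives the right side, or another crossing between them, and such pairs of
crossings cancel; what remains are pairs with a common passage, see `Generic.eps_cyclic`. -/
theorem Realizes.compat [Fintype E] [DecidableEq E] (hr : Realizes br dl inn out cl)
    (hg : Generic inn out) {σ : Perm E} {a b : E} (hab : ¬σ.SameCycle a b)
    (hσ : ∀ x, σ.SameCycle a x ∨ σ.SameCycle b x) :
    dl (br (cl σ a ⊗ₜ cl σ b)) =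
      LieBialg.act br (cl σ a) (dl (cl σ b)) - LieBialg.act br (cl σ b) (dl (cl σ a)) := by
  rw [hr.act_dl hab, hr.act_dl (fun h => hab h.symm), hr.dl_br hab hσ]
  obtain ⟨T, hT⟩ : ∃ T : E → E → E → E → A ⊗[𝕜] A, ∀ e f g h, T e f g h =
      (eps inn out σ e f * eps inn out (swap e f * σ) g h) •
        (cl (swap g h * (swap e f * σ)) g ⊗ₜ[𝕜] cl (swap g h * (swap e f * σ)) h) :=
    ⟨_, fun _ _ _ _ => rfl⟩
  obtain ⟨S, hS⟩ : ∃ S : E → E → E → E → A ⊗[𝕜] A, ∀ e f g h, S e f g h =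
      (eps inn out σ g h * eps inn out (swap g h * σ) e f) •
          (cl (swap e f * (swap g h * σ)) g ⊗ₜ[𝕜] cl (swap e f * (swap g h * σ)) h) :=
    ⟨_, fun _ _ _ _ => rfl⟩
  simp only [← hT, ← hS]
  have T_self {e f : E} (h : e ≠ f) : T e f e f = 0 := by
    rw [hT, hg.eps_mul_self σ h, zero_smul]
  have T_self' {e f : E} (h : e ≠ f) : T e f f e = 0 := by
    rw [hT, hg.eps_swap _ h.symm, mul_neg, hg.eps_mul_self σ h, neg_zero, zero_smul]
  -- `T` and `S` differ in the order of smoothing, which is irrelevant for disjoint pairs.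
  have T_eq {e f g h : E} (hd : g ≠ e ∧ g ≠ f ∧ h ≠ e ∧ h ≠ f) : T e f g h = S e f g h := by
    obtain ⟨h1, h2, h3, h4⟩ := hd
    rw [hT, hS, swap_mul_swap_comm σ h1 h2 h3 h4, eps_of_ne σ h1 h2 h3 h4,
      eps_of_ne σ h1.symm h3.symm h2.symm h4.symm, mul_comm]
  have T_flip {e f : E} (h : e ≠ f) (x y : E) : T f e x y = -T e f x y := by
    rw [hT, hT, hg.eps_swap σ h.symm, swap_comm f e, neg_mul, neg_smul]
  have S_flip {e f : E} (h : e ≠ f) (x y : E) : S f e x y = -S e f x y := by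
    rw [hS, hS, hg.eps_swap _ h.symm, swap_comm f e, mul_neg, neg_smul]
  -- Two crossings between the two curves: exchanging their order changes the sign.
  have T_twist {e f g h : E} (hd : g ≠ e ∧ g ≠ f ∧ h ≠ e ∧ h ≠ f) (hef : ¬σ.SameCycle e f)
      (h1 : σ.SameCycle e g) (h2 : σ.SameCycle f h) : T g h f e = -T e f g h := by
    obtain ⟨d1, d2, d3, d4⟩ := hd
    have hne : e ≠ f := fun h => hef (h ▸ SameCycle.refl _ _)
    have hinv : swap e f * (swap e f * σ) = σ := by rw [← mul_assoc, swap_mul_self, one_mul]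
    obtain ⟨k1, k2⟩ := sameCycle_swap_of_cyclic_order hne (sameCycle_swap_self hef)
      (hinv.symm ▸ h1) d1 (hinv.symm ▸ h2) d4
    rw [hT, hT, hr.cl_eq k1, hr.cl_eq k2, swap_comm f e, swap_mul_swap_comm σ d1 d2 d3 d4,
      eps_of_ne σ d1 d2 d3 d4, eps_of_ne σ d2.symm d4.symm d1.symm d3.symm,
      hg.eps_swap σ hne.symm, mul_neg, neg_smul, mul_comm]
  -- If the second crossing shares a passage with the first one, the terms cancel in threes.
  have overlap (a b : E) (hab : ¬σ.SameCycle a b) : ∑ e, ∑ f, ∑ y,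
      (if σ.SameCycle a e ∧ σ.SameCycle b f ∧ σ.SameCycle b y ∧ y ≠ f then
        T e f e y + T e f y e + (T e f f y - S e f f y) + (T e f y f - S e f y f) else 0) = 0 := by
    refine Finset.sum_eq_zero fun e _ => ?_
    -- In the terms where the second crossing is on the passage `f`, the names of `f` and `y` are
    -- exchanged.
    have e1 : (∑ f, ∑ y,
      (if σ.SameCycle a e ∧ σ.SameCycle b f ∧ σ.SameCycle b y ∧ y ≠ f then
        T e f e y + T e f y e + (T e f f y - S e f f y) + (T e f y f - S e f y f) else 0)) =
      (∑ f, ∑ y,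
      if σ.SameCycle a e ∧ σ.SameCycle b f ∧ σ.SameCycle b y ∧ y ≠ f then
        T e f e y + T e f y e - S e f f y - S e f y f else 0) +
      ∑ f, ∑ y,
      if σ.SameCycle a e ∧ σ.SameCycle b f ∧ σ.SameCycle b y ∧ y ≠ f then
        T e f f y + T e f y f else 0 := by
      simp only [← Finset.sum_add_distrib]
      refine Finset.sum_congr rfl fun f _ => Finset.sum_congr rfl fun y _ => ?_
      split_ifs
      · abel
      · simp
    rw [e1, Finset.sum_comm (f := fun f y => if σ.SameCycle a e ∧ σ.SameCycle b f ∧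
      σ.SameCycle b y ∧ y ≠ f then T e f f y + T e f y f else 0)]
    simp only [← Finset.sum_add_distrib]
    refine Finset.sum_eq_zero fun f _ => Finset.sum_eq_zero fun y _ => ?_
    by_cases hB : σ.SameCycle a e ∧ σ.SameCycle b f ∧ σ.SameCycle b y ∧ y ≠ f
    · obtain ⟨he, hf, hy, hyf⟩ := hB
      have hef : ¬σ.SameCycle e f := fun h => hab (he.trans (h.trans hf.symm))
      have hey : ¬σ.SameCycle e y := fun h => hab (he.trans (h.trans hy.symm))
      have nef : e ≠ f := fun h => hef (h ▸ SameCycle.refl _ _)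
      have ney : e ≠ y := fun h => hey (h ▸ SameCycle.refl _ _)
      rw [if_pos ⟨he, hf, hy, hyf⟩, if_pos ⟨he, hy, hf, hyf.symm⟩]
      have p1 : swap e y * (swap e f * σ) = swap e f * (swap f y * σ) := by
        rw [swap_comm e y]
        exact swap_mul_swap_rotate σ ney.symm hyf
      have p2 : swap f y * (swap e y * σ) = swap e f * (swap f y * σ) := by
        rw [swap_comm e y]
        exact (swap_mul_swap_rotate σ nef ney).symm
      have hk := hg.eps_cyclic σ nef hyf.symm ney
      have hc : (swap e f * (swap f y * σ)).SameCycle e f := by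
        refine sameCycle_swap_self fun h => hef ?_
        exact sameCycle_of_swap (hf.symm.trans hy) hyf.symm h
      have hcl := hr.cl_eq hc
      have t1 : T e f y e = -((eps inn out σ e f * eps inn out (swap e f * σ) e y) •
          (cl (swap e f * (swap f y * σ)) y ⊗ₜ[𝕜] cl (swap e f * (swap f y * σ)) f)) := by
        rw [hT, swap_comm y e, p1, hcl, hg.eps_swap _ ney.symm, mul_neg, neg_smul]
      have t2 : T e f e y = (eps inn out σ e f * eps inn out (swap e f * σ) e y) •
          (cl (swap e f * (swap f y * σ)) f ⊗ₜ[𝕜] cl (swap e f * (swap f y * σ)) y) := by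
        rw [hT, p1, hcl]
      have t3 : T e y f y = (eps inn out σ e y * eps inn out (swap e y * σ) f y) •
          (cl (swap e f * (swap f y * σ)) f ⊗ₜ[𝕜] cl (swap e f * (swap f y * σ)) y) := by
        rw [hT, p2]
      have t4 : T e y y f = -((eps inn out σ e y * eps inn out (swap e y * σ) f y) •
          (cl (swap e f * (swap f y * σ)) y ⊗ₜ[𝕜] cl (swap e f * (swap f y * σ)) f)) := by
        rw [hT, swap_comm y f, p2, hg.eps_swap _ hyf, mul_neg, neg_smul]
      have s1 : S e f y f = -((eps inn out σ f y * eps inn out (swap f y * σ) e f) •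
          (cl (swap e f * (swap f y * σ)) y ⊗ₜ[𝕜] cl (swap e f * (swap f y * σ)) f)) := by
        rw [hS, swap_comm y f, hg.eps_swap σ hyf, neg_mul, neg_smul]
      have s2 := hS e f f y
      have hk' : eps inn out σ e f * eps inn out (swap e f * σ) e y +
          eps inn out σ e y * eps inn out (swap e y * σ) f y -
          eps inn out σ f y * eps inn out (swap f y * σ) e f = 0 := by
        rw [hg.eps_swap _ ney.symm, hg.eps_swap (swap e f * σ) ney.symm, swap_comm y e] at hk
        linarith
      rw [t1, t2, t3, t4, s1, s2]
      generalize cl (swap e f * (swap f y * σ)) f ⊗ₜ[𝕜] cl (swap e f * (swap f y * σ)) y = X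
      generalize cl (swap e f * (swap f y * σ)) y ⊗ₜ[𝕜] cl (swap e f * (swap f y * σ)) f = Y
      refine Eq.trans ?_ ((congrArg (· • (X - Y)) hk').trans (zero_smul ℤ _))
      module
    · rw [if_neg hB, if_neg (fun h => hB ⟨h.1, h.2.2.1, h.2.1, h.2.2.2.symm⟩), add_zero]
  have hA (x : E) : σ.SameCycle a x ↔ ¬σ.SameCycle b x :=
    ⟨fun h h' => hab (h.trans h'.symm), (hσ x).resolve_right⟩
  have hne {e f : E} (h : σ.SameCycle a e ∧ σ.SameCycle b f) : e ≠ f := by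
    rintro rfl; exact (hA e).1 h.1 h.2
  obtain ⟨Q, hQ⟩ : ∃ Q : E → E → E → E → A ⊗[𝕜] A, ∀ e f g h, Q e f g h = T e f g h -
      if (σ.SameCycle b g ∧ σ.SameCycle b h) ∨ (σ.SameCycle a g ∧ σ.SameCycle a h) then
        S e f g h else 0 := ⟨_, fun _ _ _ _ => rfl⟩
  -- Both terms on the right side are written as one sum over crossings of the two curves.
  have collect : (∑ g, ∑ h, ∑ e, ∑ f,
      if (σ.SameCycle b g ∧ σ.SameCycle b h ∧ g ≠ h) ∧ σ.SameCycle a e ∧ σ.SameCycle b f then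
        S e f g h else 0) - (∑ g, ∑ h, ∑ e, ∑ f,
      if (σ.SameCycle a g ∧ σ.SameCycle a h ∧ g ≠ h) ∧ σ.SameCycle b e ∧ σ.SameCycle a f then
        S e f g h else 0) = ∑ e, ∑ f, if σ.SameCycle a e ∧ σ.SameCycle b f then
      ∑ g, ∑ h, if g ≠ h then if (σ.SameCycle b g ∧ σ.SameCycle b h) ∨
        (σ.SameCycle a g ∧ σ.SameCycle a h) then S e f g h else 0 else 0 else 0 := by
    rw [sum_exchange₄ (fun e f g h => if (σ.SameCycle b g ∧ σ.SameCycle b h ∧ g ≠ h) ∧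
      σ.SameCycle a e ∧ σ.SameCycle b f then S e f g h else 0),
      sum_exchange₄ (fun e f g h => if (σ.SameCycle a g ∧ σ.SameCycle a h ∧ g ≠ h) ∧
      σ.SameCycle b e ∧ σ.SameCycle a f then S e f g h else 0),
      Finset.sum_comm (f := fun e f => ∑ g, ∑ h, if (σ.SameCycle a g ∧ σ.SameCycle a h ∧ g ≠ h) ∧
      σ.SameCycle b e ∧ σ.SameCycle a f then S e f g h else 0)]
    simp only [← Finset.sum_sub_distrib]
    refine Finset.sum_congr rfl fun e _ => Finset.sum_congr rfl fun f _ => ?_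
    split_ifs with hB
    · refine Finset.sum_congr rfl fun g _ => Finset.sum_congr rfl fun h _ => ?_
      rw [S_flip (hne hB)]
      have h1 := hA g
      have h2 := hA h
      by_cases hgh : g = h
      · simp [hgh]
      · by_cases h3 : σ.SameCycle b g <;> by_cases h4 : σ.SameCycle b h <;>
          simp [h1, h2, h3, h4, hgh, hB.1, hB.2]
    · refine Finset.sum_eq_zero fun g _ => Finset.sum_eq_zero fun h _ => ?_
      rw [if_neg (by tauto), if_neg (by tauto), sub_zero]
  rw [collect, ← sub_eq_zero]
  simp only [← Finset.sum_sub_distrib]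
  -- For a fixed first crossing, the self-crossings away from it cancel, and there remain the other
  -- crossings of the two curves and the pairs with a common passage.
  have e1 (e f : E) : ((if σ.SameCycle a e ∧ σ.SameCycle b f then
      ∑ g, ∑ h, if g ≠ h then T e f g h else 0 else 0) -
      if σ.SameCycle a e ∧ σ.SameCycle b f then
      ∑ g, ∑ h, if g ≠ h then if (σ.SameCycle b g ∧ σ.SameCycle b h) ∨
        (σ.SameCycle a g ∧ σ.SameCycle a h) then S e f g h else 0 else 0 else 0) =
      (∑ g, ∑ h, ((if σ.SameCycle a e ∧ σ.SameCycle b f ∧ (g ≠ e ∧ g ≠ f ∧ h ≠ e ∧ h ≠ f) ∧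
        σ.SameCycle a g ∧ σ.SameCycle b h then T e f g h else 0) +
        (if σ.SameCycle a e ∧ σ.SameCycle b f ∧ (g ≠ e ∧ g ≠ f ∧ h ≠ e ∧ h ≠ f) ∧
        σ.SameCycle b g ∧ σ.SameCycle a h then T e f g h else 0))) +
      ∑ y, ((if σ.SameCycle a e ∧ σ.SameCycle b f ∧ σ.SameCycle b y ∧ y ≠ f then
        T e f e y + T e f y e + (T e f f y - S e f f y) + (T e f y f - S e f y f) else 0) -
        (if σ.SameCycle b f ∧ σ.SameCycle a e ∧ σ.SameCycle a y ∧ y ≠ e then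
        T f e f y + T f e y f + (T f e e y - S f e e y) + (T f e y e - S f e y e) else 0)) := by
    by_cases hB : σ.SameCycle a e ∧ σ.SameCycle b f
    · have hef := hne hB
      have e2 : (∑ g, ∑ h, if g ≠ h then T e f g h else 0) -
          (∑ g, ∑ h, if g ≠ h then if (σ.SameCycle b g ∧ σ.SameCycle b h) ∨
            (σ.SameCycle a g ∧ σ.SameCycle a h) then S e f g h else 0 else 0) =
          ∑ g, ∑ h, if g ≠ h then Q e f g h else 0 := by
        simp only [← Finset.sum_sub_distrib, hQ]
        refine Finset.sum_congr rfl fun g _ => Finset.sum_congr rfl fun h _ => ?_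
        split_ifs <;> simp
      have q1 : Q e f e f = 0 := by
        rw [hQ, T_self hef, if_neg, sub_zero]
        have := hA e; have := hA f; tauto
      have q2 : Q e f f e = 0 := by
        rw [hQ, T_self' hef, if_neg, sub_zero]
        have := hA e; have := hA f; tauto
      rw [if_pos hB, if_pos hB, e2, sum_pair_split _ hef, q1, q2, add_zero, add_zero]
      congr 1
      · refine Finset.sum_congr rfl fun g _ => Finset.sum_congr rfl fun h _ => ?_
        have h1 := hA g
        have h2 := hA h
        by_cases hd : g ≠ e ∧ g ≠ f ∧ h ≠ e ∧ h ≠ f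
        · by_cases hgh : g = h
          · subst hgh
            rw [if_neg (fun h => h.1 rfl), if_neg (by tauto), if_neg (by tauto), add_zero]
          · rw [if_pos ⟨hgh, hd⟩, hQ, T_eq hd]
            by_cases h3 : σ.SameCycle b g <;> by_cases h4 : σ.SameCycle b h <;>
              simp [h1, h2, h3, h4, hd, hB.1, hB.2]
        · rw [if_neg (by tauto), if_neg (by tauto), if_neg (by tauto), add_zero]
      · refine Finset.sum_congr rfl fun y _ => ?_
        have h0 : ¬σ.SameCycle b e := (hA e).1 hB.1
        have h0' : ¬σ.SameCycle a f := fun h => (hA f).1 h hB.2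
        have h1 := hA y
        simp only [T_flip hef, S_flip hef, hQ]
        by_cases h3 : σ.SameCycle b y
        · have h4 : y ≠ e := fun h => h0 (h ▸ h3)
          have h5 : ¬σ.SameCycle a y := fun h => h1.1 h h3
          by_cases h6 : y = f
          · simp [h6, h0']
          · simp [h3, h4, h5, h6, h0, h0', hB.1, hB.2]
        · have h4 : y ≠ f := fun h => h3 (h ▸ hB.2)
          have h5 : σ.SameCycle a y := h1.2 h3
          by_cases h6 : y = e
          · simp [h6, h0]
          · simp [h3, h4, h5, h6, h0, h0', hB.1, hB.2]
            abel
    · rw [if_neg hB, if_neg hB, sub_zero]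
      symm
      rw [Finset.sum_eq_zero, Finset.sum_eq_zero, add_zero]
      · intro y _
        rw [if_neg (by tauto), if_neg (by tauto), sub_zero]
      · intro g _
        refine Finset.sum_eq_zero fun h _ => ?_
        rw [if_neg (by tauto), if_neg (by tauto), add_zero]
  simp only [e1]
  simp only [Finset.sum_add_distrib, Finset.sum_sub_distrib]
  rw [overlap a b hab, Finset.sum_comm (f := fun e f => ∑ y, if σ.SameCycle b f ∧
    σ.SameCycle a e ∧ σ.SameCycle a y ∧ y ≠ e then
    T f e f y + T f e y f + (T f e e y - S f e e y) + (T f e y e - S f e y e) else 0),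
    overlap b a (fun h => hab h.symm), sub_zero, add_zero,
    sum_twist₄ (fun e f g h => if σ.SameCycle a e ∧ σ.SameCycle b f ∧
      (g ≠ e ∧ g ≠ f ∧ h ≠ e ∧ h ≠ f) ∧ σ.SameCycle b g ∧ σ.SameCycle a h then
      T e f g h else 0)]
  simp only [← Finset.sum_add_distrib]
  refine Finset.sum_eq_zero fun e _ => Finset.sum_eq_zero fun f _ => Finset.sum_eq_zero fun g _ =>
    Finset.sum_eq_zero fun h _ => ?_
  by_cases hB : σ.SameCycle a e ∧ σ.SameCycle b f ∧ (g ≠ e ∧ g ≠ f ∧ h ≠ e ∧ h ≠ f) ∧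
      σ.SameCycle a g ∧ σ.SameCycle b h
  · obtain ⟨b1, b2, b3, b4, b5⟩ := hB
    rw [if_pos ⟨b1, b2, b3, b4, b5⟩, if_pos ⟨b4, b5, ⟨b3.2.1.symm, b3.2.2.2.symm, b3.1.symm,
      b3.2.2.1.symm⟩, b2, b1⟩, T_twist b3 (fun h => hab (b1.trans (h.trans b2.symm)))
      (b1.symm.trans b4) (b2.symm.trans b5), add_neg_cancel]
  · rw [if_neg hB, if_neg, add_zero]
    rintro ⟨b4, b5, ⟨c1, c2, c3, c4⟩, b2, b1⟩
    exact hB ⟨b1, b2, ⟨c3.symm, c1.symm, c4.symm, c2.symm⟩, b4, b5⟩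

end Identities

/-! ### Conjugacy classes of the free group as cyclic words -/

section Class
variable {n : ℕ}

theorem bar_bar (x : Letter n) : bar (bar x) = x := by simp [bar]

theorem bar_ne (x : Letter n) : bar x ≠ x := by
  intro h
  have := congrArg Prod.snd h
  simp [bar] at this

theorem bar_injective : Function.Injective (bar (n := n)) := fun x y h => by
  rw [← bar_bar x, h, bar_bar]

theorem mk_bar (x : Letter n) : FreeGroup.mk [bar x] = (FreeGroup.mk [x])⁻¹ := by
  simp [FreeGroup.inv_mk, FreeGroup.invRev, bar]

theorem mk_cons (x : Letter n) (l : List (Letter n)) :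
    FreeGroup.mk (x :: l) = FreeGroup.mk [x] * FreeGroup.mk l := by
  simp [FreeGroup.mul_mk]

theorem ne_bar_iff {a b : Letter n} : b ≠ bar a ↔ (a.1 = b.1 → a.2 = b.2) := by
  obtain ⟨i, s⟩ := a
  obtain ⟨j, t⟩ := b
  cases s <;> cases t <;> simp [bar, eq_comm]

theorem isReduced_iff_chain {l : List (Letter n)} :
    FreeGroup.IsReduced l ↔ l.IsChain fun a b => b ≠ bar a := by
  simp only [FreeGroup.IsReduced, ne_bar_iff]

/-- Being reduced in terms of consecutive letters of the cyclic word. -/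
theorem isReduced_iff_cycle_chain (c : Cycle (Letter n)) :
    IsReduced c ↔ c ≠ Cycle.nil ∧ c.Chain fun a b => b ≠ bar a := by
  refine and_congr_right fun hc => ⟨fun h => ?_, fun h w hw => ?_⟩
  · obtain ⟨w, rfl⟩ : ∃ w : List (Letter n), (w : Cycle (Letter n)) = c := Quot.exists_rep c
    cases w with
    | nil => exact absurd rfl hc
    | cons a m =>
      rw [Cycle.chain_coe_cons]
      have h1 := isReduced_iff_chain.1 (h _ rfl)
      have h2 := isReduced_iff_chain.1 (h (m ++ [a]) (Cycle.coe_eq_coe.2 ⟨m.length, by simp⟩))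
      cases m with
      | nil => simpa using (bar_ne a).symm
      | cons b m =>
        rw [List.isChain_cons_cons] at h1
        rw [List.cons_append, List.isChain_cons_cons]
        exact ⟨h1.1, h2⟩
  · rw [isReduced_iff_chain]
    subst hw
    cases w with
    | nil => exact List.isChain_nil
    | cons a m =>
      rw [Cycle.chain_coe_cons] at h
      exact List.IsChain.left_of_append (l₂ := [a]) (by simpa using h)

theorem reduceCyclically_eq_self {l : List (Letter n)}
    (h : (l : Cycle (Letter n)).Chain fun a b => b ≠ bar a) :
    FreeGroup.reduceCyclically l = l := by
  induction l using List.bidirectionalRec with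
  | nil => simp
  | singleton a => simp
  | cons_append a m b =>
    rw [FreeGroup.reduceCyclically.cons_append, if_neg]
    · rfl
    · rintro ⟨h1, h2⟩
      rw [Cycle.chain_coe_cons, show a :: (m ++ [b] ++ [a]) = (a :: m) ++ b :: [a] by simp,
        List.isChain_split] at h
      have := h.2
      rw [List.isChain_cons_cons] at this
      exact this.1 (by simp [bar, h1, h2])

/-- The cyclic word of a conjugacy class in the free group. -/
def cycleOf (g : FreeGroup (Fin n)) : Cycle (Letter n) :=
  (FreeGroup.reduceCyclically g.toWord : List (Letter n))

theorem cycleOf_one : cycleOf (1 : FreeGroup (Fin n)) = Cycle.nil := by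
  simp [cycleOf]

theorem cycleOf_mk {l : List (Letter n)} (h : (l : Cycle (Letter n)).Chain fun a b => b ≠ bar a) :
    cycleOf (FreeGroup.mk l) = (l : Cycle (Letter n)) := by
  have hl : FreeGroup.IsReduced l := by
    by_cases hn : l = []
    · subst hn; exact List.isChain_nil
    · exact ((isReduced_iff_cycle_chain _).2 ⟨by simpa using hn, h⟩).2 l rfl
  rw [cycleOf, FreeGroup.toWord_mk, hl.reduce_eq, reduceCyclically_eq_self h]

theorem chain_reduceCyclically (g : FreeGroup (Fin n)) :
    ((FreeGroup.reduceCyclically g.toWord : List (Letter n)) : Cycle (Letter n)).Chain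
      fun a b => b ≠ bar a := by
  have h := FreeGroup.reduceCyclically.isCyclicallyReduced
    (FreeGroup.isReduced_toWord (x := g))
  set l := FreeGroup.reduceCyclically g.toWord
  cases hl : l using List.bidirectionalRec with
  | nil => exact trivial
  | singleton a =>
    rw [Cycle.chain_coe_cons]
    simpa using (bar_ne a).symm
  | cons_append a m b =>
    rw [hl, ← List.cons_append, FreeGroup.isCyclicallyReduced_cons_append_iff,
      isReduced_iff_chain] at h
    rw [Cycle.chain_coe_cons, show a :: (m ++ [b] ++ [a]) = (a :: m) ++ b :: [a] by simp,
      List.isChain_split]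
    exact ⟨h.1, by simpa [ne_bar_iff] using h.2⟩

theorem exists_conj_reduceCyclically (g : FreeGroup (Fin n)) :
    ∃ c, g = c * FreeGroup.mk (FreeGroup.reduceCyclically g.toWord) * c⁻¹ := by
  refine ⟨FreeGroup.mk (FreeGroup.reduceCyclically.conjugator g.toWord), ?_⟩
  rw [FreeGroup.inv_mk, FreeGroup.mul_mk, FreeGroup.mul_mk,
    FreeGroup.reduceCyclically.conj_conjugator_reduceCyclically, FreeGroup.mk_toWord]

theorem isReduced_cycleOf {g : FreeGroup (Fin n)} (hg : g ≠ 1) : IsReduced (cycleOf g) := by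
  refine (isReduced_iff_cycle_chain _).2 ⟨fun h => hg ?_, chain_reduceCyclically g⟩
  obtain ⟨c, hc⟩ := exists_conj_reduceCyclically g
  rw [cycleOf, Cycle.coe_eq_nil] at h
  rw [h] at hc
  rw [hc, ← FreeGroup.one_eq_mk]
  simp

/-- A letter that cancels in front of a reduced word, but not behind it, is moved to the back by
conjugation. -/
theorem cycleOf_conj_of_cons {x : Letter n} {m : List (Letter n)}
    (h : FreeGroup.IsReduced (bar x :: m)) (hx : (bar x :: m).getLast? ≠ some x) :
    cycleOf (FreeGroup.mk [x] * FreeGroup.mk (bar x :: m) * (FreeGroup.mk [x])⁻¹) =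
      cycleOf (FreeGroup.mk (bar x :: m)) := by
  have hc : ((bar x :: m : List (Letter n)) : Cycle (Letter n)).Chain fun a b => b ≠ bar a := by
    rw [Cycle.chain_coe_cons]
    rw [isReduced_iff_chain] at h
    cases m using List.reverseRecOn with
    | nil => simpa using (bar_ne _).symm
    | append_singleton m b =>
      rw [show bar x :: (m ++ [b] ++ [bar x]) = (bar x :: m) ++ b :: [bar x] by simp,
        List.isChain_split]
      refine ⟨h, ?_⟩
      rw [List.isChain_cons_cons]
      refine ⟨fun h' => hx ?_, List.isChain_singleton _⟩
      rw [← bar_injective h', ← List.cons_append, List.getLast?_concat]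
  have hrot : ((m ++ [bar x] : List (Letter n)) : Cycle (Letter n)) = (bar x :: m : List _) :=
    Cycle.coe_eq_coe.2 (List.IsRotated.symm ⟨1, by simp⟩)
  rw [mk_cons (bar x) m, mk_bar, ← mk_bar, mk_bar, mul_inv_cancel_left, ← mk_bar,
    FreeGroup.mul_mk, cycleOf_mk (hrot ▸ hc), hrot, ← mk_cons, cycleOf_mk hc]

theorem cycleOf_conj_letter (x : Letter n) (g : FreeGroup (Fin n)) :
    cycleOf (FreeGroup.mk [x] * g * (FreeGroup.mk [x])⁻¹) = cycleOf g := by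
  obtain ⟨w, hw, rfl⟩ : ∃ w : List (Letter n), FreeGroup.IsReduced w ∧ g = FreeGroup.mk w :=
    ⟨g.toWord, FreeGroup.isReduced_toWord, FreeGroup.mk_toWord.symm⟩
  by_cases h1 : w.head? = some (bar x)
  · cases w with
    | nil => simp at h1
    | cons y m =>
      obtain rfl : y = bar x := by simpa using h1
      by_cases h2 : (bar x :: m).getLast? = some x
      · cases m using List.reverseRecOn with
        | nil => exact absurd (by simpa using h2) (bar_ne x)
        | append_singleton m z =>
          obtain rfl : z = x := by
            rw [← List.cons_append, List.getLast?_concat] at h2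
            simpa using h2
          have hm : FreeGroup.IsReduced m := hw.infix ⟨[bar z], [z], by simp⟩
          have e1 : FreeGroup.mk [z] * FreeGroup.mk (bar z :: (m ++ [z])) * (FreeGroup.mk [z])⁻¹ =
              FreeGroup.mk m := by
            rw [mk_cons (bar z), ← FreeGroup.mul_mk, mk_bar]
            group
          rw [e1, cycleOf, cycleOf, FreeGroup.toWord_mk, FreeGroup.toWord_mk, hw.reduce_eq,
            hm.reduce_eq, FreeGroup.reduceCyclically.cons_append, if_pos]
          simp [bar]
      · exact cycleOf_conj_of_cons hw h2
  · by_cases h2 : w.getLast? = some x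
    · cases w using List.reverseRecOn with
      | nil => simp at h2
      | append_singleton m z =>
        obtain rfl : z = x := by simpa using h2
        have e1 : FreeGroup.mk [z] * FreeGroup.mk (m ++ [z]) * (FreeGroup.mk [z])⁻¹ =
            FreeGroup.mk (z :: m) := by
          rw [mk_cons z m, ← FreeGroup.mul_mk]
          group
        have hred : FreeGroup.IsReduced (bar (bar z) :: m) := by
          rw [bar_bar]
          cases m with
          | nil => exact FreeGroup.IsReduced.singleton
          | cons b m =>
            rw [isReduced_iff_chain, List.isChain_cons_cons]
            refine ⟨fun h => h1 (by simp [h]), isReduced_iff_chain.1 (hw.infix ⟨[], [z], by simp⟩)⟩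
        have := cycleOf_conj_of_cons (x := bar z) (m := m) hred (by
          rw [bar_bar]
          cases m using List.reverseRecOn with
          | nil => simpa using (bar_ne z).symm
          | append_singleton m b =>
            rw [← List.cons_append, List.getLast?_concat]
            intro h
            obtain rfl : b = bar z := by simpa using h
            rw [isReduced_iff_chain, List.append_assoc, List.singleton_append,
              List.isChain_split, List.isChain_cons_cons] at hw
            exact hw.2.1 (bar_bar z).symm)
        rw [bar_bar] at this
        rw [e1, ← this, mk_bar, mk_cons z m, ← FreeGroup.mul_mk]
        congr 1
        group
    · by_cases hw0 : w = []
      · subst hw0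
        rw [← FreeGroup.one_eq_mk, mul_one, mul_inv_cancel]
      have hred : FreeGroup.IsReduced (x :: (w ++ [bar x])) := by
        rw [isReduced_iff_chain] at hw ⊢
        rw [List.isChain_cons, List.isChain_append]
        refine ⟨fun y hy hxy => h1 ?_, hw, List.isChain_singleton _, fun y hy z hz hyz => h2 ?_⟩
        · rw [List.head?_append_of_ne_nil _ hw0] at hy
          rw [hy, hxy]
        · rw [← bar_injective ((by simpa using hz : bar x = z).trans hyz)] at hy
          exact hy
      have e1 : FreeGroup.mk [x] * FreeGroup.mk w * (FreeGroup.mk [x])⁻¹ =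
          FreeGroup.mk (x :: (w ++ [bar x])) := by
        rw [← mk_bar, FreeGroup.mul_mk, FreeGroup.mul_mk]
        simp
      rw [e1, cycleOf, cycleOf, FreeGroup.toWord_mk, FreeGroup.toWord_mk, hw.reduce_eq,
        hred.reduce_eq, FreeGroup.reduceCyclically.cons_append, if_pos]
      simp [bar]

/-- The word of a conjugacy class does not depend on the representative. Conjugation by one letter
is enough, and there it rotates a cyclically reduced word or cancels. -/
theorem cycleOf_conj (c g : FreeGroup (Fin n)) : cycleOf (c * g * c⁻¹) = cycleOf g := by
  obtain ⟨w, rfl⟩ : ∃ w, c = FreeGroup.mk w := ⟨c.toWord, FreeGroup.mk_toWord.symm⟩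
  induction w with
  | nil => rw [← FreeGroup.one_eq_mk]; simp
  | cons x w ih =>
    rw [mk_cons, ← ih, ← cycleOf_conj_letter x (FreeGroup.mk w * g * (FreeGroup.mk w)⁻¹)]
    congr 1
    group

end Class

/-! ### Sums along words that only depend on the element of the free group -/

section Walk
variable {n : ℕ} {M : Type*} [AddCommGroup M] {Z : Type*}

/-- The sum of `Ψ x z` over the letters `x` of a word, where the state `z` is moved by each letter
that has been read. -/
def walkSum (act : FreeGroup (Fin n) → Z → Z) (Ψ : Letter n → Z → M) : Z → List (Letter n) → M
  | _, [] => 0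
  | z, x :: l => Ψ x z + walkSum act Ψ (act (FreeGroup.mk [x]) z) l

/-- A right action on the states, and a summand that changes its sign when a letter is read
backwards. -/
structure IsWalk (act : FreeGroup (Fin n) → Z → Z) (Ψ : Letter n → Z → M) : Prop where
  act_one : ∀ z, act 1 z = z
  act_mul : ∀ g h z, act (g * h) z = act h (act g z)
  bar_act : ∀ x z, Ψ (bar x) (act (FreeGroup.mk [x]) z) = -Ψ x z

variable {act : FreeGroup (Fin n) → Z → Z} {Ψ : Letter n → Z → M}

theorem IsWalk.append (h : IsWalk act Ψ) (z : Z) (l₁ l₂ : List (Letter n)) :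
    walkSum act Ψ z (l₁ ++ l₂) =
      walkSum act Ψ z l₁ + walkSum act Ψ (act (FreeGroup.mk l₁) z) l₂ := by
  induction l₁ generalizing z with
  | nil => rw [← FreeGroup.one_eq_mk, h.act_one]; simp [walkSum]
  | cons x l ih =>
    rw [List.cons_append, walkSum, walkSum, ih, mk_cons x l, h.act_mul, add_assoc]

theorem IsWalk.step (h : IsWalk act Ψ) (z : Z) {l l' : List (Letter n)}
    (hl : FreeGroup.Red.Step l l') : walkSum act Ψ z l = walkSum act Ψ z l' := by
  obtain @⟨l₁, l₂, x, b⟩ := hl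
  have hx : (x, !b) = bar ((x, b) : Letter n) := rfl
  rw [h.append, h.append, hx, walkSum, walkSum, h.bar_act, ← h.act_mul, ← h.act_mul]
  rw [mk_bar, mul_inv_cancel, mul_one, add_neg_cancel_left]

/-- Removing a pair `x x̅` does not change the sum along a walk, so it is a function on the free
group. -/
theorem IsWalk.eq_of_mk_eq (h : IsWalk act Ψ) (z : Z) {l l' : List (Letter n)}
    (hl : FreeGroup.mk l = FreeGroup.mk l') : walkSum act Ψ z l = walkSum act Ψ z l' := by
  have red (l : List (Letter n)) : walkSum act Ψ z l = walkSum act Ψ z (FreeGroup.reduce l) := by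
    have := FreeGroup.reduce.red (L := l)
    generalize FreeGroup.reduce l = l' at this
    induction this with
    | refl => rfl
    | tail _ h2 ih => rw [ih, h.step z h2]
  rw [red l, red l', FreeGroup.reduce.sound hl]

/-- The states of a loop: the group element that is read when the loop starts at this place. -/
def rot (g h : FreeGroup (Fin n)) : FreeGroup (Fin n) := g⁻¹ * h * g

/-- The sum of `Φ p g` over the outgoing ends, minus the sum over the incoming ends, of the edges of
a loop; here `g` is the element of the free group that is read along the loop from this end. -/
noncomputable def loopSum (Φ : Letter n → FreeGroup (Fin n) → M) (g : FreeGroup (Fin n)) : M :=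
  walkSum rot (fun x g => Φ x g - Φ (bar x) (rot (FreeGroup.mk [x]) g)) g g.toWord

theorem isWalk_rot (Φ : Letter n → FreeGroup (Fin n) → M) :
    IsWalk rot (fun x g => Φ x g - Φ (bar x) (rot (FreeGroup.mk [x]) g)) where
  act_one z := by simp [rot]
  act_mul g h z := by simp [rot, mul_assoc]
  bar_act x z := by
    simp only [bar_bar, mk_bar, neg_sub]
    congr 2
    simp only [rot]
    group

theorem loopSum_mk (Φ : Letter n → FreeGroup (Fin n) → M) (l : List (Letter n)) :
    loopSum Φ (FreeGroup.mk l) =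
      walkSum rot (fun x g => Φ x g - Φ (bar x) (rot (FreeGroup.mk [x]) g)) (FreeGroup.mk l) l :=
  (isWalk_rot Φ).eq_of_mk_eq _ FreeGroup.mk_toWord

theorem loopSum_one (Φ : Letter n → FreeGroup (Fin n) → M) : loopSum Φ 1 = 0 := by
  rw [FreeGroup.one_eq_mk, loopSum_mk]
  rfl

/-- Rotating a word only permutes the summands, so `loopSum` is a class function. -/
theorem loopSum_conj (Φ : Letter n → FreeGroup (Fin n) → M) (c g : FreeGroup (Fin n)) :
    loopSum Φ (c * g * c⁻¹) = loopSum Φ g := by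
  have comm (l l' : List (Letter n)) : loopSum Φ (FreeGroup.mk l * FreeGroup.mk l') = loopSum Φ
      (FreeGroup.mk l' * FreeGroup.mk l) := by
    rw [FreeGroup.mul_mk, FreeGroup.mul_mk, loopSum_mk, loopSum_mk, (isWalk_rot Φ).append,
      (isWalk_rot Φ).append, add_comm]
    congr 2 <;> simp only [rot, ← FreeGroup.mul_mk] <;> group
  have := comm (c * g).toWord c⁻¹.toWord
  rw [FreeGroup.mk_toWord, FreeGroup.mk_toWord] at this
  rw [this, inv_mul_cancel_left]

/-- The sum of `s q • Θ A B` over the outgoing ends `q`, minus the sum over the incoming ends, that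
are met along a word; here `A` and `B` are the two parts into which the word is cut there. The two
ends of the word itself do not contribute if `Θ` vanishes at `1`. -/
noncomputable def cutSum (s : Letter n → ℤ) (Θ : FreeGroup (Fin n) → FreeGroup (Fin n) → M)
    (g : FreeGroup (Fin n)) : M :=
  walkSum (fun g z => (z.1 * g, g⁻¹ * z.2))
    (fun x z => s x • Θ z.1 z.2 - s (bar x) • Θ (z.1 * FreeGroup.mk [x])
        ((FreeGroup.mk [x])⁻¹ * z.2)) (1, g) g.toWord

theorem isWalk_cut (s : Letter n → ℤ) (Θ : FreeGroup (Fin n) → FreeGroup (Fin n) → M) :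
    IsWalk (fun g (z : FreeGroup (Fin n) × FreeGroup (Fin n)) => (z.1 * g, g⁻¹ * z.2))
      (fun x z => s x • Θ z.1 z.2 - s (bar x) • Θ (z.1 * FreeGroup.mk [x])
          ((FreeGroup.mk [x])⁻¹ * z.2)) where
  act_one z := by simp
  act_mul g h z := by simp [mul_assoc]
  bar_act x z := by simp only [bar_bar, mk_bar, neg_sub, mul_inv_cancel_right, inv_inv,
    mul_inv_cancel_left]

theorem cutSum_mk (s : Letter n → ℤ) (Θ : FreeGroup (Fin n) → FreeGroup (Fin n) → M)
    (l : List (Letter n)) : cutSum s Θ (FreeGroup.mk l) =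
      walkSum (fun g z => (z.1 * g, g⁻¹ * z.2))
    (fun x z => s x • Θ z.1 z.2 - s (bar x) • Θ (z.1 * FreeGroup.mk [x])
        ((FreeGroup.mk [x])⁻¹ * z.2)) (1, FreeGroup.mk l) l :=
  (isWalk_cut s Θ).eq_of_mk_eq _ FreeGroup.mk_toWord

end Walk

section Holonomy
open Equiv Equiv.Perm
variable {n : ℕ} {M : Type*} [AddCommGroup M] {E : Type*}

/-- The element of the free group that is read along a cycle of `σ` from `e`. -/
noncomputable def hol (x : E → Letter n) (σ : Perm E) (e : E) : FreeGroup (Fin n) :=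
  FreeGroup.mk ((cycleList σ e).map x)

variable {x : E → Letter n} {σ : Perm E}

theorem hol_apply [Fintype E] (e : E) : hol x σ (σ e) = rot (FreeGroup.mk [x e]) (hol x σ e) := by
  obtain ⟨A, hA⟩ := exists_cycleList_eq_cons σ e
  rw [hol, hol, rot, cycleList_apply, hA]
  simp only [List.rotate_cons_succ, List.rotate_zero, List.map_append, List.map_cons, List.map_nil]
  rw [mk_cons (x e) (A.map x), ← FreeGroup.mul_mk]
  group

/-- Along a curve, `loopSum` collects the outgoing and the incoming end at each point. -/
theorem loopSum_hol [Fintype E] (Φ : Letter n → FreeGroup (Fin n) → M) (a : E) :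
    loopSum Φ (hol x σ a) =
      ∑ e ∈ cyc σ a, (Φ (x e) (hol x σ e) - Φ (bar (x (σ⁻¹ e))) (hol x σ e)) := by
  have e1 : ∑ e ∈ cyc σ a, (Φ (x e) (hol x σ e) - Φ (bar (x (σ⁻¹ e))) (hol x σ e)) =
      ∑ e ∈ cyc σ a, (Φ (x e) (hol x σ e) - Φ (bar (x e)) (hol x σ (σ e))) := by
    rw [Finset.sum_sub_distrib, Finset.sum_sub_distrib,
      ← sum_cyc_apply σ a (fun e => Φ (bar (x (σ⁻¹ e))) (hol x σ e))]
    simp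
  rw [e1, sum_cyc]
  have hc := cycleList_chain (σ := σ) (e := a)
  have key (l : List E) (e : E) (h : List.IsChain (fun a b => σ a = b) (e :: l)) :
      walkSum rot (fun x g => Φ x g - Φ (bar x) (rot (FreeGroup.mk [x]) g)) (hol x σ e)
        ((e :: l).map x) =
      ((e :: l).map fun e => Φ (x e) (hol x σ e) - Φ (bar (x e)) (hol x σ (σ e))).sum := by
    induction l generalizing e with
    | nil => simp [walkSum, hol_apply]
    | cons f l ih =>
      rw [List.isChain_cons_cons] at h
      obtain ⟨rfl, h⟩ := h
      rw [List.map_cons, walkSum, ← hol_apply, ih _ h]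
      simp only [List.map_cons, List.sum_cons]
  obtain ⟨A, hA⟩ := exists_cycleList_eq_cons σ a
  rw [hA] at hc ⊢
  rw [← key A a (hc.left_of_append)]
  conv_lhs => rw [hol, loopSum_mk]
  rw [hol, hA]

/-- The value of `Θ` on the two arcs into which a cycle is cut in front of `e` and `f`. -/
noncomputable def arcs [DecidableEq E] (Θ : FreeGroup (Fin n) → FreeGroup (Fin n) → M)
    (x : E → Letter n) (σ : Perm E) (e f : E) : M :=
  if e = f then 0 else Θ (hol x (swap e f * σ) e) (hol x (swap e f * σ) f)

theorem arcs_eq [Fintype E] [DecidableEq E] {Θ : FreeGroup (Fin n) → FreeGroup (Fin n) → M}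
    (h₁ : ∀ g, Θ 1 g = 0) {e f : E} {A B : List E} (h : cycleList σ e = A ++ f :: B) :
    Θ (FreeGroup.mk (A.map x)) (FreeGroup.mk ((f :: B).map x)) = arcs Θ x σ e f := by
  cases A with
  | nil =>
    obtain ⟨A', hA'⟩ := exists_cycleList_eq_cons σ e
    rw [hA'] at h
    obtain ⟨rfl, -⟩ : e = f ∧ A' = B := by simpa using h
    rw [arcs, if_pos rfl, List.map_nil, ← FreeGroup.one_eq_mk, h₁]
  | cons e' A =>
    obtain ⟨A', hA'⟩ := exists_cycleList_eq_cons σ e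
    obtain ⟨rfl, -⟩ : e = e' ∧ A' = A ++ f :: B := by rw [hA'] at h; simpa using h
    have hn := nodup_cycleList σ e
    rw [h] at hn
    have hef : e ≠ f := by
      rintro rfl
      simp at hn
    obtain ⟨h1, h2⟩ := cycleList_swap_of_split h
    rw [arcs, if_neg hef, hol, hol, h1, h2]

theorem arcs_apply_eq [Fintype E] [DecidableEq E] {Θ : FreeGroup (Fin n) → FreeGroup (Fin n) → M}
    (h₁ : ∀ g, Θ 1 g = 0) (h₂ : ∀ g, Θ g 1 = 0) {e f : E} {A B : List E}
    (h : cycleList σ e = A ++ f :: B) :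
    Θ (FreeGroup.mk ((A ++ [f]).map x)) (FreeGroup.mk (B.map x)) = arcs Θ x σ e (σ f) := by
  have hc := cycleList_chain (σ := σ) (e := e)
  rw [h] at hc
  cases B with
  | nil =>
    rw [List.append_assoc, List.singleton_append, List.isChain_split, List.isChain_cons_cons] at hc
    rw [hc.2.1, arcs, if_pos rfl, List.map_nil, ← FreeGroup.one_eq_mk, h₂]
  | cons f' B =>
    have : σ f = f' := by
      rw [List.append_assoc, List.cons_append, List.isChain_split, List.cons_append,
        List.isChain_cons_cons] at hc
      exact hc.2.1
    subst this
    exact arcs_eq h₁ (by rw [h]; simp)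

/-- Along a curve, `cutSum` collects the ways to cut the curve once more. -/
theorem cutSum_hol [Fintype E] [DecidableEq E] (s : Letter n → ℤ)
    {Θ : FreeGroup (Fin n) → FreeGroup (Fin n) → M} (h₁ : ∀ g, Θ 1 g = 0) (h₂ : ∀ g, Θ g 1 = 0)
    (e : E) :
    cutSum s Θ (hol x σ e) =
      ∑ f ∈ cyc σ e, (s (x f) - s (bar (x (σ⁻¹ f)))) • arcs Θ x σ e f := by
  have e1 : ∑ f ∈ cyc σ e, (s (x f) - s (bar (x (σ⁻¹ f)))) • arcs Θ x σ e f =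
      ∑ f ∈ cyc σ e, (s (x f) • arcs Θ x σ e f - s (bar (x f)) • arcs Θ x σ e (σ f)) := by
    simp only [sub_smul]
    rw [Finset.sum_sub_distrib, Finset.sum_sub_distrib,
      ← sum_cyc_apply σ e (fun f => s (bar (x (σ⁻¹ f))) • arcs Θ x σ e f)]
    simp
  rw [e1, sum_cyc, hol, cutSum_mk]
  have key (B : List E) : ∀ A : List E, cycleList σ e = A ++ B →
      walkSum (fun g z => (z.1 * g, g⁻¹ * z.2))
        (fun x z => s x • Θ z.1 z.2 - s (bar x) • Θ (z.1 * FreeGroup.mk [x])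
            ((FreeGroup.mk [x])⁻¹ * z.2))
        (FreeGroup.mk (A.map x), FreeGroup.mk (B.map x)) (B.map x) =
      (B.map fun f => s (x f) • arcs Θ x σ e f - s (bar (x f)) • arcs Θ x σ e (σ f)).sum := by
    induction B with
    | nil => intro A _; rfl
    | cons f B ih =>
      intro A h
      have h3 := ih (A ++ [f]) (by rw [h]; simp)
      have e2 : FreeGroup.mk (A.map x) * FreeGroup.mk [x f] = FreeGroup.mk ((A ++ [f]).map x) := by
        rw [FreeGroup.mul_mk]; simp
      have e3 : (FreeGroup.mk [x f])⁻¹ * FreeGroup.mk ((f :: B).map x) =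
          FreeGroup.mk (B.map x) := by
        rw [List.map_cons, mk_cons (x f) (B.map x), inv_mul_cancel_left]
      rw [List.map_cons (f := fun f => s (x f) • arcs Θ x σ e f - s (bar (x f)) • arcs Θ x σ e
          (σ f)),
        List.sum_cons, ← h3, ← arcs_eq h₁ h, ← arcs_apply_eq h₁ h₂ h]
      conv_lhs => rw [List.map_cons, walkSum, ← List.map_cons]
      dsimp only
      rw [e2, e3]
  exact key _ [] rfl

end Holonomy

/-! ### Separating the passages at equal letters -/

section Separate
open Equiv Equiv.Perm
variable {n : ℕ} {E : Type*}

/-- Different end points at the same letter are separated by a second coordinate. The order of the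
edges at the inverse letter is reversed, so that parallel edges do not cross. -/
def side (o : List (Letter n)) (l : Letter n) (k : ℤ) : ℕ ×ₗ ℤ :=
  toLex (place o l, if l.2 then k else -k)

/-- The number of an edge. -/
noncomputable def key [Fintype E] (e : E) : ℤ := (Fintype.equivFin E e : ℕ)

theorem key_injective [Fintype E] : Function.Injective (key (E := E)) := fun e f h => by
  simpa [key, Fin.val_inj] using h

/-- The end point of an edge at the inverse of its letter: this is where the next passage starts. -/
noncomputable def inPoint [Fintype E] (o : List (Letter n)) (x : E → Letter n) (e : E) : ℕ ×ₗ ℤ :=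
  side o (bar (x e)) (key e)

/-- The end point of an edge at its letter: this is where the passage in front of the edge ends. -/
noncomputable def outPoint [Fintype E] (o : List (Letter n)) (x : E → Letter n) (e : E) : ℕ ×ₗ ℤ :=
  side o (x e) (key e)

theorem side_injective {o : List (Letter n)} (hm : ∀ x, x ∈ o) {l l' : Letter n} {k k' : ℤ}
    (h : side o l k = side o l' k') : l = l' ∧ k = k' := by
  have h : (place o l, if l.2 then k else -k) = (place o l', if l'.2 then k' else -k') :=
    toLex.injective h
  rw [Prod.mk.injEq] at h
  obtain rfl := place_injective hm h.1
  have h2 := h.2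
  refine ⟨rfl, ?_⟩
  split_ifs at h2 <;> omega

/-- Separating the ends of edges with equal letters brings any family of curves into general
position. -/
theorem generic_inPoint_outPoint [Fintype E] {o : List (Letter n)} (hm : ∀ x, x ∈ o)
    (x : E → Letter n) :
    Generic (inPoint o x) (outPoint o x) where
  inn_injective e f h := key_injective (side_injective hm h).2
  out_injective e f h := key_injective (side_injective hm h).2
  inn_ne_out e f h := by
    obtain ⟨h1, h2⟩ := side_injective hm h
    obtain rfl := key_injective h2
    exact bar_ne _ h1

theorem sgn_side_of_ne {o : List (Letter n)} (hm : ∀ x, x ∈ o) {l l' : Letter n} (h : l ≠ l')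
    (k k' : ℤ) : sgn (side o l k) (side o l' k') = sgn (place o l) (place o l') := by
  have h := (place_injective hm).ne h
  simp [sgn, side, Prod.Lex.toLex_lt_toLex, h, h.symm]

/-- The ends of edges with equal letters are ordered by the keys at one side of the generator and in
the reverse order at the other side, so that the parallel edges do not cross. -/
theorem sgn_side_self (o : List (Letter n)) (l : Letter n) (k k' : ℤ) :
    sgn (side o l k) (side o l k') = if l.2 then sgn k k' else -sgn k k' := by
  by_cases h : l.2
  · simp [sgn, side, Prod.Lex.toLex_lt_toLex, h]
  · rw [if_neg h, ← sgn_swap]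
    simp [sgn, side, Prod.Lex.toLex_lt_toLex, h]

/-- The effect of the separation on the sign of a pair of ends. -/
noncomputable def defect (o : List (Letter n)) (l l' : Letter n) (k k' : ℤ) : ℤ :=
  sgn (side o l k) (side o l' k') - sgn (place o l) (place o l')

theorem defect_of_ne {o : List (Letter n)} (hm : ∀ x, x ∈ o) {l l' : Letter n} (h : l ≠ l')
    (k k' : ℤ) : defect o l l' k k' = 0 := by
  rw [defect, sgn_side_of_ne hm h, sub_self]

/-- Parallel edges are separated in opposite order at their two sides. -/
theorem defect_bar {o : List (Letter n)} (hm : ∀ x, x ∈ o) (l l' : Letter n) (k k' : ℤ) :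
    defect o (bar l) (bar l') k k' = -defect o l l' k k' := by
  by_cases h : l = l'
  · subst h
    rw [defect, defect, sgn_side_self, sgn_side_self, sgn_self, sgn_self]
    cases h : l.2 <;> simp [bar, h]
  · rw [defect_of_ne hm h, defect_of_ne hm (bar_injective.ne h), neg_zero]

/-- Twice the crossing number of two passages that enter at `x̅` and `y̅` and leave at `x'` and
`y'`, where a common end point counts as one half of a crossing. -/
def halfCross (o : List (Letter n)) (x x' y y' : Letter n) : ℤ :=
  twiceCross (place o (bar x)) (place o x') (place o (bar y)) (place o y')

variable {M : Type*} [AddCommGroup M]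

/-- Smoothing functions that do not distinguish the crossings along a strip of parallel edges do not
see how the edges have been separated. -/
theorem sum_eps_eq_sum_halfCross [Fintype E] {o : List (Letter n)} (hm : ∀ x, x ∈ o)
    (x : E → Letter n) (σ : Perm E) (a b : E) (H : E → E → M)
    (h₀ : ∀ e f, σ.SameCycle a e → σ.SameCycle b f → e = f → H e f = 0)
    (h₁ : ∀ e f, σ.SameCycle a e → σ.SameCycle b f → x e = x f → H e f = H (σ e) (σ f))
    (h₂ : ∀ e f, σ.SameCycle a e → σ.SameCycle b f → x e = bar (x f) →
      H (σ e) f = H e (σ f)) :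
    (2 : ℤ) • ∑ e ∈ cyc σ a, ∑ f ∈ cyc σ b, eps (inPoint o x) (outPoint o x) σ e f • H e f =
      ∑ e ∈ cyc σ a, ∑ f ∈ cyc σ b,
        halfCross o (x (σ⁻¹ e)) (x e) (x (σ⁻¹ f)) (x f) • H e f := by
  -- The separation moves the sign of a crossing by the defects `P` at the two ends of parallel
  -- edges and `N` at the two ends of antiparallel edges; these telescope along the curves.
  set P : E → E → ℤ := fun e f => defect o (x e) (x f) (key e) (key f) with hP
  set N : E → E → ℤ := fun e f => defect o (bar (x f)) (x e) (key f) (key e) with hN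
  have e1 (e f : E) (hef : e ≠ f) : 2 * eps (inPoint o x) (outPoint o x) σ e f =
      halfCross o (x (σ⁻¹ e)) (x e) (x (σ⁻¹ f)) (x f) + (P e f - P (σ⁻¹ e) (σ⁻¹ f)) +
        (N e (σ⁻¹ f) - N (σ⁻¹ e) f) := by
    have d1 := defect_bar hm (x (σ⁻¹ e)) (x (σ⁻¹ f)) (key (σ⁻¹ e)) (key (σ⁻¹ f))
    have d2 := defect_bar hm (bar (x f)) (x (σ⁻¹ e)) (key f) (key (σ⁻¹ e))
    rw [bar_bar] at d2
    rw [(generic_inPoint_outPoint hm x).two_mul_eps σ hef]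
    simp only [hP, hN]
    rw [eq_neg_iff_add_eq_zero] at d1 d2
    have d3 : defect o (bar (x (σ⁻¹ e))) (bar (x (σ⁻¹ f))) (key (σ⁻¹ e)) (key (σ⁻¹ f)) =
      sgn (inPoint o x (σ⁻¹ e)) (inPoint o x (σ⁻¹ f)) - sgn (place o (bar (x (σ⁻¹ e))))
          (place o (bar (x (σ⁻¹ f)))) := rfl
    have d4 : defect o (bar (x (σ⁻¹ f))) (x e) (key (σ⁻¹ f)) (key e) =
      sgn (inPoint o x (σ⁻¹ f)) (outPoint o x e) -
        sgn (place o (bar (x (σ⁻¹ f)))) (place o (x e)) := rfl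
    have d5 : defect o (x e) (x f) (key e) (key f) =
      sgn (outPoint o x e) (outPoint o x f) - sgn (place o (x e)) (place o (x f)) := rfl
    have d6 : defect o (x f) (bar (x (σ⁻¹ e))) (key f) (key (σ⁻¹ e)) =
      sgn (outPoint o x f) (inPoint o x (σ⁻¹ e)) -
        sgn (place o (x f)) (place o (bar (x (σ⁻¹ e)))) := rfl
    unfold halfCross twiceCross
    linarith
  have e2 : (2 : ℤ) • ∑ e ∈ cyc σ a, ∑ f ∈ cyc σ b,
      eps (inPoint o x) (outPoint o x) σ e f • H e f =
      ∑ e ∈ cyc σ a, ∑ f ∈ cyc σ b,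
        (halfCross o (x (σ⁻¹ e)) (x e) (x (σ⁻¹ f)) (x f) + (P e f - P (σ⁻¹ e) (σ⁻¹ f)) +
        (N e (σ⁻¹ f) - N (σ⁻¹ e) f)) • H e f := by
    simp only [Finset.smul_sum, smul_smul]
    refine Finset.sum_congr rfl fun e he => Finset.sum_congr rfl fun f hf => ?_
    by_cases hef : e = f
    · rw [h₀ e f (mem_cyc.1 he) (mem_cyc.1 hf) hef, smul_zero, smul_zero]
    · rw [e1 e f hef]
  have hs (e : E) : σ⁻¹ (σ e) = e := by simp
  have s1 : ∑ e ∈ cyc σ a, ∑ f ∈ cyc σ b, P (σ⁻¹ e) (σ⁻¹ f) • H e f =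
      ∑ e ∈ cyc σ a, ∑ f ∈ cyc σ b, P e f • H e f := by
    rw [← sum_cyc_apply]
    refine Finset.sum_congr rfl fun e he => ?_
    rw [← sum_cyc_apply]
    refine Finset.sum_congr rfl fun f hf => ?_
    rw [hs, hs]
    by_cases hx : x e = x f
    · rw [h₁ e f (mem_cyc.1 he) (mem_cyc.1 hf) hx]
    · simp only [hP, defect_of_ne hm hx, zero_smul]
  have s2 : ∑ e ∈ cyc σ a, ∑ f ∈ cyc σ b, N (σ⁻¹ e) f • H e f =
      ∑ e ∈ cyc σ a, ∑ f ∈ cyc σ b, N e (σ⁻¹ f) • H e f := by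
    rw [← sum_cyc_apply]
    refine Finset.sum_congr rfl fun e he => ?_
    rw [← sum_cyc_apply σ b (fun f => N e (σ⁻¹ f) • H e f)]
    refine Finset.sum_congr rfl fun f hf => ?_
    rw [hs, hs]
    by_cases hx : x e = bar (x f)
    · rw [h₂ e f (mem_cyc.1 he) (mem_cyc.1 hf) hx]
    · simp only [hN, defect_of_ne hm (Ne.symm hx), zero_smul]
  rw [e2]
  simp only [add_smul, sub_smul, Finset.sum_add_distrib, Finset.sum_sub_distrib, s1, s2]
  simp

end Separate

/-! ### Bracket and cobracket of conjugacy classes -/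

section Formal
open Equiv Equiv.Perm
variable {n : ℕ} {E : Type*}

/-- The bracket of two conjugacy classes, up to a factor two, as a formal sum of cyclic words. -/
noncomputable def formalBracket (o : List (Letter n)) (g h : FreeGroup (Fin n)) :
    Cycle (Letter n) →₀ ℤ :=
  loopSum (fun p g => loopSum (fun q h =>
    sgn (place o p) (place o q) • Finsupp.single (cycleOf (g * h)) (1 : ℤ)) h) g

open Classical in
/-- The formal pair of the cyclic words of two group elements, and `0` if one of them is trivial. -/
noncomputable def classPair (g h : FreeGroup (Fin n)) :
    (Cycle (Letter n) × Cycle (Letter n)) →₀ ℤ :=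
  if g = 1 ∨ h = 1 then 0 else Finsupp.single (cycleOf g, cycleOf h) 1

/-- The cobracket of a conjugacy class, up to a factor two, as a formal sum of pairs of cyclic
words. -/
noncomputable def formalCobracket (o : List (Letter n)) (g : FreeGroup (Fin n)) :
    (Cycle (Letter n) × Cycle (Letter n)) →₀ ℤ :=
  loopSum (fun p g => cutSum (fun q => sgn (place o p) (place o q)) classPair g) g

theorem classPair_conj (c d g h : FreeGroup (Fin n)) :
    classPair (c * g * c⁻¹) (d * h * d⁻¹) = classPair g h := by
  simp only [classPair, conj_eq_one_iff, cycleOf_conj]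

theorem formalBracket_conj (o : List (Letter n)) (c d g h : FreeGroup (Fin n)) :
    formalBracket o (c * g * c⁻¹) (d * h * d⁻¹) = formalBracket o g h := by
  simp only [formalBracket, loopSum_conj]

theorem formalCobracket_conj (o : List (Letter n)) (c g : FreeGroup (Fin n)) :
    formalCobracket o (c * g * c⁻¹) = formalCobracket o g := by
  simp only [formalCobracket, loopSum_conj]

theorem formalBracket_one_left (o : List (Letter n)) (h : FreeGroup (Fin n)) :
    formalBracket o 1 h = 0 := loopSum_one _

theorem formalBracket_one_right (o : List (Letter n)) (g : FreeGroup (Fin n)) :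
    formalBracket o g 1 = 0 := by
  simp only [formalBracket, loopSum_one]
  simp only [loopSum]
  generalize g.toWord = l
  generalize g = z
  induction l generalizing z with
  | nil => rfl
  | cons x l ih => rw [walkSum, ih]; simp

theorem formalCobracket_one (o : List (Letter n)) :
    formalCobracket (n := n) o 1 = 0 := loopSum_one _

/-- The formal bracket of two curves is the sum over their half crossings. -/
theorem formalBracket_hol [Fintype E] {F : Type*} [Fintype F] (o : List (Letter n))
    (x : E → Letter n) (σ : Perm E) (a : E) (y : F → Letter n) (τ : Perm F) (b : F) :
    formalBracket o (hol x σ a) (hol y τ b) = ∑ e ∈ cyc σ a, ∑ f ∈ cyc τ b,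
      halfCross o (x (σ⁻¹ e)) (x e) (y (τ⁻¹ f)) (y f) •
        Finsupp.single (cycleOf (hol x σ e * hol y τ f)) (1 : ℤ) := by
  rw [formalBracket, loopSum_hol]
  refine Finset.sum_congr rfl fun e _ => ?_
  rw [loopSum_hol, loopSum_hol, ← Finset.sum_sub_distrib]
  refine Finset.sum_congr rfl fun f _ => ?_
  rw [← sub_smul, ← sub_smul, ← sub_smul]
  congr 1
  unfold halfCross twiceCross
  rw [sgn_swap (place o (bar (y (τ⁻¹ f)))), sgn_swap (place o (y f)) (place o (bar (x (σ⁻¹ e))))]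
  ring

/-- The formal cobracket of a curve is the sum over its half self-crossings. -/
theorem formalCobracket_hol [Fintype E] [DecidableEq E] (o : List (Letter n)) (x : E → Letter n)
    (σ : Perm E) (a : E) :
    formalCobracket o (hol x σ a) = ∑ e ∈ cyc σ a, ∑ f ∈ cyc σ a,
      halfCross o (x (σ⁻¹ e)) (x e) (x (σ⁻¹ f)) (x f) • arcs classPair x σ e f := by
  rw [formalCobracket, loopSum_hol]
  refine Finset.sum_congr rfl fun e he => ?_
  have h₁ (g : FreeGroup (Fin n)) : classPair 1 g = 0 := by simp [classPair]
  have h₂ (g : FreeGroup (Fin n)) : classPair g 1 = 0 := by simp [classPair]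
  rw [cutSum_hol _ h₁ h₂, cutSum_hol _ h₁ h₂, ← cyc_eq_of_mem (mem_cyc.1 he),
    ← Finset.sum_sub_distrib]
  refine Finset.sum_congr rfl fun f _ => ?_
  rw [← sub_smul]
  congr 1
  unfold halfCross twiceCross
  rw [sgn_swap (place o (bar (x (σ⁻¹ f)))), sgn_swap (place o (x f)) (place o (bar (x (σ⁻¹ e))))]
  ring

/-- The joined curves at the two ends of a parallel edge are conjugate. -/
theorem single_mul_parallel [Fintype E] {F : Type*} [Fintype F] (x : E → Letter n) (σ : Perm E)
    (y : F → Letter n) (τ : Perm F) {e : E} {f : F} (h : x e = y f) :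
    cycleOf (hol x σ e * hol y τ f) = cycleOf (hol x σ (σ e) * hol y τ (τ f)) := by
  rw [hol_apply, hol_apply, ← h, ← cycleOf_conj (FreeGroup.mk [x e])⁻¹]
  congr 1
  simp only [rot]
  group

/-- The joined curves at the two ends of an antiparallel edge are conjugate. -/
theorem single_mul_antiparallel [Fintype E] {F : Type*} [Fintype F] (x : E → Letter n) (σ : Perm E)
    (y : F → Letter n) (τ : Perm F) {e : E} {f : F} (h : x e = bar (y f)) :
    cycleOf (hol x σ (σ e) * hol y τ f) = cycleOf (hol x σ e * hol y τ (τ f)) := by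
  have h' : FreeGroup.mk [y f] = (FreeGroup.mk [x e])⁻¹ := by rw [h, mk_bar, inv_inv]
  rw [hol_apply, hol_apply, h', ← cycleOf_conj (FreeGroup.mk [x e])]
  congr 1
  simp only [rot]
  group

/-- The two arcs are the same up to conjugation whether one cuts before or after a parallel edge. -/
theorem arcs_parallel [Fintype E] [DecidableEq E] (x : E → Letter n) (σ : Perm E) {e f : E}
    (hσ : σ.SameCycle e f) (h : x e = x f) :
    arcs classPair x σ e f = arcs classPair x σ (σ e) (σ f) := by
  by_cases hef : e = f
  · subst hef; simp [arcs]
  have h₁ (g : FreeGroup (Fin n)) : classPair 1 g = 0 := by simp [classPair]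
  have h₂ (g : FreeGroup (Fin n)) : classPair g 1 = 0 := by simp [classPair]
  obtain ⟨A, B, hAB⟩ := exists_cycleList_split hσ hef
  have hAB' : cycleList σ (σ e) = A ++ f :: (B ++ [e]) := by
    rw [cycleList_apply, hAB]; simp
  rw [← arcs_eq h₁ hAB, ← arcs_apply_eq h₁ h₂ hAB', ← classPair_conj (FreeGroup.mk [x e])⁻¹
    (FreeGroup.mk [x f])⁻¹]
  simp only [List.map_append, List.map_cons, List.map_nil]
  rw [mk_cons (x e) (A.map x), mk_cons (x f) (B.map x), ← FreeGroup.mul_mk, ← FreeGroup.mul_mk, h]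
  all_goals (congr 1; group)

/-- The two arcs are the same up to conjugation at both ends of an antiparallel edge. -/
theorem arcs_antiparallel [Fintype E] [DecidableEq E] (x : E → Letter n) (σ : Perm E) {e f : E}
    (hσ : σ.SameCycle e f) (h : x e = bar (x f)) :
    arcs classPair x σ (σ e) f = arcs classPair x σ e (σ f) := by
  have hef : e ≠ f := by
    rintro rfl; exact bar_ne _ h.symm
  have h₁ (g : FreeGroup (Fin n)) : classPair 1 g = 0 := by simp [classPair]
  have h₂ (g : FreeGroup (Fin n)) : classPair g 1 = 0 := by simp [classPair]
  obtain ⟨A, B, hAB⟩ := exists_cycleList_split hσ hef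
  have hAB' : cycleList σ (σ e) = A ++ f :: (B ++ [e]) := by
    rw [cycleList_apply, hAB]; simp
  have h' : FreeGroup.mk [x f] = (FreeGroup.mk [x e])⁻¹ := by rw [h, mk_bar, inv_inv]
  rw [← arcs_eq h₁ hAB', ← arcs_apply_eq h₁ h₂ hAB, ← classPair_conj (FreeGroup.mk [x e])
    (FreeGroup.mk [x e])]
  simp only [List.map_append, List.map_cons, List.map_nil, List.cons_append]
  rw [mk_cons (x e) (A.map x ++ [x f]), mk_cons (x f) (B.map x ++ [x e]), ← FreeGroup.mul_mk,
    ← FreeGroup.mul_mk, h']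
  all_goals (congr 1; group)

/-- The sum over the crossings of two curves in general position depends only on the conjugacy
classes of the curves. -/
theorem two_smul_sum_eps_join [Fintype E] [DecidableEq E] {o : List (Letter n)} (hm : ∀ x, x ∈ o)
    (x : E → Letter n) {σ : Perm E} {a b : E} (hab : ¬σ.SameCycle a b) :
    (2 : ℤ) • ∑ e ∈ cyc σ a, ∑ f ∈ cyc σ b, eps (inPoint o x) (outPoint o x) σ e f •
      Finsupp.single (cycleOf (hol x (swap e f * σ) e)) (1 : ℤ) =
      formalBracket o (hol x σ a) (hol x σ b) := by
  rw [formalBracket_hol, ← sum_eps_eq_sum_halfCross hm x σ a b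
    (fun e f => Finsupp.single (cycleOf (hol x σ e * hol x σ f)) (1 : ℤ))]
  · congr 1
    refine Finset.sum_congr rfl fun e he => Finset.sum_congr rfl fun f hf => ?_
    have hef : ¬σ.SameCycle e f := fun h =>
      hab ((mem_cyc.1 he).trans (h.trans (mem_cyc.1 hf).symm))
    rw [hol, hol, hol, cycleList_swap_of_not_sameCycle hef, FreeGroup.mul_mk, List.map_append]
  · rintro e f he hf rfl
    exact absurd (he.trans hf.symm) hab
  · intro e f _ _ h
    rw [single_mul_parallel x σ x σ h]
  · intro e f _ _ h
    rw [single_mul_antiparallel x σ x σ h]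

/-- The sum over the self-crossings of a curve in general position depends only on the conjugacy
class of the curve. -/
theorem two_smul_sum_eps_cut [Fintype E] [DecidableEq E] {o : List (Letter n)} (hm : ∀ x, x ∈ o)
    (x : E → Letter n) (σ : Perm E) (a : E) :
    (2 : ℤ) • ∑ e ∈ cyc σ a, ∑ f ∈ cyc σ a, eps (inPoint o x) (outPoint o x) σ e f •
      arcs classPair x σ e f = formalCobracket o (hol x σ a) := by
  rw [formalCobracket_hol, sum_eps_eq_sum_halfCross hm x σ a a]
  · rintro e f - - rfl
    simp [arcs]
  · intro e f he hf h
    exact arcs_parallel x σ (he.symm.trans hf) h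
  · intro e f he hf h
    exact arcs_antiparallel x σ (he.symm.trans hf) h

end Formal

/-! ### Strips of parallel edges -/

section Strip
open Equiv Equiv.Perm
variable {n : ℕ} {E F : Type*}
variable {M : Type*} [AddCommGroup M] {X : Type*}

/-- Two curves run parallel along exactly `m` edges, starting with `e` and `f`. -/
def Strip (σ : Perm E) (τ : Perm F) (x : E → X) (y : F → X) (m : ℕ) (e : E) (f : F) : Prop :=
  0 < m ∧ x (σ⁻¹ e) ≠ y (τ⁻¹ f) ∧ (∀ i < m, x ((σ ^ i) e) = y ((τ ^ i) f)) ∧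
    x ((σ ^ m) e) ≠ y ((τ ^ m) f)

/-- A sum over the length of an initial segment that is ended by `p` has one term. -/
theorem sum_range_first (p : ℕ → Prop) {N : ℕ} (h : ∃ i < N, p i) (c : M) :
    open Classical in
    ∑ m ∈ Finset.range N, (if p m ∧ ∀ i < m, ¬p i then c else 0) = c := by
  classical
  obtain ⟨i, hi, hp⟩ := h
  have hex : ∃ i, p i := ⟨i, hp⟩
  rw [Finset.sum_eq_single (Nat.find hex)]
  · rw [if_pos ⟨Nat.find_spec hex, fun i hi => Nat.find_min hex hi⟩]
  · intro m _ hm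
    rw [if_neg]
    rintro ⟨h1, h2⟩
    exact hm ((Nat.find_eq_iff hex).2 ⟨h1, h2⟩).symm
  · intro h'
    exact absurd (Finset.mem_range.2 ((Nat.find_le hp).trans_lt hi)) h'

open Classical in
/-- A passage at which two curves begin to run parallel is the start of exactly one strip. The
common period `N` bounds its length: just before its start, the edges differ. -/
theorem sum_start (σ : Perm E) (τ : Perm F) (x : E → X) (y : F → X) {N : ℕ} (hN : 0 < N)
    (hσ : σ ^ N = 1) (hτ : τ ^ N = 1) (e : E) (f : F) (c : M) :
    (if x e = y f ∧ x (σ⁻¹ e) ≠ y (τ⁻¹ f) then c else 0) =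
      ∑ m ∈ Finset.range N, if Strip σ τ x y m e f then c else 0 := by
  by_cases h : x e = y f ∧ x (σ⁻¹ e) ≠ y (τ⁻¹ f)
  · rw [if_pos h]
    refine (sum_range_first (fun m => x ((σ ^ m) e) ≠ y ((τ ^ m) f)) (N := N) ?_ c).symm.trans ?_
    rotate_left
    · refine Finset.sum_congr rfl fun m _ => ?_
      have h' : (x ((σ ^ m) e) ≠ y ((τ ^ m) f) ∧ ∀ i < m, ¬x ((σ ^ i) e) ≠ y ((τ ^ i) f)) ↔
          Strip σ τ x y m e f := ?_
      · by_cases hS : Strip σ τ x y m e f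
        · rw [if_pos hS, if_pos (h'.2 hS)]
        · rw [if_neg hS, if_neg (fun h => hS (h'.1 h))]
      constructor
      · rintro ⟨h1, h2⟩
        simp only [ne_eq, not_not] at h2
        refine ⟨Nat.pos_of_ne_zero ?_, h.2, h2, h1⟩
        rintro rfl
        exact h1 (by simpa using h.1)
      · rintro ⟨-, -, h1, h2⟩
        exact ⟨h2, fun i hi => not_not.2 (h1 i hi)⟩
    -- By periodicity, `N - 1` steps forward are one step backward.
    · refine ⟨N - 1, by omega, ?_⟩
      have e1 : σ ^ (N - 1) = σ⁻¹ := by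
        rw [eq_inv_iff_mul_eq_one, ← pow_succ, Nat.sub_add_cancel hN, hσ]
      have e2 : τ ^ (N - 1) = τ⁻¹ := by
        rw [eq_inv_iff_mul_eq_one, ← pow_succ, Nat.sub_add_cancel hN, hτ]
      rw [e1, e2]
      exact h.2
  · rw [if_neg h, Finset.sum_eq_zero]
    rintro m -
    rw [if_neg]
    rintro ⟨h1, h2, h3, -⟩
    exact h ⟨by simpa using h3 0 h1, h2⟩

theorem inv_inv_apply (ρ : Perm E) (g : E) : ρ⁻¹ (ρ⁻¹⁻¹ g) = g := by simp

theorem inv_pow_apply_pow_apply (ρ : Perm E) (m : ℕ) (g : E) : (ρ⁻¹ ^ m) ((ρ ^ m) g) = g := by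
  rw [← Perm.mul_apply, inv_pow, inv_mul_cancel, Perm.one_apply]

theorem inv_apply_inv_pow_apply_pow_apply (ρ : Perm E) {m i : ℕ} (g : E) (hi : i < m) :
    ρ⁻¹ ((ρ⁻¹ ^ i) ((ρ ^ m) g)) = (ρ ^ (m - 1 - i)) g := by
  obtain ⟨k, rfl⟩ : ∃ k, m = k + 1 + i := ⟨m - 1 - i, by omega⟩
  rw [show k + 1 + i - 1 - i = k by omega, ← Perm.mul_apply, ← Perm.mul_apply]
  congr 1
  rw [inv_pow]
  group

theorem inv_apply_pow_apply (ρ : Perm E) {m : ℕ} (hm : 0 < m) (g : E) :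
    ρ⁻¹ ((ρ ^ m) g) = (ρ ^ (m - 1)) g := by
  simpa using inv_apply_inv_pow_apply_pow_apply ρ g hm

/-- A strip, read backwards from its end. -/
theorem strip_inv_iff (σ : Perm E) (τ : Perm F) (x : E → X) (y : F → X) (m : ℕ) (e : E) (f : F) :
    Strip σ⁻¹ τ⁻¹ (fun e => x (σ⁻¹ e)) (fun f => y (τ⁻¹ f)) m ((σ ^ m) e) ((τ ^ m) f) ↔
      Strip σ τ x y m e f := by
  simp only [Strip, inv_inv_apply, inv_pow_apply_pow_apply]
  constructor
  · rintro ⟨h1, h2, h3, h4⟩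
    refine ⟨h1, h4, fun i hi => ?_, h2⟩
    have := h3 (m - 1 - i) (by omega)
    rwa [inv_apply_inv_pow_apply_pow_apply σ e (by omega),
      inv_apply_inv_pow_apply_pow_apply τ f (by omega), show m - 1 - (m - 1 - i) = i by omega]
      at this
  · rintro ⟨h1, h2, h3, h4⟩
    refine ⟨h1, h4, fun i hi => ?_, h2⟩
    rw [inv_apply_inv_pow_apply_pow_apply σ e hi, inv_apply_inv_pow_apply_pow_apply τ f hi]
    exact h3 _ (by omega)

open Classical in
/-- The version of `sum_start` for the last edge: a strip is traversed backwards by the inverse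
permutations. -/
theorem sum_end [Fintype E] [Fintype F] (σ : Perm E) (τ : Perm F) (x : E → X) (y : F → X) {N : ℕ}
    (hN : 0 < N) (hσ : σ ^ N = 1) (hτ : τ ^ N = 1) (c : E → F → M) :
    (∑ e, ∑ f, if x e ≠ y f ∧ x (σ⁻¹ e) = y (τ⁻¹ f) then c e f else 0) =
      ∑ e, ∑ f, ∑ m ∈ Finset.range N,
        if Strip σ τ x y m e f then c ((σ ^ m) e) ((τ ^ m) f) else 0 := by
  have e1 (e : E) (f : F) : (if x e ≠ y f ∧ x (σ⁻¹ e) = y (τ⁻¹ f) then c e f else 0) =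
      ∑ m ∈ Finset.range N, if Strip σ⁻¹ τ⁻¹ (fun e => x (σ⁻¹ e)) (fun f => y (τ⁻¹ f)) m e f then
        c e f else 0 := by
    rw [← sum_start σ⁻¹ τ⁻¹ (fun e => x (σ⁻¹ e)) (fun f => y (τ⁻¹ f)) hN
        (by rw [inv_pow, hσ, inv_one])
      (by rw [inv_pow, hτ, inv_one]), inv_inv_apply, inv_inv_apply]
    exact if_congr and_comm rfl rfl
  have sw (G : E → F → ℕ → M) : ∑ e, ∑ f, ∑ m ∈ Finset.range N, G e f m =
      ∑ m ∈ Finset.range N, ∑ e, ∑ f, G e f m := by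
    rw [Finset.sum_comm]
    rw [Finset.sum_congr rfl fun f _ => Finset.sum_comm, Finset.sum_comm]
    exact Finset.sum_congr rfl fun m _ => Finset.sum_comm
  simp only [e1]
  rw [sw, sw]
  refine Finset.sum_congr rfl fun m _ => ?_
  rw [← Equiv.sum_comp (σ ^ m)]
  refine Finset.sum_congr rfl fun e _ => ?_
  rw [← Equiv.sum_comp (τ ^ m)]
  refine Finset.sum_congr rfl fun f _ => ?_
  exact if_congr (strip_inv_iff σ τ x y m e f) rfl rfl

open Classical in
/-- Two ends of a strip contribute half a crossing each: the contributions add up if the curves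
cross along the strip, and they cancel otherwise. -/
theorem sum_start_add_sum_end [Fintype E] [Fintype F] (σ : Perm E) (τ : Perm F) (x : E → X)
    (y : F → X) {N : ℕ} (hN : 0 < N) (hσ : σ ^ N = 1) (hτ : τ ^ N = 1) (s t : E → F → ℤ)
    (H : E → F → M) (hH : ∀ e f, x e = y f → H e f = H (σ e) (τ f))
    (hs : ∀ e f, x e = y f → x (σ⁻¹ e) ≠ y (τ⁻¹ f) → s e f = 1 ∨ s e f = -1)
    (ht : ∀ e f, x e ≠ y f → x (σ⁻¹ e) = y (τ⁻¹ f) → t e f = 1 ∨ t e f = -1) :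
    (∑ e, ∑ f, if x e = y f ∧ x (σ⁻¹ e) ≠ y (τ⁻¹ f) then s e f • H e f else 0) +
      (∑ e, ∑ f, if x e ≠ y f ∧ x (σ⁻¹ e) = y (τ⁻¹ f) then t e f • H e f else 0) =
    (2 : ℤ) • ∑ e, ∑ f, ∑ m ∈ Finset.range N,
      if Strip σ τ x y m e f ∧ s e f = t ((σ ^ m) e) ((τ ^ m) f) then
        s e f • H ((σ ^ m) e) ((τ ^ m) f) else 0 := by
  rw [sum_end σ τ x y hN hσ hτ]
  simp only [sum_start σ τ x y hN hσ hτ, ← Finset.sum_add_distrib, Finset.smul_sum]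
  refine Finset.sum_congr rfl fun e _ => Finset.sum_congr rfl fun f _ =>
    Finset.sum_congr rfl fun m _ => ?_
  by_cases hm : Strip σ τ x y m e f
  · have hH' (i : ℕ) (hi : i ≤ m) : H e f = H ((σ ^ i) e) ((τ ^ i) f) := by
      induction i with
      | zero => rfl
      | succ i ih =>
        rw [ih (by omega), hH _ _ (hm.2.2.1 i hi), pow_succ', pow_succ', Perm.mul_apply,
          Perm.mul_apply]
    have h1 := hs e f (by simpa using hm.2.2.1 0 hm.1) hm.2.1
    have h2 := ht ((σ ^ m) e) ((τ ^ m) f) hm.2.2.2 (by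
      rw [inv_apply_pow_apply σ hm.1, inv_apply_pow_apply τ hm.1]
      exact hm.2.2.1 _ (by have := hm.1; omega))
    rw [if_pos hm, if_pos hm, hH' m le_rfl, ← add_smul]
    by_cases h3 : s e f = t ((σ ^ m) e) ((τ ^ m) f)
    · rw [if_pos ⟨hm, h3⟩, smul_smul, ← h3, two_mul]
    · rw [if_neg (fun h => h3 h.2), smul_zero]
      have : s e f + t ((σ ^ m) e) ((τ ^ m) f) = 0 := by omega
      rw [this, zero_smul]
  · rw [if_neg hm, if_neg hm, if_neg (fun h => hm h.1)]
    simp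

theorem orient_triple_eq_or {o : List (Letter n)} (ho : o.Nodup) (hm : ∀ x, x ∈ o)
    {a b c : Letter n} (hab : a ≠ b) (hbc : b ≠ c) (hca : c ≠ a) :
    orient o (([a, b, c] : List (Letter n)) : Cycle (Letter n)) = 1 ∨
      orient o (([a, b, c] : List (Letter n)) : Cycle (Letter n)) = -1 := by
  have h := orient_triple ho hm a b c
  have h1 := sgn_eq_or ((place_injective hm).ne hab)
  have h2 := sgn_eq_or ((place_injective hm).ne hbc)
  have h3 := sgn_eq_or ((place_injective hm).ne hca)
  have h4 : orient o (([a, b, c] : List (Letter n)) : Cycle (Letter n)) = 1 ∨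
      orient o (([a, b, c] : List (Letter n)) : Cycle (Letter n)) = -1 ∨
      orient o (([a, b, c] : List (Letter n)) : Cycle (Letter n)) = 0 := by
    unfold orient
    split_ifs <;> simp
  omega

open Classical in
/-- The half crossing number of two passages, by the coincidences among their four ends. -/
theorem halfCross_eq {o : List (Letter n)} (ho : o.Nodup) (hm : ∀ x, x ∈ o) {x x' y y' : Letter n}
    (hx : x' ≠ bar x) (hy : y' ≠ bar y) :
    halfCross o x x' y y' =
      2 * orient o (([bar x, bar y, x', y'] : List (Letter n)) : Cycle (Letter n)) +
      (if x' = y' ∧ x ≠ y then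
        orient o (([bar x, bar y, x'] : List (Letter n)) : Cycle (Letter n)) else 0) +
      (if x' ≠ y' ∧ x = y then
        orient o (([x', y', bar x] : List (Letter n)) : Cycle (Letter n)) else 0) +
      (if x' = bar y ∧ x ≠ bar y' then
        orient o (([y', bar x, x'] : List (Letter n)) : Cycle (Letter n)) else 0) +
      (if x' ≠ bar y ∧ x = bar y' then
        orient o (([bar y, x', bar x] : List (Letter n)) : Cycle (Letter n)) else 0) := by
  have zero (h : bar x = bar y ∨ bar y = x' ∨ x' = y' ∨ y' = bar x) :
      orient o (([bar x, bar y, x', y'] : List (Letter n)) : Cycle (Letter n)) = 0 := by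
    by_contra h'
    have := ne_of_orient_quadruple_ne_zero ho hm h'
    tauto
  simp only [orient_triple ho hm]
  unfold halfCross twiceCross
  by_cases h1 : x' = y'
  · subst h1
    rw [zero (by tauto)]
    have h2 : x' ≠ bar y := hy
    have h3 : x ≠ bar x' := fun h => hx (by rw [h, bar_bar])
    by_cases h4 : x = y
    · subst h4
      simp [h2, h3, sgn_swap (place o x') (place o (bar x))]
    · simp [h2, h3, h4]
  by_cases h2 : x = y
  · subst h2
    rw [zero (by tauto)]
    have h3 : x ≠ bar y' := fun h => hy (by rw [h, bar_bar])
    simp [h1, h3, hx]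
    ring
  by_cases h3 : x' = bar y
  · subst h3
    rw [zero (by tauto)]
    by_cases h4 : x = bar y'
    · subst h4
      simp [h1, h2, bar_bar, sgn_swap (place o y') (place o (bar y))]
    · simp [h1, h2, h4]
      ring
  by_cases h4 : x = bar y'
  · subst h4
    rw [zero (by simp [bar_bar])]
    simp [h1, h2, h3, bar_bar]
    ring
  · have h5 : y' ≠ bar x := fun h => h4 (by rw [h, bar_bar])
    rw [orient_quadruple ho hm (bar_injective.ne h2) (Ne.symm h3) h1 h5]
    simp [h1, h2, h3, h4, twiceCross]

open Classical in
/-- The sum over the half crossings of two curves is twice the sum over their crossings: the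
crossings in one point, and the crossings along strips of parallel and of antiparallel edges. -/
theorem sum_halfCross [Fintype E] [Fintype F] {o : List (Letter n)} (ho : o.Nodup) (hm : ∀ x, x ∈ o)
    (σ : Perm E) (τ : Perm F) (x : E → Letter n) (y : F → Letter n) {N : ℕ} (hN : 0 < N)
    (hσ : σ ^ N = 1) (hτ : τ ^ N = 1) (hx : ∀ e, x (σ e) ≠ bar (x e))
    (hy : ∀ f, y (τ f) ≠ bar (y f)) (H : E → F → M) (h₁ : ∀ e f, x e = y f → H e f = H (σ e) (τ f))
    (h₂ : ∀ e f, x e = bar (y f) → H (σ e) f = H e (τ f)) :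
    ∑ e : E, ∑ f : F, halfCross o (x (σ⁻¹ e)) (x e) (y (τ⁻¹ f)) (y f) • H e f =
    (2 : ℤ) • ((∑ e : E, ∑ f : F, orient (o : Cycle (Letter n))
        ([bar (x (σ⁻¹ e)), bar (y (τ⁻¹ f)), x e, y f] : List (Letter n)) • H e f) +
      (∑ e : E, ∑ f : F, ∑ m ∈ Finset.range N, if Strip σ τ x y m e f ∧
        orient (o : Cycle (Letter n)) ([bar (x (σ⁻¹ e)), bar (y (τ⁻¹ f)), x e] : List (Letter n)) =
          orient (o : Cycle (Letter n)) ([x ((σ ^ m) e), y ((τ ^ m) f), bar (x (σ⁻¹ ((σ ^ m) e)))] :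
            List (Letter n)) then
        orient (o : Cycle (Letter n)) ([bar (x (σ⁻¹ e)), bar (y (τ⁻¹ f)), x e] : List (Letter n)) •
          H ((σ ^ m) e) ((τ ^ m) f) else 0) +
      ∑ e : E, ∑ f : F, ∑ m ∈ Finset.range N, if Strip σ τ⁻¹ x
          (fun f : F => (bar (y (τ⁻¹ f)) : Letter n)) m e f ∧
        orient (o : Cycle (Letter n)) ([y f, bar (x (σ⁻¹ e)), x e] : List (Letter n)) =
          orient (o : Cycle (Letter n)) ([bar (y (τ⁻¹ ((τ⁻¹ ^ m) f))), x ((σ ^ m) e), bar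
              (x (σ⁻¹ ((σ ^ m) e)))] :
            List (Letter n)) then
        orient (o : Cycle (Letter n)) ([y f, bar (x (σ⁻¹ e)), x e] : List (Letter n)) •
          H ((σ ^ m) e) ((τ⁻¹ ^ m) f) else 0) := by
  have hx' (e : E) : x e ≠ bar (x (σ⁻¹ e)) := by simpa using hx (σ⁻¹ e)
  have hy' (f : F) : y f ≠ bar (y (τ⁻¹ f)) := by simpa using hy (τ⁻¹ f)
  have hs (f : F) : τ⁻¹ (τ⁻¹⁻¹ f) = f := inv_inv_apply τ f
  -- The ends of strips of parallel edges.
  have par := sum_start_add_sum_end σ τ x y hN hσ hτ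
    (fun (e : E) (f : F) => orient (o : Cycle (Letter n))
        ([bar (x (σ⁻¹ e)), bar (y (τ⁻¹ f)), x e] : List (Letter n)))
    (fun (e : E) (f : F) => orient (o : Cycle (Letter n))
        ([x e, y f, bar (x (σ⁻¹ e))] : List (Letter n))) H h₁
    (fun e f h h' => orient_triple_eq_or ho hm (bar_injective.ne h')
      (by rw [h]; exact (hy' f).symm) (hx' e))
    (fun e f h h' => orient_triple_eq_or ho hm h (by rw [h']; exact hy' f) (hx' e).symm)
  -- The ends of strips of antiparallel edges; here the second curve is run backwards.
  have anti := sum_start_add_sum_end σ τ⁻¹ x (fun f => bar (y (τ⁻¹ f))) hN hσ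
    (by rw [inv_pow, hτ, inv_one])
    (fun (e : E) (f : F) => orient (o : Cycle (Letter n))
        ([y f, bar (x (σ⁻¹ e)), x e] : List (Letter n)))
    (fun (e : E) (f : F) => orient (o : Cycle (Letter n))
        ([bar (y (τ⁻¹ f)), x e, bar (x (σ⁻¹ e))] : List (Letter n))) H
    (fun e f h => by rw [h₂ e (τ⁻¹ f) h]; simp)
    (fun e f h h' => by
      rw [hs] at h'
      exact orient_triple_eq_or ho hm (fun h => h' (by rw [h, bar_bar])) (hx' e).symm
        (by rw [h]; exact (hy' f).symm))
    (fun e f h h' => by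
      rw [hs] at h'
      exact orient_triple_eq_or ho hm (Ne.symm h) (hx' e)
        (by rw [h', bar_bar]; exact hy' f))
  simp only [hs] at anti
  rw [smul_add, smul_add, ← par, ← anti, Finset.smul_sum]
  simp only [Finset.smul_sum, ← Finset.sum_add_distrib]
  refine Finset.sum_congr rfl fun e _ => Finset.sum_congr rfl fun f _ => ?_
  rw [halfCross_eq ho hm (hx' e) (hy' f)]
  simp only [add_smul, ite_smul, zero_smul, mul_smul]
  simp only [add_assoc]
  congr!

end Strip

/-! ### Linked pairs along curves -/

section Path
open Equiv Equiv.Perm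
variable {n : ℕ} {E F : Type*} {X : Type*}

/-- The word of length `k` that is read along `σ`, starting at `e`. -/
def path (σ : Perm E) (x : E → X) (e : E) (k : ℕ) : List X :=
  (List.range k).map fun t => x ((σ ^ t) e)

@[simp] theorem length_path (σ : Perm E) (x : E → X) (e : E) (k : ℕ) :
    (path σ x e k).length = k := by simp [path]

theorem getElem_path (σ : Perm E) (x : E → X) (e : E) (k t : ℕ) (h : t < (path σ x e k).length) :
    (path σ x e k)[t] = x ((σ ^ t) e) := by simp [path]

theorem path_succ (σ : Perm E) (x : E → X) (e : E) (k : ℕ) :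
    path σ x e (k + 1) = x e :: path σ x (σ e) k := by
  simp [path, List.range_succ_eq_map, pow_succ]

theorem path_succ' (σ : Perm E) (x : E → X) (e : E) (k : ℕ) :
    path σ x e (k + 1) = path σ x e k ++ [x ((σ ^ k) e)] := by
  simp [path, List.range_succ]

theorem path_add_two (σ : Perm E) (x : E → X) (e : E) (m : ℕ) :
    path σ x e (m + 2) = x e :: (path σ x (σ e) m ++ [x ((σ ^ (m + 1)) e)]) := by
  rw [path_succ, path_succ', pow_succ, Perm.mul_apply]

theorem head?_path (σ : Perm E) (x : E → X) (e : E) {m : ℕ} (hm : 0 < m) :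
    (path σ x e m).head? = some (x e) := by
  obtain ⟨k, rfl⟩ : ∃ k, m = k + 1 := ⟨m - 1, by omega⟩
  rw [path_succ, List.head?_cons]

theorem getLast?_path (σ : Perm E) (x : E → X) (e : E) {m : ℕ} (hm : 0 < m) :
    (path σ x (σ e) m).getLast? = some (x ((σ ^ m) e)) := by
  obtain ⟨k, rfl⟩ : ∃ k, m = k + 1 := ⟨m - 1, by omega⟩
  rw [path_succ', List.getLast?_concat, pow_succ, Perm.mul_apply]

theorem path_eq_path_iff (σ : Perm E) (τ : Perm F) (x : E → X) (y : F → X) (e : E) (f : F) (m : ℕ) :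
    path σ x e m = path τ y f m ↔ ∀ i < m, x ((σ ^ i) e) = y ((τ ^ i) f) := by
  simp [path, List.map_inj_left]

theorem path_eq_invRev_path_iff (σ : Perm E) (τ : Perm F) (x : E → Letter n) (y : F → Letter n)
    (e : E) (f : F) (m : ℕ) : path τ y f m = FreeGroup.invRev (path σ x e m) ↔
      ∀ i < m, x ((σ ^ i) e) = bar (y ((τ ^ (m - 1 - i)) f)) := by
  have h (i : ℕ) (hi : i < m) : (FreeGroup.invRev (path σ x e m))[i]'(by simpa using hi) =
      bar (x ((σ ^ (m - 1 - i)) e)) := by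
    simp [FreeGroup.invRev, List.getElem_reverse, getElem_path, bar]
  constructor
  · intro h' i hi
    have h2 := h (m - 1 - i) (by omega)
    simp only [← h', getElem_path, show m - 1 - (m - 1 - i) = i by omega] at h2
    rw [h2, bar_bar]
  · intro h'
    refine List.ext_getElem (by simp) fun i h1 h2 => ?_
    rw [length_path] at h1
    rw [h i h1, getElem_path, h' (m - 1 - i) (by omega), bar_bar,
      show m - 1 - (m - 1 - i) = i by omega]

theorem isReduced_path {σ : Perm E} {x : E → Letter n} (hx : ∀ e, x (σ e) ≠ bar (x e)) (e : E)
    (k : ℕ) : FreeGroup.IsReduced (path σ x e k) := by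
  rw [isReduced_iff_chain, List.isChain_iff_getElem]
  intro i hi
  rw [getElem_path, getElem_path, pow_succ', Perm.mul_apply]
  exact hx _

theorem linked₁_path_iff (O : Cycle (Letter n)) (σ : Perm E) (τ : Perm F) (x : E → Letter n)
    (y : F → Letter n) (e : E) (f : F) (m : ℕ) :
    Linked₁ O (path σ x e (m + 2)) (path τ y f (m + 2)) ↔ m = 0 ∧
      orient O ([bar (x e), bar (y f), x (σ e), y (τ f)] : List (Letter n)) ≠ 0 := by
  constructor
  · rintro ⟨p₁, p₂, q₁, q₂, hP, hQ, h⟩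
    have hm : m = 0 := by simpa using congrArg List.length hP
    subst hm
    simp [path, List.range_succ] at hP hQ
    obtain ⟨rfl, rfl⟩ := hP
    obtain ⟨rfl, rfl⟩ := hQ
    exact ⟨rfl, h⟩
  · rintro ⟨rfl, h⟩
    exact ⟨_, _, _, _, by simp [path, List.range_succ], by simp [path, List.range_succ], h⟩

theorem cons_append_singleton_inj {a b a' b' : X} {Y Y' : List X}
    (h : a :: (Y ++ [b]) = a' :: (Y' ++ [b'])) : a = a' ∧ Y = Y' ∧ b = b' := by
  obtain ⟨h1, h2⟩ := List.cons.inj h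
  obtain ⟨h3, h4⟩ := List.append_inj' h2 rfl
  exact ⟨h1, h3, by simpa using h4⟩

/-- Linked pairs with a parallel middle part are the strips along which the curves change sides. -/
theorem linked₂_path_iff (O : Cycle (Letter n)) (σ : Perm E) (τ : Perm F) (x : E → Letter n)
    (y : F → Letter n) (e : E) (f : F) (m : ℕ) :
    Linked₂ O (path σ x e (m + 2)) (path τ y f (m + 2)) ↔ Strip σ τ x y m (σ e) (τ f) ∧
      orient O ([bar (x e), bar (y f), x (σ e)] : List (Letter n)) =
        orient O ([x ((σ ^ m) (σ e)), y ((τ ^ m) (τ f)), bar (x ((σ ^ m) e))] :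
          List (Letter n)) := by
  rw [path_add_two, path_add_two]
  simp only [pow_succ, Perm.mul_apply]
  constructor
  · rintro ⟨p₁, p₂, q₁, q₂, x₁, x₂, Y, hP, hQ, h1, h2, h3, h4, h5⟩
    obtain ⟨rfl, rfl, rfl⟩ := cons_append_singleton_inj hP
    obtain ⟨rfl, hY, rfl⟩ := cons_append_singleton_inj hQ
    have hm : 0 < m := Nat.pos_of_ne_zero fun hm => by subst hm; simp [path] at h3
    rw [head?_path _ _ _ hm, Option.some_inj] at h3
    rw [getLast?_path _ _ _ hm, Option.some_inj] at h4
    subst h3 h4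
    exact ⟨⟨hm, by simpa using h1, (path_eq_path_iff _ _ _ _ _ _ _).1 hY.symm, h2⟩, h5⟩
  · rintro ⟨⟨hm, h1, h2, h3⟩, h4⟩
    exact ⟨_, _, _, _, _, _, _, rfl, by rw [(path_eq_path_iff _ _ _ _ _ _ _).2 h2],
      by simpa using h1, h3, head?_path _ _ _ hm, getLast?_path _ _ _ hm, h4⟩

/-- A strip of a curve and the reverse of another one, in terms of the two curves. -/
theorem strip_anti_iff (σ : Perm E) (τ : Perm F) (x : E → Letter n) (y : F → Letter n) (e : E)
    (f : F) (m : ℕ) :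
    Strip σ τ⁻¹ x (fun f => bar (y (τ⁻¹ f))) m (σ e) ((τ ^ m) (τ f)) ↔
      0 < m ∧ x e ≠ bar (y ((τ ^ m) (τ f))) ∧
      (∀ i < m, x ((σ ^ i) (σ e)) = bar (y ((τ ^ (m - 1 - i)) (τ f)))) ∧
      x ((σ ^ m) (σ e)) ≠ bar (y f) := by
  unfold Strip
  beta_reduce
  have h1 : τ⁻¹ ((τ⁻¹ ^ m) ((τ ^ m) (τ f))) = f := by rw [inv_pow_apply_pow_apply]; simp
  rw [h1, inv_inv_apply]
  have h2 : (∀ i < m, x ((σ ^ i) (σ e)) = bar (y (τ⁻¹ ((τ⁻¹ ^ i) ((τ ^ m) (τ f)))))) ↔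
      ∀ i < m, x ((σ ^ i) (σ e)) = bar (y ((τ ^ (m - 1 - i)) (τ f))) := by
    refine forall₂_congr fun i hi => ?_
    rw [inv_apply_inv_pow_apply_pow_apply τ _ hi]
  rw [h2]
  simp

/-- Linked pairs with an antiparallel middle part are the strips of one curve and the reverse of the
other one along which they change sides. -/
theorem linked₃_path_iff (O : Cycle (Letter n)) (σ : Perm E) (τ : Perm F) (x : E → Letter n)
    (y : F → Letter n) (e : E) (f : F) (m : ℕ) :
    Linked₃ O (path σ x e (m + 2)) (path τ y f (m + 2)) ↔
      Strip σ τ⁻¹ x (fun f => bar (y (τ⁻¹ f))) m (σ e) ((τ ^ m) (τ f)) ∧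
      orient O ([y ((τ ^ m) (τ f)), bar (x e), x (σ e)] : List (Letter n)) =
        orient O ([bar (y f), x ((σ ^ m) (σ e)), bar (x ((σ ^ m) e))] :
          List (Letter n)) := by
  rw [path_add_two, path_add_two, strip_anti_iff]
  simp only [pow_succ, Perm.mul_apply]
  constructor
  · rintro ⟨p₁, p₂, q₁, q₂, x₁, x₂, Y, hP, hQ, h1, h2, h3, h4, h5⟩
    obtain ⟨rfl, rfl, rfl⟩ := cons_append_singleton_inj hP
    obtain ⟨rfl, hY, rfl⟩ := cons_append_singleton_inj hQ
    have hm : 0 < m := Nat.pos_of_ne_zero fun hm => by subst hm; simp [path] at h3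
    rw [head?_path _ _ _ hm, Option.some_inj] at h3
    rw [getLast?_path _ _ _ hm, Option.some_inj] at h4
    subst h3 h4
    exact ⟨⟨hm, h1, (path_eq_invRev_path_iff _ _ _ _ _ _ _).1 hY, h2⟩, h5⟩
  · rintro ⟨⟨hm, h1, h2, h3⟩, h4⟩
    exact ⟨_, _, _, _, _, _, _, rfl, by rw [(path_eq_invRev_path_iff _ _ _ _ _ _ _).2 h2],
      h1, h3, head?_path _ _ _ hm, getLast?_path _ _ _ hm, h4⟩

/-- A pair of words cannot be linked both with parallel and with antiparallel middle parts, since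
a non-empty freely reduced word is not inverse to itself. -/
theorem not_strip_of_strip {σ : Perm E} {τ : Perm F} {x : E → Letter n} {y : F → Letter n}
    (hx : ∀ e, x (σ e) ≠ bar (x e)) {e : E} {f : F} {m : ℕ} (h : Strip σ τ x y m (σ e) (τ f)) :
    ¬Strip σ τ⁻¹ x (fun f => bar (y (τ⁻¹ f))) m (σ e) ((τ ^ m) (τ f)) := by
  rw [strip_anti_iff]
  rintro ⟨-, -, h2, -⟩
  have h1 := h.2.2.1
  have hm := h.1
  have key (i : ℕ) (hi : i < m) : x ((σ ^ i) (σ e)) = bar (x ((σ ^ (m - 1 - i)) (σ e))) := by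
    rw [h2 i hi, h1 _ (by omega)]
  obtain ⟨k, hk | hk⟩ := Nat.even_or_odd' m
  · have := key (k - 1) (by omega)
    rw [show m - 1 - (k - 1) = (k - 1) + 1 by omega] at this
    rw [pow_succ' σ (k - 1), Perm.mul_apply] at this
    exact hx ((σ ^ (k - 1)) (σ e)) (by rw [this, bar_bar])
  · have := key k (by omega)
    rw [show m - 1 - k = k by omega] at this
    exact (bar_ne _) this.symm

theorem sign_path_zero (O : Cycle (Letter n)) (σ : Perm E) (τ : Perm F) (x : E → Letter n)
    (y : F → Letter n) (e : E) (f : F) :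
    sign O (path σ x e 2) (path τ y f 2) =
      orient O ([bar (x e), bar (y f), x (σ e), y (τ f)] : List (Letter n)) := by
  simp [path, List.range_succ, sign]

open Classical in
/-- The sign of a linked pair with a non-empty middle part; the first and last letters of the middle
part are read off the paths. -/
theorem sign_path (O : Cycle (Letter n)) (σ : Perm E) (τ : Perm F) (x : E → Letter n)
    (y : F → Letter n) (e : E) (f : F) {m : ℕ} (hm : 0 < m) :
    sign O (path σ x e (m + 2)) (path τ y f (m + 2)) =
      if Linked₃ O (path σ x e (m + 2)) (path τ y f (m + 2)) then
        orient O ([y ((τ ^ m) (τ f)), bar (x e), x (σ e)] : List (Letter n))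
      else orient O ([bar (x e), bar (y f), x (σ e)] : List (Letter n)) := by
  obtain ⟨k, rfl⟩ : ∃ k, m = k + 1 := ⟨m - 1, by omega⟩
  have h1 : path σ x e (k + 1 + 2) =
      x e :: x (σ e) :: x (σ (σ e)) :: path σ x (σ (σ (σ e))) k := by
    rw [path_succ, path_succ, path_succ]
  have h2 : path τ y f (k + 1 + 2) = y f :: (path τ y (τ f) (k + 1 + 1)) := by
    rw [path_succ]
  have h3 : (path τ y (τ f) (k + 1 + 1)).getLastD (y f) = y ((τ ^ (k + 1)) (τ f)) := by
    rw [path_succ', List.getLastD_concat]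
  rw [h1, h2, ← h3]
  simp [sign]

open Classical in
/-- The middle part of a linked pair decides its type; this describes the contribution of a pair of
occurrences by its type. -/
theorem ite_linked_path (o : List (Letter n)) {σ : Perm E} {τ : Perm F} {x : E → Letter n}
    {y : F → Letter n} (hx : ∀ e, x (σ e) ≠ bar (x e)) (hy : ∀ f, y (τ f) ≠ bar (y f)) {M : Type*}
    [AddCommGroup M] (H : E → F → M) (e : E) (f : F) (m : ℕ) :
    (if Linked (o : Cycle (Letter n)) (path σ x e (m + 2)) (path τ y f (m + 2)) then
      sign (o : Cycle (Letter n)) (path σ x e (m + 2)) (path τ y f (m + 2)) •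
        (if Linked₃ (o : Cycle (Letter n)) (path σ x e (m + 2)) (path τ y f (m + 2)) then
          H ((σ ^ m) (σ e)) (τ f) else H ((σ ^ m) (σ e)) ((τ ^ m) (τ f))) else 0) =
    (if m = 0 then orient (o : Cycle (Letter n))
      ([bar (x e), bar (y f), x (σ e), y (τ f)] : List (Letter n)) • H (σ e) (τ f) else 0) +
    (if Linked₂ (o : Cycle (Letter n)) (path σ x e (m + 2)) (path τ y f (m + 2)) then
      orient (o : Cycle (Letter n)) ([bar (x e), bar (y f), x (σ e)] : List (Letter n)) •
        H ((σ ^ m) (σ e)) ((τ ^ m) (τ f)) else 0) +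
    (if Linked₃ (o : Cycle (Letter n)) (path σ x e (m + 2)) (path τ y f (m + 2)) then
      orient (o : Cycle (Letter n))
        ([y ((τ ^ m) (τ f)), bar (x e), x (σ e)] : List (Letter n)) •
        H ((σ ^ m) (σ e)) (τ f) else 0) := by
  have hL : Linked (o : Cycle (Letter n)) (path σ x e (m + 2)) (path τ y f (m + 2)) ↔
      (Linked₁ (o : Cycle (Letter n)) (path σ x e (m + 2)) (path τ y f (m + 2)) ∨
      Linked₂ (o : Cycle (Letter n)) (path σ x e (m + 2)) (path τ y f (m + 2)) ∨
      Linked₃ (o : Cycle (Letter n)) (path σ x e (m + 2)) (path τ y f (m + 2))) := by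
    simp [Linked, isReduced_path hx, isReduced_path hy]
  by_cases h0 : m = 0
  · subst h0
    have n2 : ¬Linked₂ (o : Cycle (Letter n)) (path σ x e (0 + 2)) (path τ y f (0 + 2)) := by
      rw [linked₂_path_iff]
      exact fun h => absurd h.1.1 (lt_irrefl 0)
    have n3 : ¬Linked₃ (o : Cycle (Letter n)) (path σ x e (0 + 2)) (path τ y f (0 + 2)) := by
      rw [linked₃_path_iff]
      exact fun h => absurd h.1.1 (lt_irrefl 0)
    rw [if_neg n2, if_neg n3, if_neg n3, if_pos rfl, add_zero, add_zero, hL, linked₁_path_iff,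
      zero_add, sign_path_zero]
    rw [zero_add] at n2 n3
    by_cases h1 : orient (o : Cycle (Letter n))
        ([bar (x e), bar (y f), x (σ e), y (τ f)] : List (Letter n)) = 0
    · rw [h1]
      simp
    · rw [if_pos (Or.inl ⟨rfl, h1⟩)]
      simp
  · have n1 : ¬Linked₁ (o : Cycle (Letter n)) (path σ x e (m + 2)) (path τ y f (m + 2)) := by
      rw [linked₁_path_iff]
      exact fun h => h0 h.1
    rw [sign_path _ _ _ _ _ _ _ (Nat.pos_of_ne_zero h0), if_neg h0, zero_add]
    by_cases h2 : Linked₂ (o : Cycle (Letter n)) (path σ x e (m + 2)) (path τ y f (m + 2))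
    · have n3 : ¬Linked₃ (o : Cycle (Letter n)) (path σ x e (m + 2)) (path τ y f (m + 2)) := by
        rw [linked₂_path_iff] at h2
        rw [linked₃_path_iff]
        exact fun h => not_strip_of_strip hx h2.1 h.1
      rw [if_pos (hL.2 (Or.inr (Or.inl h2))), if_neg n3, if_neg n3, if_neg n3, if_pos h2, add_zero]
    · by_cases h3 : Linked₃ (o : Cycle (Letter n)) (path σ x e (m + 2)) (path τ y f (m + 2))
      · rw [if_pos (hL.2 (Or.inr (Or.inr h3))), if_pos h3, if_pos h3, if_pos h3, if_neg h2,
          zero_add]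
      · rw [if_neg (fun h => by rw [hL] at h; tauto), if_neg h2, if_neg h3, add_zero]

theorem inv_apply_eq_self (ρ : Perm E) (e : E) : ρ⁻¹ (ρ e) = e := by simp

theorem inv_apply_pow_apply_apply (ρ : Perm E) (m : ℕ) (e : E) :
    ρ⁻¹ ((ρ ^ m) (ρ e)) = (ρ ^ m) e := by
  rw [← Perm.mul_apply (ρ ^ m), ← pow_succ, pow_succ', Perm.mul_apply, inv_apply_eq_self]

open Classical in
/-- The sum over the half crossings of two curves is twice the sum over the linked pairs. -/
theorem sum_halfCross_eq_sum_linked [Fintype E] [Fintype F] {o : List (Letter n)} (ho : o.Nodup)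
    (hm : ∀ x, x ∈ o) (σ : Perm E) (τ : Perm F) (x : E → Letter n) (y : F → Letter n) {N : ℕ}
    (hN : 0 < N) (hσ : σ ^ N = 1) (hτ : τ ^ N = 1) (hx : ∀ e, x (σ e) ≠ bar (x e))
    (hy : ∀ f, y (τ f) ≠ bar (y f)) {M : Type*} [AddCommGroup M] (H : E → F → M)
    (h₁ : ∀ e f, x e = y f → H e f = H (σ e) (τ f))
    (h₂ : ∀ e f, x e = bar (y f) → H (σ e) f = H e (τ f)) :
    ∑ e, ∑ f, halfCross o (x (σ⁻¹ e)) (x e) (y (τ⁻¹ f)) (y f) • H e f =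
    (2 : ℤ) • ∑ e, ∑ f, ∑ m ∈ Finset.range N,
      if Linked (o : Cycle (Letter n)) (path σ x e (m + 2)) (path τ y f (m + 2)) then
        sign (o : Cycle (Letter n)) (path σ x e (m + 2)) (path τ y f (m + 2)) •
        (if Linked₃ (o : Cycle (Letter n)) (path σ x e (m + 2)) (path τ y f (m + 2)) then
          H ((σ ^ m) (σ e)) (τ f) else H ((σ ^ m) (σ e)) ((τ ^ m) (τ f))) else 0 := by
  rw [sum_halfCross ho hm σ τ x y hN hσ hτ hx hy H h₁ h₂]
  congr 1
  simp only [ite_linked_path o hx hy, Finset.sum_add_distrib]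
  congr 1
  · congr 1
    · rw [← Equiv.sum_comp σ]
      refine Finset.sum_congr rfl fun e _ => ?_
      rw [← Equiv.sum_comp τ]
      refine Finset.sum_congr rfl fun f _ => ?_
      rw [Finset.sum_ite_eq', if_pos (Finset.mem_range.2 hN)]
      simp
    · rw [← Equiv.sum_comp σ]
      refine Finset.sum_congr rfl fun e _ => ?_
      rw [← Equiv.sum_comp τ]
      refine Finset.sum_congr rfl fun f _ => Finset.sum_congr rfl fun m _ => ?_
      rw [linked₂_path_iff, inv_apply_pow_apply_apply, inv_apply_eq_self, inv_apply_eq_self]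
      split_ifs <;> rfl
  · rw [← Equiv.sum_comp σ]
    refine Finset.sum_congr rfl fun e _ => ?_
    rw [Finset.sum_comm, Finset.sum_comm (s := Finset.univ)]
    refine Finset.sum_congr rfl fun m _ => ?_
    -- A strip of antiparallel edges begins where the second word of the pair ends.
    rw [← Equiv.sum_comp (τ ^ m * τ)]
    refine Finset.sum_congr rfl fun f _ => ?_
    rw [linked₃_path_iff, Perm.mul_apply, inv_pow_apply_pow_apply, inv_apply_eq_self,
      inv_apply_pow_apply_apply, inv_apply_eq_self]
    split_ifs <;> rfl

/-- A strip is shorter than a common period of the two curves. -/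
theorem Strip.lt {σ : Perm E} {τ : Perm F} {x : E → X} {y : F → X} {m N : ℕ} {e : E} {f : F}
    (h : Strip σ τ x y m e f) (hN : 0 < N) (hσ : σ ^ N = 1) (hτ : τ ^ N = 1) : m < N := by
  by_contra hmN
  have h1 := h.2.2.1 (N - 1) (by omega)
  have e1 : σ ^ (N - 1) = σ⁻¹ := by
    rw [eq_inv_iff_mul_eq_one, ← pow_succ, Nat.sub_add_cancel hN, hσ]
  have e2 : τ ^ (N - 1) = τ⁻¹ := by
    rw [eq_inv_iff_mul_eq_one, ← pow_succ, Nat.sub_add_cancel hN, hτ]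
  rw [e1, e2] at h1
  exact h.2.1 h1

/-- The middle part of a linked pair is shorter than any common period of the two words; this bounds
the bracket. -/
theorem lt_of_linked_path {O : Cycle (Letter n)} {σ : Perm E} {τ : Perm F} {x : E → Letter n}
    {y : F → Letter n} {e : E} {f : F} {m N : ℕ} (hN : 0 < N) (hσ : σ ^ N = 1) (hτ : τ ^ N = 1)
    (h : Linked O (path σ x e (m + 2)) (path τ y f (m + 2))) : m < N := by
  obtain ⟨-, -, -, -, h | h | h⟩ := h
  · rw [linked₁_path_iff] at h
    rwa [h.1]
  · rw [linked₂_path_iff] at h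
    exact h.1.lt hN hσ hτ
  · rw [linked₃_path_iff] at h
    exact h.1.lt hN hσ (by rw [inv_pow, hτ, inv_one])

end Path

/-! ### The words of a linked pair are reduced -/

section Reduced
open Equiv Equiv.Perm
variable {n : ℕ} {E F : Type*} {X : Type*}

theorem path_zero (σ : Perm E) (x : E → X) (e : E) : path σ x e 0 = [] := rfl

theorem path_add (σ : Perm E) (x : E → X) (e : E) (a b : ℕ) :
    path σ x e (a + b) = path σ x e a ++ path σ x ((σ ^ a) e) b := by
  rw [path, List.range_add, List.map_append, path, path, List.map_map]
  congr 1
  refine List.map_congr_left fun t _ => ?_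
  simp only [Function.comp_apply]
  rw [add_comm a t, pow_add, Perm.mul_apply]

theorem path_ne_nil (σ : Perm E) (x : E → X) (e : E) {a : ℕ} (h : 0 < a) : path σ x e a ≠ [] := by
  rw [← List.length_pos_iff, length_path]
  exact h

theorem chain_coe_iff {R : X → X → Prop} {l : List X} {a b : X} (ha : a ∈ l.head?)
    (hb : b ∈ l.getLast?) (hl : l.IsChain R) (h : R b a) : (l : Cycle X).Chain R := by
  obtain ⟨t, rfl⟩ := List.head?_eq_some_iff.1 ha
  rw [Cycle.chain_coe_cons, ← List.cons_append, List.isChain_append]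
  refine ⟨hl, List.isChain_singleton a, fun c hc d hd => ?_⟩
  obtain rfl : b = c := Option.some_inj.1 (hb.symm.trans hc)
  obtain rfl : a = d := by simpa using hd
  exact h

theorem getLast?_path' (σ : Perm E) (x : E → X) (e : E) {a : ℕ} (h : 0 < a) :
    (path σ x e a).getLast? = some (x ((σ ^ (a - 1)) e)) := by
  obtain ⟨k, rfl⟩ : ∃ k, a = k + 1 := ⟨a - 1, by omega⟩
  rw [path_succ', List.getLast?_concat]
  rfl

theorem chain_path {σ : Perm E} {x : E → Letter n} (hx : ∀ e, x (σ e) ≠ bar (x e)) {e : E} {a : ℕ}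
    (h : 0 < a → x e ≠ bar (x ((σ ^ (a - 1)) e))) :
    (path σ x e a : Cycle (Letter n)).Chain fun a b => b ≠ bar a := by
  obtain rfl | ha := Nat.eq_zero_or_pos a
  · exact Cycle.Chain.nil _
  · exact chain_coe_iff (head?_path σ x e ha) (getLast?_path' σ x e ha)
      (isReduced_iff_chain.1 (isReduced_path hx e a)) (h ha)

theorem chain_path_append_path {σ : Perm E} {x : E → Letter n} (hx : ∀ e, x (σ e) ≠ bar (x e))
    {τ : Perm F} {y : F → Letter n} (hy : ∀ f, y (τ f) ≠ bar (y f)) {e : E} {f : F} {a b : ℕ}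
    (ha : 0 < a) (hb : 0 < b) (h₁ : y f ≠ bar (x ((σ ^ (a - 1)) e)))
    (h₂ : x e ≠ bar (y ((τ ^ (b - 1)) f))) :
    (path σ x e a ++ path τ y f b : Cycle (Letter n)).Chain fun a b => b ≠ bar a := by
  refine chain_coe_iff (a := x e) (b := y ((τ ^ (b - 1)) f)) ?_ ?_ ?_ h₂
  · rw [List.head?_append, head?_path σ x e ha]; rfl
  · rw [List.getLast?_append, getLast?_path' τ y f hb]; rfl
  · rw [List.isChain_append]
    refine ⟨isReduced_iff_chain.1 (isReduced_path hx e a),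
      isReduced_iff_chain.1 (isReduced_path hy f b), fun c hc d hd => ?_⟩
    rw [getLast?_path' σ x e ha] at hc
    rw [head?_path τ y f hb] at hd
    obtain rfl : _ = c := Option.some_inj.1 hc
    obtain rfl : _ = d := Option.some_inj.1 hd
    exact h₁

theorem isReduced_of_chain {l : List (Letter n)} (hl : l ≠ [])
    (h : (l : Cycle (Letter n)).Chain fun a b => b ≠ bar a) : IsReduced (l : Cycle (Letter n)) :=
  (isReduced_iff_cycle_chain _).2 ⟨by simpa using hl, h⟩

theorem ne_one_of_cycleOf_ne_nil {g : FreeGroup (Fin n)} (h : cycleOf g ≠ Cycle.nil) : g ≠ 1 := by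
  rintro rfl
  exact h cycleOf_one

theorem mk_ne_one_of_chain {l : List (Letter n)} (hl : l ≠ [])
    (h : (l : Cycle (Letter n)).Chain fun a b => b ≠ bar a) : FreeGroup.mk l ≠ 1 :=
  ne_one_of_cycleOf_ne_nil (by rw [cycleOf_mk h]; simpa using hl)

/-- After a linked pair with parallel middle parts, one may change from one word to the other. -/
theorem junction_of_not_linked₃ {o : List (Letter n)} (ho : o.Nodup) (hm : ∀ x, x ∈ o) {σ : Perm E}
    {τ : Perm F} {x : E → Letter n} {y : F → Letter n} (hx : ∀ e, x (σ e) ≠ bar (x e))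
    (hy : ∀ f, y (τ f) ≠ bar (y f)) {e : E} {f : F} {m : ℕ}
    (h : Linked (o : Cycle (Letter n)) (path σ x e (m + 2)) (path τ y f (m + 2)))
    (h₃ : ¬Linked₃ (o : Cycle (Letter n)) (path σ x e (m + 2)) (path τ y f (m + 2))) :
    x ((σ ^ m) (σ e)) ≠ bar (y ((τ ^ m) f)) ∧ y ((τ ^ m) (τ f)) ≠ bar (x ((σ ^ m) e)) := by
  obtain ⟨-, -, -, -, h | h | h⟩ := h
  · rw [linked₁_path_iff] at h
    obtain ⟨rfl, h⟩ := h
    have := ne_of_orient_quadruple_ne_zero ho hm h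
    exact ⟨this.2.1.symm, this.2.2.2.1⟩
  · rw [linked₂_path_iff] at h
    obtain ⟨k, rfl⟩ : ∃ k, m = k + 1 := ⟨m - 1, by have := h.1.1; omega⟩
    have h1 := h.1.2.2.1 k (by omega)
    simp only [← Perm.mul_apply, ← pow_succ] at h1 ⊢
    rw [← h1, pow_succ' _ (k + 1), pow_succ' _ (k + 1), Perm.mul_apply, Perm.mul_apply]
    refine ⟨hx _, ?_⟩
    rw [h1]
    exact hy _
  · exact absurd h h₃

/-- The loops at the end of an antiparallel linked pair do not cancel. -/
theorem mk_path_mul_mk_path_ne_one {σ : Perm E} {τ : Perm F} {x : E → Letter n} {y : F → Letter n}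
    (hx : ∀ e, x (σ e) ≠ bar (x e)) (hy : ∀ f, y (τ f) ≠ bar (y f)) {e : E} {f : F} {m : ℕ}
    {L L' : ℕ} (hL : 0 < L) (hσ : σ ^ L = 1) (hτ : τ ^ L' = 1) (h : x e ≠ bar (y ((τ ^ m) (τ f)))) :
    FreeGroup.mk (path σ x ((σ ^ m) (σ e)) L) * FreeGroup.mk (path τ y (τ f) L') ≠ 1 := by
  intro h1
  rw [mul_eq_one_iff_inv_eq, FreeGroup.inv_mk] at h1
  have h2 := congrArg FreeGroup.toWord h1
  rw [FreeGroup.toWord_mk, FreeGroup.toWord_mk, (isReduced_path hy _ _).reduce_eq,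
    FreeGroup.reduce_invRev, (isReduced_path hx _ _).reduce_eq] at h2
  obtain rfl : L = L' := by simpa using congrArg List.length h2
  -- If the loops were inverse to each other, the curves would run antiparallel beyond the start of
  -- the strip; modulo the period, that place is `m` steps back.
  have h3 := (path_eq_invRev_path_iff _ _ _ _ _ _ _).1 h2.symm (L - 1 - m % L) (by omega)
  have hlt := Nat.mod_lt m hL
  refine h ?_
  rw [show L - 1 - (L - 1 - m % L) = m % L by omega] at h3
  have e1 : τ ^ (m % L) = τ ^ m := by
    conv_rhs => rw [← Nat.mod_add_div m L, pow_add, pow_mul, hτ, one_pow, mul_one]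
  have e2 : σ ^ (L - 1 - m % L) * (σ ^ m * σ) = 1 := by
    rw [← pow_succ, ← pow_add]
    have : L - 1 - m % L + (m + 1) = L * (m / L + 1) := by
      have := Nat.mod_add_div m L
      rw [mul_add, mul_one]
      omega
    rw [this, pow_mul, hσ, one_pow]
  rw [e1, ← Perm.mul_apply (σ ^ m), ← Perm.mul_apply, e2, Perm.one_apply] at h3
  exact h3

theorem pow_sub_one_apply_pow_apply {ρ : Perm E} {g : E} {K m : ℕ} (hρ : ρ ^ K = 1)
    (hK : 0 < K - m) :
    (ρ ^ (K - m - 1)) ((ρ ^ m) (ρ g)) = g := by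
  rw [← Perm.mul_apply (ρ ^ m), ← pow_succ, ← Perm.mul_apply, ← pow_add,
    show K - m - 1 + (m + 1) = K by omega, hρ, Perm.one_apply]

theorem orient_rotate {o : List (Letter n)} (ho : o.Nodup) (hm : ∀ x, x ∈ o) (a b c : Letter n) :
    orient (o : Cycle (Letter n)) ([a, b, c] : List (Letter n)) =
      orient (o : Cycle (Letter n)) ([b, c, a] : List (Letter n)) := by
  rw [orient_triple ho hm, orient_triple ho hm]
  ring

/-- The words that remain of two antiparallel linked words when the middle part is removed form a
reduced cyclic word. -/
theorem chain_of_linked₃ {o : List (Letter n)} (ho : o.Nodup) (hm : ∀ x, x ∈ o) {σ : Perm E}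
    {τ : Perm F} {x : E → Letter n} {y : F → Letter n} (hx : ∀ e, x (σ e) ≠ bar (x e))
    (hy : ∀ f, y (τ f) ≠ bar (y f)) {e : E} {f : F} {m : ℕ} {L L' : ℕ} (hσ : σ ^ L = 1)
    (hτ : τ ^ L' = 1) (hmL : m ≤ L) (hmL' : m ≤ L')
    (h : Linked₃ (o : Cycle (Letter n)) (path σ x e (m + 2)) (path τ y f (m + 2))) :
    (path σ x ((σ ^ m) (σ e)) (L - m) ++ path τ y ((τ ^ m) (τ f)) (L' - m) :
      Cycle (Letter n)).Chain fun a b => b ≠ bar a := by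
  rw [linked₃_path_iff, strip_anti_iff] at h
  obtain ⟨⟨hm0, h1, h2, h3⟩, h4⟩ := h
  have h1' : y ((τ ^ m) (τ f)) ≠ bar (x e) := fun h => h1 (by rw [h, bar_bar])
  -- Opposite orders of the same three distinct letters have different orientations; this excludes a
  -- cancellation when one of the two words is used up.
  have hsplit {u v w : Letter n} (h : orient (o : Cycle (Letter n)) ([u, v, w] : List (Letter n)) =
      orient (o : Cycle (Letter n)) ([u, w, v] : List (Letter n))) (huv : u ≠ v) (hvw : v ≠ w)
      (hwu : w ≠ u) : False := by
    have h5 := orient_triple_eq_or ho hm huv hvw hwu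
    have h6 := orient_triple ho hm u v w
    have h7 := orient_triple ho hm u w v
    rw [sgn_swap (place o w) (place o v), sgn_swap (place o v) (place o u),
      sgn_swap (place o u) (place o w)] at h7
    omega
  have hq : x (σ e) = bar (y ((τ ^ m) f)) := by
    obtain ⟨k, rfl⟩ : ∃ k, m = k + 1 := ⟨m - 1, by omega⟩
    have := h2 0 hm0
    rwa [pow_zero, Perm.one_apply, show k + 1 - 1 - 0 = k by omega, ← Perm.mul_apply (τ ^ k),
      ← pow_succ] at this
  have hp : x ((σ ^ m) e) = bar (y (τ f)) := by
    obtain ⟨k, rfl⟩ : ∃ k, m = k + 1 := ⟨m - 1, by omega⟩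
    have := h2 k (by omega)
    rwa [show k + 1 - 1 - k = 0 by omega, pow_zero, Perm.one_apply, ← Perm.mul_apply (σ ^ k),
      ← pow_succ] at this
  have hne1 : y ((τ ^ m) (τ f)) ≠ x (σ e) := by
    rw [hq, ← Perm.mul_apply (τ ^ m), ← pow_succ, pow_succ', Perm.mul_apply]
    exact hy _
  have hne2 : bar (x e) ≠ x (σ e) := (hx e).symm
  obtain hL | hL := Nat.eq_zero_or_pos (L - m)
  · obtain rfl : L = m := by omega
    rw [Nat.sub_self, path_zero, List.nil_append]
    refine chain_path hy fun hb => ?_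
    rw [pow_sub_one_apply_pow_apply hτ hb]
    intro hbar
    rw [hbar, hσ, Perm.one_apply, Perm.one_apply] at h4
    rw [hbar] at h1' hne1
    exact hsplit h4 h1' hne2 hne1.symm
  obtain hL' | hL' := Nat.eq_zero_or_pos (L' - m)
  · obtain rfl : L' = m := by omega
    rw [Nat.sub_self, path_zero, List.append_nil]
    refine chain_path hx fun hb => ?_
    rw [pow_sub_one_apply_pow_apply hσ hb]
    intro hbar
    rw [hτ, Perm.one_apply] at hq hne1 h4
    rw [hτ, Perm.one_apply] at h1'
    rw [hbar, hp, bar_bar, ← hq, orient_rotate ho hm, orient_rotate ho hm (x (σ e))] at h4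
    exact hsplit h4 hne2 hne1.symm h1'
  · refine chain_path_append_path hx hy hL hL' ?_ ?_
    · rwa [pow_sub_one_apply_pow_apply hσ hL]
    · rwa [pow_sub_one_apply_pow_apply hτ hL']

/-- The occurrences in a linked pair with a parallel or empty middle part are distinct. -/
theorem ne_zero_of_not_linked₃ {o : List (Letter n)} (ho : o.Nodup) (hm : ∀ x, x ∈ o) {σ : Perm E}
    {x : E → Letter n} {e : E} {d m : ℕ}
    (h : Linked (o : Cycle (Letter n)) (path σ x e (m + 2)) (path σ x ((σ ^ d) e) (m + 2)))
    (h₃ : ¬Linked₃ (o : Cycle (Letter n)) (path σ x e (m + 2)) (path σ x ((σ ^ d) e) (m + 2))) :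
    0 < d := by
  refine Nat.pos_of_ne_zero ?_
  rintro rfl
  rw [pow_zero, Perm.one_apply] at h h₃
  obtain ⟨-, -, -, -, h | h | h⟩ := h
  · rw [linked₁_path_iff] at h
    exact (ne_of_orient_quadruple_ne_zero ho hm h.2).1 rfl
  · rw [linked₂_path_iff] at h
    exact h.1.2.1 rfl
  · exact h₃ h

/-- If a curve runs parallel to its own translate along all edges but one, then it does so along
all edges, since the letter sums over all edges agree. -/
theorem Strip.add_one_lt [Fintype E] {σ : Perm E} {x : E → X} {e : E} {d m L : ℕ}
    (hL : ∀ g, ∃ t < L, (σ ^ t) e = g) (h : Strip σ σ x x m (σ e) (σ ((σ ^ d) e))) :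
    m + 1 < L := by
  classical
  by_contra hmL
  -- The edge `e` is the only one that could contribute to this sum.
  have key : ∑ g, ((if x g = x e then (1 : ℤ) else 0) -
      if x ((σ ^ d) g) = x e then (1 : ℤ) else 0) = 0 := by
    rw [Finset.sum_sub_distrib, sub_eq_zero]
    exact (Equiv.sum_comp (σ ^ d) fun g => if x g = x e then (1 : ℤ) else 0).symm
  rw [Finset.sum_eq_single e] at key
  · have h1 := h.2.1
    rw [inv_apply_eq_self, inv_apply_eq_self] at h1
    rw [if_pos rfl, if_neg h1.symm] at key
    norm_num at key
  · intro g _ hg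
    obtain ⟨t, ht, rfl⟩ := hL g
    obtain rfl | ht0 := Nat.eq_zero_or_pos t
    · exact absurd rfl hg
    obtain ⟨s, rfl⟩ : ∃ s, t = s + 1 := ⟨t - 1, by omega⟩
    have h1 := h.2.2.1 s (by omega)
    rw [← Perm.mul_apply, ← Perm.mul_apply, ← pow_succ, ← Perm.mul_apply, ← pow_add,
      Nat.add_comm (s + 1) d] at h1
    rw [← Perm.mul_apply, ← pow_add, h1, sub_self]
  · simp

/-- A curve and its translate can only run antiparallel along disjoint segments, since a freely
reduced word does not overlap with its inverse. -/
theorem le_of_linked₃ {O : Cycle (Letter n)} {σ : Perm E} {x : E → Letter n}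
    (hx : ∀ e, x (σ e) ≠ bar (x e)) {e : E} {d m L : ℕ} (hσ : σ ^ L = 1) (hd : d < L)
    (h : Linked₃ O (path σ x e (m + 2)) (path σ x ((σ ^ d) e) (m + 2))) :
    m + 1 ≤ d ∧ d + m + 1 ≤ L := by
  rw [linked₃_path_iff, strip_anti_iff] at h
  obtain ⟨⟨hm0, -, h2, -⟩, -⟩ := h
  -- The strip pairs the place `a` with the place `d + m + 1 - a`. If the segments overlap, the
  -- middle of this reflection is a letter equal to its own inverse, or a pair of inverse
  -- neighbours.
  have hu (a : ℕ) (h1 : 1 ≤ a) (ha : a ≤ m) :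
      x ((σ ^ a) e) = bar (x ((σ ^ (d + m + 1 - a)) e)) := by
    have := h2 (a - 1) (by omega)
    rwa [← Perm.mul_apply (σ ^ (a - 1)), ← pow_succ, ← Perm.mul_apply (σ ^ (m - 1 - (a - 1))),
      ← pow_succ, ← Perm.mul_apply (σ ^ (m - 1 - (a - 1) + 1)), ← pow_add,
      show a - 1 + 1 = a by omega, show m - 1 - (a - 1) + 1 + d = d + m + 1 - a by omega] at this
  have hr (a : ℕ) : x ((σ ^ (a + 1)) e) ≠ bar (x ((σ ^ a) e)) := by
    rw [pow_succ', Perm.mul_apply]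
    exact hx _
  have hp (a : ℕ) : x ((σ ^ (a + L)) e) = x ((σ ^ a) e) := by rw [pow_add, hσ, mul_one]
  constructor
  · by_contra hdm
    obtain ⟨q, hq | hq⟩ := Nat.even_or_odd' (d + m + 1)
    · have := hu q (by omega) (by omega)
      rw [show d + m + 1 - q = q by omega] at this
      exact bar_ne _ this.symm
    · have := hu q (by omega) (by omega)
      rw [show d + m + 1 - q = q + 1 by omega] at this
      exact hr q (by rw [this, bar_bar])
  · by_contra hdm
    obtain ⟨q, hq | hq⟩ := Nat.even_or_odd' (d + m + 1 + L)
    · have := hu (q - L) (by omega) (by omega)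
      rw [show d + m + 1 - (q - L) = q by omega, ← hp, show q - L + L = q by omega] at this
      exact bar_ne _ this.symm
    · have := hu (q + 1 - L) (by omega) (by omega)
      rw [show d + m + 1 - (q + 1 - L) = q by omega, ← hp,
        show q + 1 - L + L = q + 1 by omega] at this
      exact hr q this

/-- The two loops at a self-intersection with parallel strands. -/
theorem chain_of_not_linked₃ {o : List (Letter n)} (ho : o.Nodup) (hm : ∀ x, x ∈ o) {σ : Perm E}
    {x : E → Letter n} (hx : ∀ e, x (σ e) ≠ bar (x e)) {e : E} {d m L : ℕ} (hσ : σ ^ L = 1)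
    (hd : d < L)
    (h : Linked (o : Cycle (Letter n)) (path σ x e (m + 2)) (path σ x ((σ ^ d) e) (m + 2)))
    (h₃ : ¬Linked₃ (o : Cycle (Letter n)) (path σ x e (m + 2)) (path σ x ((σ ^ d) e) (m + 2))) :
    ((path σ x ((σ ^ (m + 1)) e) d : Cycle (Letter n)).Chain fun a b => b ≠ bar a) ∧
      (path σ x ((σ ^ (d + m + 1)) e) (L - d) : Cycle (Letter n)).Chain fun a b => b ≠ bar a := by
  have hd0 := ne_zero_of_not_linked₃ ho hm h h₃
  have hj := junction_of_not_linked₃ ho hm hx hx h h₃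
  simp only [← Perm.mul_apply, ← pow_succ, ← pow_add] at hj
  constructor
  · refine chain_path hx fun _ => ?_
    rw [← Perm.mul_apply, ← pow_add, show d - 1 + (m + 1) = m + d by omega]
    exact hj.1
  · refine chain_path hx fun _ => ?_
    rw [← Perm.mul_apply, ← pow_add, show L - d - 1 + (d + m + 1) = m + L by omega, pow_add σ m L,
      hσ, mul_one, show d + m + 1 = m + 1 + d by omega, pow_add, pow_succ]
    exact hj.2

/-- The two loops at a self-intersection with antiparallel strands. -/
theorem chain_of_linked₃_self {O : Cycle (Letter n)} {σ : Perm E} {x : E → Letter n}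
    (hx : ∀ e, x (σ e) ≠ bar (x e)) {e : E} {d m L : ℕ} (hσ : σ ^ L = 1) (hd : d < L)
    (h : Linked₃ O (path σ x e (m + 2)) (path σ x ((σ ^ d) e) (m + 2))) :
    ((path σ x ((σ ^ (m + 1)) e) (d - m) : Cycle (Letter n)).Chain fun a b => b ≠ bar a) ∧
      (path σ x ((σ ^ (d + m + 1)) e) (L - (d + m)) : Cycle (Letter n)).Chain
        fun a b => b ≠ bar a := by
  obtain ⟨hdm, hdL⟩ := le_of_linked₃ hx hσ hd h
  rw [linked₃_path_iff, strip_anti_iff] at h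
  obtain ⟨⟨-, h1, -, h2⟩, -⟩ := h
  simp only [← Perm.mul_apply, ← pow_succ] at h1 h2
  constructor
  · refine chain_path hx fun _ => ?_
    rw [← Perm.mul_apply, ← pow_add, show d - m - 1 + (m + 1) = d by omega]
    exact h2
  · refine chain_path hx fun _ => ?_
    rw [← Perm.mul_apply, ← pow_add, show L - (d + m) - 1 + (d + m + 1) = L by omega, hσ,
      Perm.one_apply, show d + m + 1 = m + 1 + d by omega, pow_add, pow_succ,
      mul_assoc]
    exact fun h => h1 (by rw [h, bar_bar])

end Reduced

/-! ### The summands of bracket and cobracket as conjugacy classes -/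

section Summands
open Equiv Equiv.Perm
variable {n : ℕ} {E F : Type*} {X Z : Type*}

theorem map_path (σ : Perm E) (x : E → X) (φ : X → Z) (e : E) (k : ℕ) :
    (path σ x e k).map φ = path σ (fun e => φ (x e)) e k := by
  simp [path]

theorem take_path (σ : Perm E) (x : E → X) (e : E) {a b : ℕ} (h : a ≤ b) :
    (path σ x e b).take a = path σ x e a := by
  rw [path, ← List.map_take, List.take_range, min_eq_left h, path]

theorem flatten_replicate_path {σ : Perm E} (x : E → X) (e : E) {L : ℕ} (hσ : σ ^ L = 1) (k : ℕ) :
    (List.replicate k (path σ x e L)).flatten = path σ x e (L * k) := by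
  induction k with
  | zero => rfl
  | succ k ih =>
    rw [List.replicate_succ, List.flatten_cons, ih, mul_add, mul_one, add_comm, path_add, hσ,
      Perm.one_apply]

theorem powTake_path {σ : Perm E} (x : E → Letter n) (e : E) {L : ℕ} (hL : 0 < L) (hσ : σ ^ L = 1)
    (k : ℕ) : powTake (path σ x e L) k = path σ x e k := by
  rw [powTake, flatten_replicate_path x e hσ, take_path _ _ _ (Nat.le_mul_of_pos_left k hL)]

theorem rotate_path {σ : Perm E} (x : E → X) (e : E) {L : ℕ} (hσ : σ ^ L = 1) (a : ℕ) :
    (path σ x e L).rotate a = path σ x ((σ ^ a) e) L := by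
  refine List.ext_getElem (by simp) fun t h1 h2 => ?_
  rw [List.getElem_rotate, getElem_path, getElem_path, length_path, ← Perm.mul_apply, ← pow_add]
  congr 2
  conv_rhs => rw [← Nat.mod_add_div (t + a) L, pow_add, pow_mul, hσ, one_pow, mul_one]

theorem mk_append (l l' : List (Letter n)) :
    FreeGroup.mk (l ++ l') = FreeGroup.mk l * FreeGroup.mk l' := FreeGroup.mul_mk.symm

open Classical in
/-- A summand of the bracket is the class of the product of the two loops at the end of the linked
pair, and it is reduced. -/
theorem γ_path {o : List (Letter n)} (ho : o.Nodup) (hm : ∀ x, x ∈ o) {σ : Perm E} {τ : Perm F}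
    {x : E → Letter n} {y : F → Letter n} (hx : ∀ e, x (σ e) ≠ bar (x e))
    (hy : ∀ f, y (τ f) ≠ bar (y f)) {e : E} {f : F} {m : ℕ} {L L' : ℕ} (hL : 0 < L) (hL' : 0 < L')
    (hσ : σ ^ L = 1) (hτ : τ ^ L' = 1)
    (h : Linked (o : Cycle (Letter n)) (path σ x e (m + 2)) (path τ y f (m + 2))) :
    γ (o : Cycle (Letter n)) (path σ x e L) (path τ y f L') (m + 2) =
      (if Linked₃ (o : Cycle (Letter n)) (path σ x e (m + 2)) (path τ y f (m + 2)) then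
        cycleOf (FreeGroup.mk (path σ x ((σ ^ m) (σ e)) L) * FreeGroup.mk (path τ y (τ f) L'))
      else cycleOf (FreeGroup.mk (path σ x ((σ ^ m) (σ e)) L) *
        FreeGroup.mk (path τ y ((τ ^ m) (τ f)) L'))) ∧
    IsReduced (γ (o : Cycle (Letter n)) (path σ x e L) (path τ y f L') (m + 2)) := by
  have e1 : m + 2 - 1 = m + 1 := rfl
  have e2 : m + 2 - 2 = m := rfl
  simp only [γ, powTake_path x e hL hσ, powTake_path y f hL' hτ, rotate_path x e hσ,
    rotate_path y f hτ, length_path, e1, e2, pow_succ, Perm.mul_apply, pow_zero, Perm.one_apply]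
  split_ifs with h₃ hk
  -- An antiparallel strip that is not longer than the two words: the copies of the strip cancel in
  -- the free group.
  · have hc := chain_of_linked₃ ho hm hx hy hσ hτ hk.1 hk.2 h₃
    rw [linked₃_path_iff, strip_anti_iff] at h₃
    obtain ⟨⟨hm0, h1, h2, h3⟩, h4⟩ := h₃
    have hp : FreeGroup.mk (path σ x ((σ ^ m) (σ e)) L) * FreeGroup.mk (path τ y (τ f) L') =
        FreeGroup.mk (path σ x ((σ ^ m) (σ e)) (L - m) ++ path τ y ((τ ^ m) (τ f)) (L' - m)) := by
      have i1 : path σ x ((σ ^ m) (σ e)) L =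
          path σ x ((σ ^ m) (σ e)) (L - m) ++ path σ x (σ e) m := by
        conv_lhs => rw [← Nat.sub_add_cancel hk.1, path_add]
        rw [← Perm.mul_apply (σ ^ (L - m)), ← pow_add, Nat.sub_add_cancel hk.1, hσ, Perm.one_apply]
      have i2 : path τ y (τ f) L' = path τ y (τ f) m ++ path τ y ((τ ^ m) (τ f)) (L' - m) := by
        conv_lhs => rw [← Nat.add_sub_cancel' hk.2, path_add]
      rw [i1, i2, (path_eq_invRev_path_iff σ τ x y (σ e) (τ f) m).2 h2, mk_append, mk_append,
        mk_append, ← FreeGroup.inv_mk]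
      group
    have hne := mk_path_mul_mk_path_ne_one hx hy hL hσ hτ h1
    rw [take_path _ _ _ (Nat.sub_le _ _), take_path _ _ _ (Nat.sub_le _ _), ← cycleOf_mk hc, ← hp]
    exact ⟨rfl, isReduced_cycleOf hne⟩
  -- A longer antiparallel strip: here the summand is reduced by definition, once the word is not
  -- trivial.
  · rw [linked₃_path_iff, strip_anti_iff] at h₃
    have hne := mk_path_mul_mk_path_ne_one hx hy hL hσ hτ h₃.1.2.1
    have hd : ((FreeGroup.reduceCyclically (FreeGroup.reduce (path σ x ((σ ^ m) (σ e)) L ++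
        path τ y (τ f) L')) : List (Letter n)) : Cycle (Letter n)) = cycleOf
        (FreeGroup.mk (path σ x ((σ ^ m) (σ e)) L) * FreeGroup.mk (path τ y (τ f) L')) := by
      rw [← mk_append]
      rfl
    rw [hd]
    exact ⟨rfl, isReduced_cycleOf hne⟩
  -- In the other cases, the concatenation is cyclically reduced.
  · obtain ⟨h1, h2⟩ := junction_of_not_linked₃ ho hm hx hy h h₃
    have hc := chain_path_append_path (e := (σ ^ m) (σ e)) (f := (τ ^ m) (τ f)) hx hy hL hL' ?_ ?_
    · rw [← mk_append, cycleOf_mk hc]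
      exact ⟨rfl, isReduced_of_chain (by simp [path_ne_nil _ _ _ hL]) hc⟩
    · rw [← Perm.mul_apply (σ ^ m) σ, ← pow_succ, ← Perm.mul_apply (σ ^ (L - 1)), ← pow_add,
        show L - 1 + (m + 1) = m + L by omega, pow_add, hσ, mul_one]
      exact h2
    · rw [← Perm.mul_apply (τ ^ m) τ, ← pow_succ, ← Perm.mul_apply (τ ^ (L' - 1)), ← pow_add,
        show L' - 1 + (m + 1) = m + L' by omega, pow_add, hτ, mul_one]
      exact h1

theorem cycleList_eq_path {σ : Perm E} {e : E} {L : ℕ} (hL : 0 < L) (he : (σ ^ L) e = e)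
    (hi : ∀ s < L, ∀ t < L, (σ ^ s) e = (σ ^ t) e → s = t) :
    cycleList σ e = path σ id e L := by
  obtain ⟨k, rfl⟩ : ∃ k, L = k + 1 := ⟨L - 1, by omega⟩
  rw [path_succ]
  refine cycleList_eq ?_ ?_
  · rw [← show path σ id e (k + 1) = e :: path σ id (σ e) k from path_succ _ _ _ _, path]
    refine List.Nodup.map_on ?_ List.nodup_range
    intro s hs t ht
    exact hi s (List.mem_range.1 hs) t (List.mem_range.1 ht)
  · have : e :: path σ id (σ e) k ++ [e] = path σ id e (k + 2) := by
      rw [path_succ', path_succ, he]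
      rfl
    rw [this, List.isChain_iff_getElem]
    intro i h
    rw [getElem_path, getElem_path, pow_succ', Perm.mul_apply]
    rfl

theorem arcs_path [Fintype E] [DecidableEq E] {M : Type*} [AddCommGroup M]
    {Θ : FreeGroup (Fin n) → FreeGroup (Fin n) → M} (h₁ : ∀ g, Θ 1 g = 0) (x : E → Letter n)
    {σ : Perm E} {e : E} {L a : ℕ} (ha : a < L) (hc : cycleList σ e = path σ id e L) :
    arcs Θ x σ e ((σ ^ a) e) =
      Θ (FreeGroup.mk (path σ x e a)) (FreeGroup.mk (path σ x ((σ ^ a) e) (L - a))) := by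
  obtain ⟨b, rfl⟩ : ∃ b, L = a + (b + 1) := ⟨L - a - 1, by omega⟩
  rw [path_add, path_succ σ id ((σ ^ a) e), id] at hc
  rw [← arcs_eq h₁ hc, Nat.add_sub_cancel_left, map_path, List.map_cons, map_path, path_succ]
  rfl

theorem classPair_mk {l l' : List (Letter n)} (hl : l ≠ []) (hl' : l' ≠ [])
    (h : (l : Cycle (Letter n)).Chain fun a b => b ≠ bar a)
    (h' : (l' : Cycle (Letter n)).Chain fun a b => b ≠ bar a) :
    classPair (FreeGroup.mk l) (FreeGroup.mk l') =
      Finsupp.single ((l : Cycle (Letter n)), (l' : Cycle (Letter n))) 1 := by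
  rw [classPair, if_neg, cycleOf_mk h, cycleOf_mk h']
  rintro (h1 | h1)
  · exact mk_ne_one_of_chain hl h h1
  · exact mk_ne_one_of_chain hl' h' h1

open Classical in
/-- A summand of the cobracket is the pair of classes of the two loops at the end of the linked
pair, and these are reduced. -/
theorem δ_path [Fintype E] [DecidableEq E] {o : List (Letter n)} (ho : o.Nodup) (hm : ∀ x, x ∈ o)
    {σ : Perm E} {x : E → Letter n} (hx : ∀ e, x (σ e) ≠ bar (x e)) {e : E} {d m L : ℕ} (hd : d < L)
    (hL : m + 2 ≤ L) (hσ : σ ^ L = 1) (hc : ∀ e, cycleList σ e = path σ id e L)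
    (h : Linked (o : Cycle (Letter n)) (path σ x e (m + 2)) (path σ x ((σ ^ d) e) (m + 2))) :
    Finsupp.single (δ₁ (o : Cycle (Letter n)) (path σ x e L) d (m + 2),
      δ₂ (o : Cycle (Letter n)) (path σ x e L) d (m + 2)) 1 =
      (if Linked₃ (o : Cycle (Letter n)) (path σ x e (m + 2)) (path σ x ((σ ^ d) e) (m + 2)) then
        arcs classPair x σ ((σ ^ m) (σ e)) (σ ((σ ^ d) e))
      else arcs classPair x σ ((σ ^ m) (σ e)) ((σ ^ m) (σ ((σ ^ d) e)))) ∧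
    IsReduced (δ₁ (o : Cycle (Letter n)) (path σ x e L) d (m + 2)) ∧
    IsReduced (δ₂ (o : Cycle (Letter n)) (path σ x e L) d (m + 2)) := by
  have e1 : m + 2 - 1 = m + 1 := rfl
  have e2 : d + (m + 2) - 1 = d + m + 1 := rfl
  have e3 : d + 2 - (m + 2) = d - m := by omega
  have e4 : L + 2 - (d + (m + 2)) = L - (d + m) := by omega
  have e5 : (σ ^ m) (σ e) = (σ ^ (m + 1)) e := by rw [pow_succ, Perm.mul_apply]
  have h₁ (g : FreeGroup (Fin n)) : classPair 1 g = 0 := by simp [classPair]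
  simp only [δ₁, δ₂, take_path _ _ _ hL, rotate_path x e hσ, length_path, e1, e2, e3, e4, e5]
  split_ifs with h₃
  · obtain ⟨c1, c2⟩ := chain_of_linked₃_self hx hσ hd h₃
    obtain ⟨hdm, hdL⟩ := le_of_linked₃ hx hσ hd h₃
    rw [take_path _ _ _ (by omega), take_path _ _ _ (by omega)]
    have n1 := path_ne_nil σ x ((σ ^ (m + 1)) e) (a := d - m) (by omega)
    have n2 := path_ne_nil σ x ((σ ^ (d + m + 1)) e) (a := L - (d + m)) (by omega)
    refine ⟨?_, isReduced_of_chain n1 c1, isReduced_of_chain n2 c2⟩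
    rw [linked₃_path_iff, strip_anti_iff] at h₃
    have e6 : σ ((σ ^ d) e) = (σ ^ (d - m)) ((σ ^ (m + 1)) e) := by
      rw [← Perm.mul_apply, ← Perm.mul_apply, ← pow_succ', ← pow_add]
      congr 2
      omega
    rw [e6, arcs_path h₁ x (by omega) (hc _), ← classPair_mk n1 n2 c1 c2, ← e6]
    -- the second loop runs back along the strip at both of its ends
    have e7 : path σ x (σ ((σ ^ d) e)) (L - (d - m)) =
        FreeGroup.invRev (path σ x (σ e) m) ++
          (path σ x ((σ ^ (d + m + 1)) e) (L - (d + m)) ++ path σ x (σ e) m) := by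
      rw [show L - (d - m) = m + ((L - (d + m)) + m) by omega, path_add, path_add,
        ← (path_eq_invRev_path_iff σ σ x x (σ e) (σ ((σ ^ d) e)) m).2 h₃.1.2.2.1]
      simp only [← Perm.mul_apply, ← pow_succ', ← pow_add]
      rw [show m + (d + 1) = d + m + 1 by omega,
        show L - (d + m) + (d + m + 1) = 1 + L by omega, pow_add σ 1 L, hσ, mul_one, pow_one]
    rw [e7, mk_append, mk_append, ← FreeGroup.inv_mk]
    have := classPair_conj 1 (FreeGroup.mk (path σ x (σ e) m))⁻¹
      (FreeGroup.mk (path σ x ((σ ^ (m + 1)) e) (d - m)))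
      (FreeGroup.mk (path σ x ((σ ^ (d + m + 1)) e) (L - (d + m))))
    rw [← this, one_mul, inv_one, mul_one, inv_inv, mul_assoc]
  · obtain ⟨c1, c2⟩ := chain_of_not_linked₃ ho hm hx hσ hd h h₃
    have hd0 := ne_zero_of_not_linked₃ ho hm h h₃
    rw [take_path _ _ _ hd.le, take_path _ _ _ (by omega)]
    have n1 := path_ne_nil σ x ((σ ^ (m + 1)) e) (a := d) hd0
    have n2 := path_ne_nil σ x ((σ ^ (d + m + 1)) e) (a := L - d) (by omega)
    refine ⟨?_, isReduced_of_chain n1 c1, isReduced_of_chain n2 c2⟩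
    have e6 : (σ ^ m) (σ ((σ ^ d) e)) = (σ ^ d) ((σ ^ (m + 1)) e) := by
      simp only [← Perm.mul_apply, ← pow_succ', ← pow_add]
      congr 2
      omega
    rw [e6, arcs_path h₁ x hd (hc _), ← classPair_mk n1 n2 c1 c2, ← Perm.mul_apply, ← pow_add,
      show d + (m + 1) = d + m + 1 by omega]

end Summands

/-! ### Cyclic words as curves -/

section FinRotate
open Equiv Equiv.Perm
variable {n : ℕ}

theorem val_finRotate_pow {L : ℕ} (i : Fin L) (m : ℕ) :
    (((finRotate L ^ m) i : Fin L) : ℕ) = (i + m) % L := by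
  induction m with
  | zero => rw [pow_zero, Perm.one_apply, add_zero, Nat.mod_eq_of_lt i.2]
  | succ m ih =>
    have := i.neZero
    rw [pow_succ', Perm.mul_apply, finRotate_apply, Fin.val_add, ih, Fin.val_one', ← Nat.add_mod,
      add_assoc]

theorem finRotate_pow_self (L : ℕ) : finRotate L ^ L = 1 := by
  ext i
  rw [val_finRotate_pow, Nat.add_mod_right, Nat.mod_eq_of_lt i.2, Perm.one_apply]

theorem path_finRotate {X : Type*} (v : List X) (i : Fin v.length) :
    path (finRotate v.length) v.get i v.length = v.rotate i := by
  refine List.ext_getElem (by simp) fun t h1 h2 => ?_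
  rw [getElem_path, List.getElem_rotate, List.get_eq_getElem]
  simp only [val_finRotate_pow, add_comm]

theorem cycleList_finRotate {L : ℕ} (i : Fin L) :
    cycleList (finRotate L) i = path (finRotate L) id i L := by
  refine cycleList_eq_path i.pos (by rw [finRotate_pow_self, Perm.one_apply]) ?_
  intro s hs t ht h
  have h := congrArg Fin.val h
  rw [val_finRotate_pow, val_finRotate_pow] at h
  have h' : s ≡ t [MOD L] := Nat.ModEq.add_left_cancel' _ h
  rwa [Nat.ModEq, Nat.mod_eq_of_lt hs, Nat.mod_eq_of_lt ht] at h'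

theorem exists_finRotate_pow_eq {L : ℕ} (i j : Fin L) : ∃ t < L, (finRotate L ^ t) i = j := by
  refine ⟨(L - i + j) % L, Nat.mod_lt _ i.pos, ?_⟩
  ext
  rw [val_finRotate_pow, Nat.add_mod_mod, show (i : ℕ) + (L - i + j) = j + L by omega,
    Nat.add_mod_right, Nat.mod_eq_of_lt j.2]

theorem cyc_finRotate {L : ℕ} (i : Fin L) : cyc (finRotate L) i = Finset.univ := by
  ext j
  obtain ⟨t, -, ht⟩ := exists_finRotate_pow_eq i j
  simp only [mem_cyc, Finset.mem_univ, iff_true]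
  exact ⟨t, by simpa using ht⟩

theorem sameCycle_finRotate {L : ℕ} (i j : Fin L) : (finRotate L).SameCycle i j := by
  rw [← mem_cyc, cyc_finRotate]
  exact Finset.mem_univ _

theorem sum_finRotate_pow {M : Type*} [AddCommMonoid M] {L : ℕ} (i : Fin L) (G : Fin L → M) :
    ∑ d ∈ Finset.range L, G ((finRotate L ^ d) i) = ∑ j, G j := by
  have h : ∀ k, (path (finRotate L) G i k).sum =
      ∑ d ∈ Finset.range k, G ((finRotate L ^ d) i) := by
    intro k
    induction k with
    | zero => rfl
    | succ k ih => rw [path_succ', List.sum_append, ih, Finset.sum_range_succ, List.sum_singleton]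
  rw [← cyc_finRotate i, sum_cyc, cycleList_finRotate, map_path, ← h]
  rfl

theorem hol_finRotate {L : ℕ} (x : Fin L → Letter n) (i : Fin L) :
    hol x (finRotate L) i = FreeGroup.mk (path (finRotate L) x i L) := by
  rw [hol, cycleList_finRotate, map_path]
  rfl

theorem coe_rotate_eq {X : Type*} (v : List X) (i : ℕ) : ((v.rotate i : List X) : Cycle X) = v :=
  Cycle.coe_eq_coe.2 ⟨v.length - i % v.length, by
    rw [← List.rotate_mod v i, List.rotate_rotate]
    obtain h | h := Nat.eq_zero_or_pos v.length
    · rw [List.length_eq_zero_iff.1 h]; simp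
    · rw [Nat.add_sub_cancel' (Nat.mod_lt i h).le, List.rotate_length]⟩

theorem rel_of_chain_path {E X : Type*} [Fintype E] {R : X → X → Prop} {σ : Perm E} {x : E → X}
    {e : E} {L : ℕ} (hL : 0 < L) (he : (σ ^ L) e = e) (h : (path σ x e L : Cycle X).Chain R) :
    R (x e) (x (σ e)) := by
  obtain ⟨k, rfl⟩ : ∃ k, L = k + 1 := ⟨L - 1, by omega⟩
  have h2 : path σ x e (k + 1) ++ [x e] = path σ x e (k + 2) := by
    rw [path_succ' _ _ _ (k + 1), he]
  rw [path_succ, Cycle.chain_coe_cons, ← List.cons_append, ← path_succ, h2, path_succ, path_succ,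
    List.isChain_cons_cons] at h
  exact h.1

theorem get_finRotate_ne {v : List (Letter n)} (hv : IsReduced (v : Cycle (Letter n)))
    (i : Fin v.length) : v.get (finRotate v.length i) ≠ bar (v.get i) := by
  have h := ((isReduced_iff_cycle_chain _).1 hv).2
  rw [← coe_rotate_eq v i, ← path_finRotate] at h
  exact rel_of_chain_path i.pos (by rw [finRotate_pow_self, Perm.one_apply]) h

theorem length_pos_of_isReduced {v : List (Letter n)} (hv : IsReduced (v : Cycle (Letter n))) :
    0 < v.length := by
  rw [List.length_pos_iff]
  rintro rfl
  exact hv.1 rfl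

/-- A sum over all linear representatives of a cyclic word, counted with multiplicity. -/
theorem sum_map_lists {X M : Type*} [AddCommMonoid M] {v : List X} (hv : v ≠ []) (G : List X → M) :
    ((v : Cycle X).lists.map G).sum = ∑ i : Fin v.length, G (v.rotate i) := by
  have h : v.cyclicPermutations = List.ofFn fun i : Fin v.length => v.rotate i := by
    refine List.ext_getElem (by simp [List.length_cyclicPermutations_of_ne_nil v hv]) ?_
    intro i h1 h2
    rw [List.getElem_cyclicPermutations, List.getElem_ofFn]
  rw [Cycle.lists_coe, h, Multiset.map_coe, Multiset.sum_coe, List.map_ofFn, List.sum_ofFn]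
  rfl

end FinRotate

/-! ### The bracket of reduced cyclic words -/

section Words
open Equiv Equiv.Perm
variable {n : ℕ} (𝕜 : Type*) [CommRing 𝕜]

open Classical in
/-- The bracket of two words, as a sum over the pairs of paths along them. The middle part of a
linked pair is shorter than the product of the lengths, which is a common period. -/
theorem bracketWord_eq (O : Cycle (Letter n)) {v w : List (Letter n)}
    (hv : IsReduced (v : Cycle (Letter n))) (hw : IsReduced (w : Cycle (Letter n))) :
    bracketWord 𝕜 O v w = ∑ i : Fin v.length, ∑ j : Fin w.length,
      ∑ m ∈ Finset.range (v.length * w.length),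
      if Linked O (path (finRotate v.length) v.get i (m + 2))
        (path (finRotate w.length) w.get j (m + 2)) then
      sign O (path (finRotate v.length) v.get i (m + 2))
        (path (finRotate w.length) w.get j (m + 2)) •
        word 𝕜 (γ O (v.rotate i) (w.rotate j) (m + 2)) else 0 := by
  have hv0 := length_pos_of_isReduced hv
  have hw0 := length_pos_of_isReduced hw
  rw [bracketWord, sum_map_lists (List.length_pos_iff.1 hv0)]
  refine Finset.sum_congr rfl fun i _ => ?_
  rw [sum_map_lists (List.length_pos_iff.1 hw0)]
  refine Finset.sum_congr rfl fun j _ => ?_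
  have hL (k : ℕ) : LP₂ O (v.rotate i) (w.rotate j) k ↔
      Linked O (path (finRotate v.length) v.get i k) (path (finRotate w.length) w.get j k) := by
    rw [LP₂, ← path_finRotate, ← path_finRotate, powTake_path _ _ hv0 (finRotate_pow_self _),
      powTake_path _ _ hw0 (finRotate_pow_self _)]
  have hs (k : ℕ) : sign O (powTake (v.rotate i) k) (powTake (w.rotate j) k) =
      sign O (path (finRotate v.length) v.get i k) (path (finRotate w.length) w.get j k) := by
    rw [← path_finRotate, ← path_finRotate, powTake_path _ _ hv0 (finRotate_pow_self _),
      powTake_path _ _ hw0 (finRotate_pow_self _)]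
  simp only [hL, hs, Int.cast_smul_eq_zsmul]
  rw [finsum_mem_def, finsum_eq_sum_of_support_subset (s :=
    (Finset.range (v.length * w.length)).image (· + 2)), Finset.sum_image (by simp)]
  · rfl
  · intro k hk
    have hk : Linked O (path (finRotate v.length) v.get i k)
        (path (finRotate w.length) w.get j k) := by
      by_contra h
      exact hk (if_neg h)
    have h2 : 2 ≤ k := by simpa using hk.2.2.1
    obtain ⟨m, rfl⟩ : ∃ m, k = m + 2 := ⟨k - 2, by omega⟩
    have := lt_of_linked_path (Nat.mul_pos hv0 hw0)
      (by rw [pow_mul, finRotate_pow_self, one_pow])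
      (by rw [mul_comm, pow_mul, finRotate_pow_self, one_pow]) hk
    simpa using this

open Classical in
/-- The formal bracket of two reduced cyclic words is twice the sum over their linked pairs. -/
theorem formalBracket_mk {o : List (Letter n)} (ho : o.Nodup) (hm : ∀ x, x ∈ o)
    {v w : List (Letter n)} (hv : IsReduced (v : Cycle (Letter n)))
    (hw : IsReduced (w : Cycle (Letter n))) :
    formalBracket o (FreeGroup.mk v) (FreeGroup.mk w) =
      (2 : ℤ) • ∑ i : Fin v.length, ∑ j : Fin w.length,
      ∑ m ∈ Finset.range (v.length * w.length),
      if Linked (o : Cycle (Letter n)) (path (finRotate v.length) v.get i (m + 2))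
        (path (finRotate w.length) w.get j (m + 2)) then
      sign (o : Cycle (Letter n)) (path (finRotate v.length) v.get i (m + 2))
        (path (finRotate w.length) w.get j (m + 2)) •
        Finsupp.single (γ (o : Cycle (Letter n)) (v.rotate i) (w.rotate j) (m + 2)) 1 else 0 := by
  have hv0 := length_pos_of_isReduced hv
  have hw0 := length_pos_of_isReduced hw
  have hhol {u : List (Letter n)} (hu : 0 < u.length) :
      FreeGroup.mk u = hol u.get (finRotate u.length) ⟨0, hu⟩ := by
    rw [hol_finRotate, path_finRotate, List.rotate_zero]
  rw [hhol hv0, hhol hw0, formalBracket_hol, cyc_finRotate, cyc_finRotate,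
    sum_halfCross_eq_sum_linked ho hm (finRotate v.length) (finRotate w.length) v.get w.get
      (Nat.mul_pos hv0 hw0) (by rw [pow_mul, finRotate_pow_self, one_pow])
      (by rw [mul_comm, pow_mul, finRotate_pow_self, one_pow])
      (get_finRotate_ne hv) (get_finRotate_ne hw)]
  · congr 1
    refine Finset.sum_congr rfl fun i _ => Finset.sum_congr rfl fun j _ =>
      Finset.sum_congr rfl fun m _ => ?_
    split_ifs with h h3
    · have := (γ_path ho hm (get_finRotate_ne hv) (get_finRotate_ne hw) hv0 hw0
        (finRotate_pow_self _) (finRotate_pow_self _) h).1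
      rw [path_finRotate, path_finRotate, if_pos h3, ← hol_finRotate, ← hol_finRotate] at this
      rw [this]
    · have := (γ_path ho hm (get_finRotate_ne hv) (get_finRotate_ne hw) hv0 hw0
        (finRotate_pow_self _) (finRotate_pow_self _) h).1
      rw [path_finRotate, path_finRotate, if_neg h3, ← hol_finRotate, ← hol_finRotate] at this
      rw [this]
    · rfl
  · intro e f h
    rw [single_mul_parallel _ _ _ _ h]
  · intro e f h
    rw [single_mul_antiparallel _ _ _ _ h]

/-- The vector in `𝕍` of a formal sum of cyclic words. -/
noncomputable def wordHom : (Cycle (Letter n) →₀ ℤ) →+ V 𝕜 n :=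
  Finsupp.liftAddHom fun c => (AddMonoidHom.flip (smulAddHom ℤ (V 𝕜 n))) (word 𝕜 c)

theorem wordHom_single (c : Cycle (Letter n)) (k : ℤ) :
    wordHom 𝕜 (Finsupp.single c k) = k • word 𝕜 c := by
  simp [wordHom]

/-- The vector in `𝕍 ⊗ 𝕍` of a formal sum of pairs of cyclic words. -/
noncomputable def wordPairHom :
    ((Cycle (Letter n) × Cycle (Letter n)) →₀ ℤ) →+ V 𝕜 n ⊗[𝕜] V 𝕜 n :=
  Finsupp.liftAddHom fun c =>
    (AddMonoidHom.flip (smulAddHom ℤ (V 𝕜 n ⊗[𝕜] V 𝕜 n))) (word 𝕜 c.1 ⊗ₜ[𝕜] word 𝕜 c.2)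

theorem wordPairHom_single (c : Cycle (Letter n) × Cycle (Letter n)) (k : ℤ) :
    wordPairHom 𝕜 (Finsupp.single c k) = k • (word 𝕜 c.1 ⊗ₜ[𝕜] word 𝕜 c.2) := by
  simp [wordPairHom]

/-- The bracket of two cyclic words is half of their formal bracket. -/
theorem bracketWord_eq_wordHom {o : List (Letter n)} (ho : o.Nodup) (hm : ∀ x, x ∈ o)
    {v w : List (Letter n)} (hv : IsReduced (v : Cycle (Letter n)))
    (hw : IsReduced (w : Cycle (Letter n))) {S : Cycle (Letter n) →₀ ℤ}
    (hS : (2 : ℤ) • S = formalBracket o (FreeGroup.mk v) (FreeGroup.mk w)) :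
    bracketWord 𝕜 (o : Cycle (Letter n)) v w = wordHom 𝕜 S := by
  classical
  rw [formalBracket_mk ho hm hv hw] at hS
  have hS := smul_right_injective _ (two_ne_zero' ℤ) hS
  rw [hS, bracketWord_eq 𝕜 _ hv hw]
  simp only [map_sum]
  refine Finset.sum_congr rfl fun i _ => Finset.sum_congr rfl fun j _ =>
      Finset.sum_congr rfl fun m _ => ?_
  split_ifs
  · rw [map_zsmul, wordHom_single, one_smul]
  · rw [map_zero]

end Words

/-! ### The cobracket of reduced cyclic words -/

section CobracketWords
open Equiv Equiv.Perm
variable {n : ℕ} (𝕜 : Type*) [CommRing 𝕜]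

/-- Linked subwords of one cyclic word are not longer than the cyclic word. -/
theorem add_two_le_of_linked {E : Type*} [Fintype E] {o : List (Letter n)} (ho : o.Nodup)
    (hm : ∀ x, x ∈ o) {σ : Perm E} {x : E → Letter n} (hx : ∀ e, x (σ e) ≠ bar (x e)) {e : E}
    {d m L : ℕ} (hd : d < L) (hσ : σ ^ L = 1) (hL : ∀ g, ∃ t < L, (σ ^ t) e = g)
    (h : Linked (o : Cycle (Letter n)) (path σ x e (m + 2)) (path σ x ((σ ^ d) e) (m + 2))) :
    m + 2 ≤ L := by
  by_cases h₃ : Linked₃ (o : Cycle (Letter n)) (path σ x e (m + 2)) (path σ x ((σ ^ d) e) (m + 2))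
  · have := le_of_linked₃ hx hσ hd h₃
    omega
  have hd0 := ne_zero_of_not_linked₃ ho hm h h₃
  obtain ⟨-, -, -, -, h | h | h⟩ := h
  · rw [linked₁_path_iff] at h
    omega
  · rw [linked₂_path_iff] at h
    have := h.1.add_one_lt hL
    omega
  · exact absurd h h₃

theorem intCast_smul_tmul {A : Type*} [AddCommGroup A] [Module 𝕜 A] (z : ℤ) (a b : A) :
    (z : 𝕜) • (a ⊗ₜ[𝕜] b) = z • (a ⊗ₜ[𝕜] b) := by
  rw [TensorProduct.smul_tmul', TensorProduct.smul_tmul', Int.cast_smul_eq_zsmul]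

open Classical in
/-- The cobracket of a word, as a sum over the pairs of paths along it. -/
theorem cobracketWord_eq (O : Cycle (Letter n)) {v : List (Letter n)}
    (hv : IsReduced (v : Cycle (Letter n))) :
    cobracketWord 𝕜 O v = ∑ i : Fin v.length, ∑ d ∈ Finset.range v.length,
      ∑ m ∈ Finset.range (v.length - 1),
      if Linked O (path (finRotate v.length) v.get i (m + 2))
        (path (finRotate v.length) v.get ((finRotate v.length ^ d) i) (m + 2)) then
      sign O (path (finRotate v.length) v.get i (m + 2))
        (path (finRotate v.length) v.get ((finRotate v.length ^ d) i) (m + 2)) •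
        (word 𝕜 (δ₁ O (v.rotate i) d (m + 2)) ⊗ₜ[𝕜] word 𝕜 (δ₂ O (v.rotate i) d (m + 2)))
      else 0 := by
  have hv0 := length_pos_of_isReduced hv
  rw [cobracketWord, sum_map_lists (List.length_pos_iff.1 hv0)]
  refine Finset.sum_congr rfl fun i _ => ?_
  rw [List.length_rotate]
  refine Finset.sum_congr rfl fun d hd => ?_
  have hno (k : ℕ) (hk : k < 2) : ¬LP₁ O (v.rotate i) d k := by
    rintro ⟨-, -, -, -, h, -⟩
    rw [List.length_take] at h
    omega
  -- Subwords of length less than `2` are not linked.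
  rw [show v.length + 1 = (v.length - 1) + 1 + 1 by omega, Finset.sum_range_succ',
    Finset.sum_range_succ', if_neg (hno 0 (by omega)), if_neg (hno (0 + 1) (by omega)), add_zero,
    add_zero]
  refine Finset.sum_congr rfl fun m hmL => ?_
  have hd := Finset.mem_range.1 hd
  have hmL := Finset.mem_range.1 hmL
  have t1 : (v.rotate i).take (m + 2) = path (finRotate v.length) v.get i (m + 2) := by
    rw [← path_finRotate, take_path _ _ _ (by omega)]
  have t2 : ((v.rotate i).rotate d).take (m + 2) =
      path (finRotate v.length) v.get ((finRotate v.length ^ d) i) (m + 2) := by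
    rw [← path_finRotate, rotate_path _ _ (finRotate_pow_self _), take_path _ _ _ (by omega)]
  have hL : LP₁ O (v.rotate i) d (m + 2) ↔
      Linked O (path (finRotate v.length) v.get i (m + 2))
        (path (finRotate v.length) v.get ((finRotate v.length ^ d) i) (m + 2)) := by
    rw [LP₁, t1, t2, List.length_rotate]
    exact ⟨fun h => h.2.2, fun h => ⟨hd, by omega, h⟩⟩
  change (if LP₁ O (v.rotate i) d (m + 2) then ((sign O ((v.rotate i).take (m + 2))
    (((v.rotate i).rotate d).take (m + 2)) : ℤ) : 𝕜) • _ else 0) = _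
  rw [t1, t2, intCast_smul_tmul]
  exact if_congr hL rfl rfl

open Classical in
/-- The formal cobracket of a reduced cyclic word is twice the sum over its linked pairs. -/
theorem formalCobracket_mk {o : List (Letter n)} (ho : o.Nodup) (hm : ∀ x, x ∈ o)
    {v : List (Letter n)} (hv : IsReduced (v : Cycle (Letter n))) :
    formalCobracket o (FreeGroup.mk v) =
      (2 : ℤ) • ∑ i : Fin v.length, ∑ d ∈ Finset.range v.length,
      ∑ m ∈ Finset.range (v.length - 1),
      if Linked (o : Cycle (Letter n)) (path (finRotate v.length) v.get i (m + 2))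
        (path (finRotate v.length) v.get ((finRotate v.length ^ d) i) (m + 2)) then
      sign (o : Cycle (Letter n)) (path (finRotate v.length) v.get i (m + 2))
        (path (finRotate v.length) v.get ((finRotate v.length ^ d) i) (m + 2)) •
        Finsupp.single (δ₁ (o : Cycle (Letter n)) (v.rotate i) d (m + 2),
          δ₂ (o : Cycle (Letter n)) (v.rotate i) d (m + 2)) 1
      else 0 := by
  have hv0 := length_pos_of_isReduced hv
  have hhol : FreeGroup.mk v = hol v.get (finRotate v.length) ⟨0, hv0⟩ := by
    rw [hol_finRotate, path_finRotate, List.rotate_zero]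
  rw [hhol, formalCobracket_hol, cyc_finRotate,
    sum_halfCross_eq_sum_linked ho hm (finRotate v.length) (finRotate v.length) v.get v.get
      hv0 (finRotate_pow_self _) (finRotate_pow_self _) (get_finRotate_ne hv) (get_finRotate_ne hv)
      (arcs classPair v.get (finRotate v.length))]
  · congr 1
    refine Finset.sum_congr rfl fun i _ => ?_
    rw [← sum_finRotate_pow i]
    refine Finset.sum_congr rfl fun d hd => ?_
    have hd := Finset.mem_range.1 hd
    have hle {m : ℕ} (h : Linked (o : Cycle (Letter n))
        (path (finRotate v.length) v.get i (m + 2))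
        (path (finRotate v.length) v.get ((finRotate v.length ^ d) i) (m + 2))) :
        m + 2 ≤ v.length := add_two_le_of_linked ho hm (get_finRotate_ne hv) hd
          (finRotate_pow_self _) (exists_finRotate_pow_eq i) h
    -- The general comparison bounds the middle part by the length of the word; linked subwords are
    -- shorter.
    conv_lhs => rw [show Finset.range v.length = Finset.range (v.length - 1 + 1) by
      rw [Nat.sub_add_cancel hv0]]
    rw [Finset.sum_range_succ, if_neg (fun h => by have := hle h; omega), add_zero]
    refine Finset.sum_congr rfl fun m _ => ?_
    by_cases h : Linked (o : Cycle (Letter n))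
        (path (finRotate v.length) v.get i (m + 2))
        (path (finRotate v.length) v.get ((finRotate v.length ^ d) i) (m + 2))
    · rw [if_pos h, if_pos h]
      have := (δ_path ho hm (get_finRotate_ne hv) hd (hle h) (finRotate_pow_self _)
        cycleList_finRotate h).1
      rw [path_finRotate] at this
      rw [this]
    · rw [if_neg h, if_neg h]
  · intro e f h
    exact arcs_parallel _ _ (sameCycle_finRotate e f) h
  · intro e f h
    exact arcs_antiparallel _ _ (sameCycle_finRotate e f) h

/-- The cobracket of a cyclic word is half of its formal cobracket. -/
theorem cobracketWord_eq_wordPairHom {o : List (Letter n)} (ho : o.Nodup) (hm : ∀ x, x ∈ o)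
    {v : List (Letter n)} (hv : IsReduced (v : Cycle (Letter n)))
    {S : (Cycle (Letter n) × Cycle (Letter n)) →₀ ℤ}
    (hS : (2 : ℤ) • S = formalCobracket o (FreeGroup.mk v)) :
    cobracketWord 𝕜 (o : Cycle (Letter n)) v = wordPairHom 𝕜 S := by
  classical
  rw [formalCobracket_mk ho hm hv] at hS
  have hS := smul_right_injective _ (two_ne_zero' ℤ) hS
  rw [hS, cobracketWord_eq 𝕜 _ hv]
  simp only [map_sum]
  refine Finset.sum_congr rfl fun i _ => Finset.sum_congr rfl fun d _ =>
      Finset.sum_congr rfl fun m _ => ?_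
  split_ifs
  · rw [map_zsmul, wordPairHom_single, one_smul]
  · rw [map_zero]

/-- The cyclic words in the cobracket of a reduced cyclic word are reduced. -/
theorem isReduced_δ {o : List (Letter n)} (ho : o.Nodup) (hm : ∀ x, x ∈ o) {u : List (Letter n)}
    {d k : ℕ} (hu : IsReduced (u : Cycle (Letter n))) (h : LP₁ (o : Cycle (Letter n)) u d k) :
    IsReduced (δ₁ (o : Cycle (Letter n)) u d k) ∧ IsReduced (δ₂ (o : Cycle (Letter n)) u d k) := by
  have hu0 := length_pos_of_isReduced hu
  obtain ⟨hd, hk, h⟩ := h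
  have h2 : 2 ≤ k := by
    have := h.2.2.1
    rw [List.length_take] at this
    omega
  obtain ⟨m, rfl⟩ : ∃ m, k = m + 2 := ⟨k - 2, by omega⟩
  have hp : path (finRotate u.length) u.get ⟨0, hu0⟩ u.length = u := by
    rw [path_finRotate, List.rotate_zero]
  have := (δ_path ho hm (get_finRotate_ne hu) (e := ⟨0, hu0⟩) hd hk (finRotate_pow_self _)
    cycleList_finRotate ?_).2
  · rwa [hp] at this
  · rw [← take_path _ _ _ hk, ← take_path _ _ ((finRotate u.length ^ d) _) hk,
      ← rotate_path _ _ (finRotate_pow_self _), hp]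
    exact h

/-- The bracket of two reduced cyclic words is a finite sum of reduced cyclic words. -/
theorem finite_and_isReduced_γ {o : List (Letter n)} (ho : o.Nodup) (hm : ∀ x, x ∈ o)
    {v w : List (Letter n)} (hv : IsReduced (v : Cycle (Letter n)))
    (hw : IsReduced (w : Cycle (Letter n))) :
    {k : ℕ | LP₂ (o : Cycle (Letter n)) v w k}.Finite ∧
      ∀ k : ℕ, LP₂ (o : Cycle (Letter n)) v w k → IsReduced (γ (o : Cycle (Letter n)) v w k) := by
  have hv0 := length_pos_of_isReduced hv
  have hw0 := length_pos_of_isReduced hw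
  have hp {u : List (Letter n)} (hu : 0 < u.length) :
      path (finRotate u.length) u.get ⟨0, hu⟩ u.length = u := by
    rw [path_finRotate, List.rotate_zero]
  have key (k : ℕ) (hk : LP₂ (o : Cycle (Letter n)) v w k) : ∃ m, k = m + 2 ∧
      Linked (o : Cycle (Letter n)) (path (finRotate v.length) v.get ⟨0, hv0⟩ (m + 2))
        (path (finRotate w.length) w.get ⟨0, hw0⟩ (m + 2)) := by
    rw [LP₂, ← hp hv0, ← hp hw0, powTake_path _ _ hv0 (finRotate_pow_self _),
      powTake_path _ _ hw0 (finRotate_pow_self _)] at hk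
    have h2 : 2 ≤ k := by simpa using hk.2.2.1
    obtain ⟨m, rfl⟩ : ∃ m, k = m + 2 := ⟨k - 2, by omega⟩
    exact ⟨m, rfl, hk⟩
  constructor
  · refine (Set.finite_lt_nat (v.length * w.length + 2)).subset fun k hk => ?_
    obtain ⟨m, rfl, h⟩ := key k hk
    have := lt_of_linked_path (Nat.mul_pos hv0 hw0)
      (by rw [pow_mul, finRotate_pow_self, one_pow])
      (by rw [mul_comm, pow_mul, finRotate_pow_self, one_pow]) h
    simpa using this
  · intro k hk
    obtain ⟨m, rfl, h⟩ := key k hk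
    have := (γ_path ho hm (get_finRotate_ne hv) (get_finRotate_ne hw) hv0 hw0
        (finRotate_pow_self _) (finRotate_pow_self _) h).2
    rwa [hp hv0, hp hw0] at this

end CobracketWords

/-! ### Bracket and cobracket of curves -/

section Curves
open Equiv Equiv.Perm
variable {n : ℕ} (𝕜 : Type*) [CommRing 𝕜]

theorem word_nil : word 𝕜 (Cycle.nil : Cycle (Letter n)) = 0 :=
  dif_neg fun h => h.1 rfl

theorem word_of_isReduced {c : Cycle (Letter n)} (h : IsReduced c) :
    word 𝕜 c = Finsupp.single ⟨c, h⟩ 1 := dif_pos h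

theorem bracket_word (O : Cycle (Letter n)) {c d : Cycle (Letter n)} (hc : IsReduced c)
    (hd : IsReduced d) : bracket 𝕜 O (word 𝕜 c ⊗ₜ[𝕜] word 𝕜 d) = bracketWord 𝕜 O c d := by
  rw [word_of_isReduced 𝕜 hc, word_of_isReduced 𝕜 hd, bracket, TensorProduct.lift.tmul,
    Finsupp.linearCombination_single, one_smul, Finsupp.linearCombination_single, one_smul]

theorem cobracket_word (O : Cycle (Letter n)) {c : Cycle (Letter n)} (hc : IsReduced c) :
    cobracket 𝕜 O (word 𝕜 c) = cobracketWord 𝕜 O c := by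
  rw [word_of_isReduced 𝕜 hc, cobracket, Finsupp.linearCombination_single, one_smul]

/-- The bracket of two conjugacy classes, trivial or not, is half of their formal bracket. -/
theorem bracket_word_cycleOf {o : List (Letter n)} (ho : o.Nodup) (hm : ∀ x, x ∈ o)
    (g h : FreeGroup (Fin n)) {S : Cycle (Letter n) →₀ ℤ} (hS : (2 : ℤ) • S = formalBracket o g h) :
    bracket 𝕜 (o : Cycle (Letter n)) (word 𝕜 (cycleOf g) ⊗ₜ[𝕜] word 𝕜 (cycleOf h)) =
      wordHom 𝕜 S := by
  -- The trivial class is represented by the empty cyclic word, which stands for the vector `0`.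
  have hzero (h0 : (2 : ℤ) • S = 0) : S = 0 := by simpa using h0
  by_cases hg : g = 1
  · subst hg
    rw [formalBracket_one_left] at hS
    rw [hzero hS, cycleOf_one, word_nil, TensorProduct.zero_tmul, map_zero, map_zero]
  by_cases hh : h = 1
  · subst hh
    rw [formalBracket_one_right] at hS
    rw [hzero hS, cycleOf_one, word_nil, TensorProduct.tmul_zero, map_zero, map_zero]
  have hg' := isReduced_cycleOf hg
  have hh' := isReduced_cycleOf hh
  rw [bracket_word 𝕜 _ hg' hh']
  obtain ⟨c, hc⟩ := exists_conj_reduceCyclically g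
  obtain ⟨d, hd⟩ := exists_conj_reduceCyclically h
  refine bracketWord_eq_wordHom 𝕜 ho hm hg' hh' ?_
  rw [hS]
  conv_lhs => rw [hc, hd, formalBracket_conj]

/-- The cobracket of a conjugacy class, trivial or not, is half of its formal cobracket. -/
theorem cobracket_word_cycleOf {o : List (Letter n)} (ho : o.Nodup) (hm : ∀ x, x ∈ o)
    (g : FreeGroup (Fin n)) {S : (Cycle (Letter n) × Cycle (Letter n)) →₀ ℤ}
    (hS : (2 : ℤ) • S = formalCobracket o g) :
    cobracket 𝕜 (o : Cycle (Letter n)) (word 𝕜 (cycleOf g)) = wordPairHom 𝕜 S := by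
  by_cases hg : g = 1
  · subst hg
    rw [formalCobracket_one] at hS
    have hS : S = 0 := by simpa using hS
    rw [hS, cycleOf_one, word_nil, map_zero, map_zero]
  have hg' := isReduced_cycleOf hg
  rw [cobracket_word 𝕜 _ hg']
  obtain ⟨c, hc⟩ := exists_conj_reduceCyclically g
  refine cobracketWord_eq_wordPairHom 𝕜 ho hm hg' ?_
  rw [hS]
  conv_lhs => rw [hc, formalCobracket_conj]

/-- The trivial class contributes the vector `0` to `𝕍`, which fits with `classPair`. -/
theorem wordPairHom_classPair (g h : FreeGroup (Fin n)) :
    wordPairHom 𝕜 (classPair g h) = word 𝕜 (cycleOf g) ⊗ₜ[𝕜] word 𝕜 (cycleOf h) := by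
  rw [classPair]
  split_ifs with h1
  · rw [map_zero]
    obtain rfl | rfl := h1 <;> simp [cycleOf_one, word_nil]
  · rw [wordPairHom_single, one_smul]

variable {E : Type*}

theorem cycleOf_hol_eq [Fintype E] (x : E → Letter n) {σ : Perm E} {a b : E} (h : σ.SameCycle a b) :
    cycleOf (hol x σ a) = cycleOf (hol x σ b) := by
  obtain ⟨i, -, rfl⟩ := h.exists_pow_eq'
  induction i with
  | zero => rfl
  | succ i ih =>
    rw [ih ⟨i, by simp⟩, pow_succ', Perm.mul_apply, hol_apply, rot,
      ← cycleOf_conj (FreeGroup.mk [x ((σ ^ i) a)])⁻¹, inv_inv]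

/-- The bracket and the cobracket are given by smoothing crossings of curves in general position. -/
theorem realizes [Fintype E] [DecidableEq E] {o : List (Letter n)} (ho : o.Nodup) (hm : ∀ x, x ∈ o)
    (x : E → Letter n) :
    Realizes (bracket 𝕜 (o : Cycle (Letter n))) (cobracket 𝕜 (o : Cycle (Letter n)))
      (inPoint o x) (outPoint o x) (fun σ e => word 𝕜 (cycleOf (hol x σ e))) where
  cl_eq h := by rw [cycleOf_hol_eq x h]
  cl_swap he hf := by rw [hol, cycleList_swap_of_disjoint he hf, hol]
  br_cl {σ a b} hab := by
    rw [bracket_word_cycleOf 𝕜 ho hm _ _ (two_smul_sum_eps_join hm x hab)]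
    simp only [map_sum, map_zsmul, wordHom_single, one_smul]
    simp only [cyc, Finset.sum_filter, ite_and]
    refine Finset.sum_congr rfl fun e _ => ?_
    by_cases he : σ.SameCycle a e
    · simp only [he, if_true]
      exact Finset.sum_congr rfl fun f _ => by congr
    · simp [he]
  dl_cl σ a := by
    rw [cobracket_word_cycleOf 𝕜 ho hm _ (two_smul_sum_eps_cut hm x σ a)]
    simp only [map_sum, map_zsmul]
    simp only [cyc, Finset.sum_filter]
    refine Finset.sum_congr rfl fun e _ => ?_
    by_cases he : σ.SameCycle a e
    · simp only [he, if_true, true_and]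
      refine Finset.sum_congr rfl fun f _ => ?_
      by_cases hf : σ.SameCycle a f
      · by_cases hef : e = f
        · simp [hef, arcs]
        · simp [hf, hef, arcs, wordPairHom_classPair]
      · simp [hf]
    · simp [he]

/-- Any family of reduced cyclic words is realized by a family of curves. -/
theorem exists_realizes {o : List (Letter n)} (ho : o.Nodup) (hm : ∀ x, x ∈ o) {ι : Type}
    [Fintype ι] [DecidableEq ι] {w : ι → Cycle (Letter n)} (hw : ∀ i, IsReduced (w i)) :
    ∃ (E : Type) (_ : Fintype E) (_ : DecidableEq E) (inn out : E → ℕ ×ₗ ℤ)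
      (cl : Perm E → E → V 𝕜 n) (σ : Perm E) (a : ι → E),
      Realizes (bracket 𝕜 (o : Cycle (Letter n))) (cobracket 𝕜 (o : Cycle (Letter n))) inn out cl ∧
      Generic inn out ∧ (∀ i, cl σ (a i) = word 𝕜 (w i)) ∧
      (∀ i j, i ≠ j → ¬σ.SameCycle (a i) (a j)) ∧ ∀ e, ∃ i, σ.SameCycle (a i) e := by
  have hw' : ∀ i, ∃ l : List (Letter n), (l : Cycle (Letter n)) = w i :=
    fun i => Quot.exists_rep (w i)
  choose l hl using hw'
  have hl0 (i : ι) : 0 < (l i).length := length_pos_of_isReduced (by rw [hl]; exact hw i)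
  let x : (Σ i, Fin (l i).length) → Letter n := fun e => (l e.1).get e.2
  let σ : Perm (Σ i, Fin (l i).length) := Equiv.sigmaCongrRight fun i => finRotate (l i).length
  have hσ (i : ι) (j : Fin (l i).length) (t : ℕ) :
      (σ ^ t) ⟨i, j⟩ = ⟨i, (finRotate (l i).length ^ t) j⟩ := by
    induction t with
    | zero => rfl
    | succ t ih => rw [pow_succ', pow_succ', Perm.mul_apply, ih]; rfl
  have hhol (i : ι) : hol x σ ⟨i, ⟨0, hl0 i⟩⟩ = FreeGroup.mk (l i) := by
    rw [hol, cycleList_eq_path (hl0 i), map_path]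
    · have : path σ (fun e => x (id e)) ⟨i, ⟨0, hl0 i⟩⟩ (l i).length =
          path (finRotate (l i).length) (l i).get ⟨0, hl0 i⟩ (l i).length := by
        simp only [path, hσ]
        rfl
      rw [this, path_finRotate, List.rotate_zero]
    · rw [hσ, finRotate_pow_self, Perm.one_apply]
    · intro s hs t ht h
      rw [hσ, hσ] at h
      have h := congrArg Fin.val (eq_of_heq (Sigma.mk.inj h).2)
      rwa [val_finRotate_pow, val_finRotate_pow, Nat.zero_add, Nat.zero_add, Nat.mod_eq_of_lt hs,
        Nat.mod_eq_of_lt ht] at h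
  refine ⟨Σ i, Fin (l i).length, inferInstance, inferInstance, inPoint o x, outPoint o x,
    fun σ e => word 𝕜 (cycleOf (hol x σ e)), σ, fun i => ⟨i, ⟨0, hl0 i⟩⟩,
    realizes 𝕜 ho hm x, generic_inPoint_outPoint hm x, fun i => ?_, fun i j hij h => ?_, ?_⟩
  · have hc := ((isReduced_iff_cycle_chain _).1 (hw i)).2
    rw [← hl] at hc
    beta_reduce
    rw [hhol, cycleOf_mk hc, hl]
  · obtain ⟨t, -, ht⟩ := h.exists_pow_eq'
    rw [hσ] at ht
    exact hij (congrArg Sigma.fst ht)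
  · rintro ⟨i, j⟩
    obtain ⟨t, -, ht⟩ := exists_finRotate_pow_eq ⟨0, hl0 i⟩ j
    refine ⟨i, t, ?_⟩
    rw [zpow_natCast, hσ, ht]

end Curves

/-! ### The involutive Lie bialgebra -/

section Main
variable {n : ℕ} (𝕜 : Type*) [CommRing 𝕜]

theorem ext_word {M : Type*} [AddCommMonoid M] [Module 𝕜 M] {f g : V 𝕜 n →ₗ[𝕜] M}
    (h : ∀ c, IsReduced c → f (word 𝕜 c) = g (word 𝕜 c)) : f = g := by
  refine Finsupp.lhom_ext' fun c => LinearMap.ext_ring ?_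
  have := h c.1 c.2
  rwa [word_of_isReduced 𝕜 c.2] at this

theorem ext_word_tmul {M N : Type*} [AddCommMonoid M] [Module 𝕜 M] [AddCommMonoid N] [Module 𝕜 N]
    {f g : V 𝕜 n ⊗[𝕜] N →ₗ[𝕜] M} (h : ∀ c, IsReduced c →
      f ∘ₗ TensorProduct.mk 𝕜 _ _ (word 𝕜 c) = g ∘ₗ TensorProduct.mk 𝕜 _ _ (word 𝕜 c)) : f = g :=
  TensorProduct.ext (ext_word 𝕜 h)

/-- Induction over linear combinations of reduced cyclic words. -/
theorem induction_word {p : V 𝕜 n → Prop} (x : V 𝕜 n) (zero : p 0)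
    (add : ∀ x y, p x → p y → p (x + y)) (smul : ∀ (r : 𝕜) x, p x → p (r • x))
    (word : ∀ c, IsReduced c → p (word 𝕜 c)) : p x := by
  induction x using Finsupp.induction_linear with
  | zero => exact zero
  | add x y hx hy => exact add x y hx hy
  | single c r =>
    have := smul r _ (word c.1 c.2)
    rwa [word_of_isReduced 𝕜 c.2, Finsupp.smul_single_one] at this

theorem act_add (br : V 𝕜 n ⊗[𝕜] V 𝕜 n →ₗ[𝕜] V 𝕜 n) (x y : V 𝕜 n) :
    LieBialg.act br (x + y) = LieBialg.act br x + LieBialg.act br y := by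
  simp only [LieBialg.act, map_add, LinearMap.comp_add, LinearMap.rTensor_add,
      LinearMap.lTensor_add]
  abel

theorem act_smul (br : V 𝕜 n ⊗[𝕜] V 𝕜 n →ₗ[𝕜] V 𝕜 n) (r : 𝕜) (x : V 𝕜 n) :
    LieBialg.act br (r • x) = r • LieBialg.act br x := by
  simp only [LieBialg.act, map_smul, LinearMap.comp_smul, LinearMap.rTensor_smul,
    LinearMap.lTensor_smul, smul_add]

theorem sameCycle_of_fin_one {E : Type} {σ : Equiv.Perm E} {a : Fin 1 → E}
    (h : ∀ e, ∃ i, σ.SameCycle (a i) e) (e f : E) : σ.SameCycle e f := by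
  obtain ⟨i, hi⟩ := h e
  obtain ⟨j, hj⟩ := h f
  obtain rfl := Subsingleton.elim i j
  exact hi.symm.trans hj

/-- Each identity is multilinear, so it suffices to check it on reduced cyclic words, and these are
realized by a family of curves, to which the identity for permutations applies. -/
theorem isInvolutiveLieBialgebra {o : List (Letter n)} (ho : o.Nodup) (hm : ∀ x, x ∈ o) :
    LieBialg.IsInvolutiveLieBialgebra (bracket 𝕜 (o : Cycle (Letter n)))
      (cobracket 𝕜 (o : Cycle (Letter n))) := by
  refine ⟨⟨⟨?_, ?_⟩, ⟨?_, ?_⟩, ?_⟩, ?_⟩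
  · refine ext_word_tmul 𝕜 fun c hc => ext_word 𝕜 fun d hd => ?_
    obtain ⟨E, _, _, inn, out, cl, σ, a, hr, hg, hcl, hne, -⟩ :=
      exists_realizes 𝕜 ho hm (w := ![c, d]) (by simp [Fin.forall_fin_two, hc, hd])
    have h := hr.skew hg (hne 0 1 (by decide))
    rw [hcl, hcl] at h
    exact h
  · refine ext_word_tmul 𝕜 fun c hc => ext_word_tmul 𝕜 fun d hd => ext_word 𝕜 fun e he => ?_
    obtain ⟨E, _, _, inn, out, cl, σ, a, hr, hg, hcl, hne, -⟩ :=
      exists_realizes 𝕜 ho hm (w := ![c, d, e]) (by simp [Fin.forall_fin_succ, hc, hd, he])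
    have h := hr.jacobi hg (hne 0 1 (by decide)) (hne 1 2 (by decide)) (hne 0 2 (by decide))
    rw [hcl, hcl, hcl] at h
    simpa [ε_tmul] using h
  · refine ext_word 𝕜 fun c hc => ?_
    obtain ⟨E, _, _, inn, out, cl, σ, a, hr, hg, hcl, -, -⟩ :=
      exists_realizes 𝕜 ho hm (w := ![c]) (by simp [hc])
    have h := hr.coskew hg σ (a 0)
    rw [hcl] at h
    exact h
  · refine ext_word 𝕜 fun c hc => ?_
    obtain ⟨E, _, _, inn, out, cl, σ, a, hr, hg, hcl, -, hall⟩ :=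
      exists_realizes 𝕜 ho hm (w := ![c]) (by simp [hc])
    have h := hr.cojacobi hg (sameCycle_of_fin_one hall) (a 0)
    rw [hcl] at h
    exact h
  · intro x y
    induction x using induction_word 𝕜 with
    | zero => simp [LieBialg.act]
    | add x x' hx hx' =>
      rw [TensorProduct.add_tmul, map_add, map_add, hx, hx', act_add, map_add, map_add,
        LinearMap.add_apply]
      abel
    | smul r x hx =>
      rw [← TensorProduct.smul_tmul', map_smul, map_smul, hx, act_smul, map_smul, map_smul,
        LinearMap.smul_apply, smul_sub]
    | word c hc => ?_
    induction y using induction_word 𝕜 with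
    | zero => simp [LieBialg.act]
    | add y y' hy hy' =>
      rw [TensorProduct.tmul_add, map_add, map_add, hy, hy', act_add, map_add, map_add,
        LinearMap.add_apply]
      abel
    | smul r y hy =>
      rw [TensorProduct.tmul_smul, map_smul, map_smul, hy, act_smul, map_smul, map_smul,
        LinearMap.smul_apply, smul_sub]
    | word d hd => ?_
    obtain ⟨E, _, _, inn, out, cl, σ, a, hr, hg, hcl, hne, hall⟩ :=
      exists_realizes 𝕜 ho hm (w := ![c, d]) (by simp [Fin.forall_fin_two, hc, hd])
    have h := hr.compat hg (hne 0 1 (by decide)) (fun e => Fin.exists_fin_two.1 (hall e))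
    rw [hcl, hcl] at h
    exact h
  · refine ext_word 𝕜 fun c hc => ?_
    obtain ⟨E, _, _, inn, out, cl, σ, a, hr, hg, hcl, -, hall⟩ :=
      exists_realizes 𝕜 ho hm (w := ![c]) (by simp [hc])
    have h := hr.involutive hg (sameCycle_of_fin_one hall) (a 0)
    rw [hcl] at h
    exact h

end Main

end CyclicWord

theorem mainTheorem1 (𝕜 : Type*) [CommRing 𝕜] (n : ℕ) (O : Cycle (CyclicWord.Letter n))
    (hO : CyclicWord.IsSurfaceSymbol O) :
    -- the cyclic words in the cobracket are reduced
    (∀ (u : List (CyclicWord.Letter n)) (d k : ℕ),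
      CyclicWord.IsReduced (u : Cycle (CyclicWord.Letter n)) → CyclicWord.LP₁ O u d k →
        CyclicWord.IsReduced (CyclicWord.δ₁ O u d k) ∧
        CyclicWord.IsReduced (CyclicWord.δ₂ O u d k)) ∧
    -- the sum in the bracket is finite, and the cyclic words in it are reduced
    (∀ v w : List (CyclicWord.Letter n),
      CyclicWord.IsReduced (v : Cycle (CyclicWord.Letter n)) →
      CyclicWord.IsReduced (w : Cycle (CyclicWord.Letter n)) →
        {k : ℕ | CyclicWord.LP₂ O v w k}.Finite ∧
        ∀ k : ℕ, CyclicWord.LP₂ O v w k → CyclicWord.IsReduced (CyclicWord.γ O v w k)) ∧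
    -- the two structures form an involutive Lie bialgebra
    LieBialg.IsInvolutiveLieBialgebra (CyclicWord.bracket 𝕜 O) (CyclicWord.cobracket 𝕜 O) := by
  obtain ⟨o, rfl⟩ : ∃ o : List (CyclicWord.Letter n), (o : Cycle (CyclicWord.Letter n)) = O :=
    Quot.exists_rep O
  have ho : o.Nodup := hO.1
  have hm : ∀ x, x ∈ o := hO.2
  exact ⟨fun _ _ _ => CyclicWord.isReduced_δ ho hm,
    fun _ _ => CyclicWord.finite_and_isReduced_γ ho hm,
    CyclicWord.isInvolutiveLieBialgebra 𝕜 ho hm⟩
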